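/- Let $R$ be a commutative artinian ring and let $\Lambda$ be a Nakayama algebra over $R$, that is, an $R$-algebra, finitely generated as an $R$-module, such that all indecomposable projective left modules and all indecomposable projective right modules are uniserial. Assume that no simple left $\Lambda$-module is projective. Modules are left $\Lambda$-modules of finite length, unless right modules are mentioned. Let $s$ be the number of isomorphism classes of simple modules and $p$ the minimal length of an indecomposable projective module. The resolution quiver $R(\Lambda)$ has as vertices the isomorphism classes of simple modules, and for each vertex $S$ a unique arrow $S\to\tau\operatorname{soc}P(S)$, where $P(S)$ is the projective cover of $S$ and $\tau=D\operatorname{Tr}$ is the Auslander–Reiten translate. A vertex $S$ is black if the projective dimension of $S$ is at least $2$, and red otherwise. A cycle of $R(\Lambda)$ is an oriented cycle (loops included). The algebra $\Lambda$ is a Gorenstein algebra if it has finite injective dimension both as a left and as a right module over itself. A module $M$ is Gorenstein projective if there is an exact complex $P_\bullet=(P_i,\delta_i)_{i\in\mathbb Z}$ of projective modules of finite length, with $\delta_i\colon P_i\to P_{i-1}$, such that $\operatorname{Hom}_\Lambda(P_\bullet,\Lambda)$ is exact and $M\cong\operatorname{Im}\delta_0$. The algebra $\Lambda$ is CM-free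 if every Gorenstein projective module is projective. (a) If $p>s$, then $\Lambda$ is a Gorenstein algebra if and only if every cycle of $R(\Lambda)$ contains only black vertices. (b) If $p>s$, then $\Lambda$ is CM-free if and only if every cycle of $R(\Lambda)$ contains at least one red vertex. Moreover, even without the assumption $p>s$: if every cycle of $R(\Lambda)$ contains at least one red vertex, then $\Lambda$ is CM-free. -/

import Mathlib

universe u v

open CategoryTheory MulOpposite

namespace NakayamaGP

section Modules

variable (A : Type u) [Ring A]

/-- A module is indecomposable: it is nonzero and has no nontrivial direct sum decomposition. -/
def IsIndecomposable (M : Type u) [AddCommGroup M] [Module A M] : Prop :=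
  Nontrivial M ∧ ∀ p q : Submodule A M, IsCompl p q → p = ⊥ ∨ q = ⊥

/-- A module is uniserial: its submodules form a chain. -/
def IsUniserial (M : Type u) [AddCommGroup M] [Module A M] : Prop :=
  ∀ p q : Submodule A M, p ≤ q ∨ q ≤ p

/-- All finitely generated indecomposable projective (left) `A`-modules are uniserial. -/
def IsLeftSerial : Prop :=
  ∀ (P : Type u) [AddCommGroup P] [Module A P], Module.Finite A P → Module.Projective A P →
    IsIndecomposable A P → IsUniserial A P

/-- The indecomposable projective left modules and the indecomposable projective right modules
are uniserial (right `A`-modules are modules over `Aᵐᵒᵖ`). An artin algebra with this property is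
a Nakayama algebra. -/
def IsNakayama : Prop := IsLeftSerial A ∧ IsLeftSerial Aᵐᵒᵖ

/-- There is no simple projective left `A`-module. -/
def NoSimpleProjective : Prop :=
  ∀ (S : Type u) [AddCommGroup S] [Module A S], IsSimpleModule A S → ¬ Module.Projective A S

/-- The minimal length `p` of an indecomposable projective left `A`-module. -/
noncomputable def minProjLength : ℕ∞ :=
  sInf {n | ∃ P : ModuleCat.{u} A, Module.Finite A P ∧ Module.Projective A P ∧
    IsIndecomposable A P ∧ Module.length A P = n}

/-- Isomorphism of simple modules. -/
def simpleSetoid : Setoid {S : ModuleCat.{u} A // IsSimpleModule A S} where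
  r S T := Nonempty (S.1 ≃ₗ[A] T.1)
  iseqv :=
    ⟨fun _ => ⟨LinearEquiv.refl _ _⟩, fun ⟨e⟩ => ⟨e.symm⟩, fun ⟨e⟩ ⟨f⟩ => ⟨e.trans f⟩⟩

/-- The isomorphism classes of simple left `A`-modules. -/
def SimpleClass : Type (u + 1) := Quotient (simpleSetoid A)

/-- The isomorphism class of a simple module. -/
def SimpleClass.mk (S : {S : ModuleCat.{u} A // IsSimpleModule A S}) : SimpleClass A :=
  Quotient.mk (simpleSetoid A) S

/-- The number `s` of (isomorphism classes of) simple left `A`-modules. -/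
noncomputable def numSimples : ℕ∞ := ENat.card (SimpleClass A)

variable {A}

/-- `f : P → M` is a projective cover: `P` is projective, `f` is surjective and the kernel of `f`
is superfluous. -/
structure IsProjectiveCover {P M : Type u} [AddCommGroup P] [Module A P] [AddCommGroup M]
    [Module A M] (f : P →ₗ[A] M) : Prop where
  projective : Module.Projective A P
  surjective : Function.Surjective f
  superfluous : ∀ N : Submodule A P, N ⊔ LinearMap.ker f = ⊤ → N = ⊤

/-- The socle: the sum of all simple submodules. -/
def socle (A : Type u) [Ring A] (M : Type u) [AddCommGroup M] [Module A M] : Submodule A M :=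
  sSup {N : Submodule A M | IsSimpleModule A N}

/-- For `f : P₁ → P₀`, the cokernel of `Hom(f, A) : Hom(P₀, A) → Hom(P₁, A)`, a right `A`-module.
If `P₁ → P₀ → M → 0` is a minimal projective presentation, this is the transpose `Tr M`. -/
abbrev Transpose {P₁ P₀ : Type u} [AddCommGroup P₁] [Module A P₁] [AddCommGroup P₀] [Module A P₀]
    (f : P₁ →ₗ[A] P₀) : Type u :=
  (P₁ →ₗ[A] A) ⧸ LinearMap.range (LinearMap.lcomp Aᵐᵒᵖ A f)

/-- `J` is an injective envelope of `R / rad R`. -/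
def IsEnvelopeOfTop (R : Type v) [CommRing R] (J : Type v) [AddCommGroup J] [Module R J] : Prop :=
  Module.Injective R J ∧ ∃ ι : (R ⧸ Ring.jacobson R) →ₗ[R] J, Function.Injective ι ∧
    ∀ N : Submodule R J, N ⊓ LinearMap.range ι = ⊥ → N = ⊥

end Modules

section ArtinAlgebra

variable (R : Type v) [CommRing R] {A : Type u} [Ring A] [Algebra R A]

/-- `N` is isomorphic to the Auslander-Reiten translate `τ M = D Tr M`, where `D = Hom_R(-, J)`
with `J` an injective envelope of `R / rad R`. The left module structure of `D X` for a right
module `X` is `(a φ)(x) = φ (x a)`. -/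
def IsARTranslate (M N : Type u) [AddCommGroup M] [Module A M] [AddCommGroup N] [Module A N] :
    Prop :=
  ∃ (P₀ P₁ : ModuleCat.{u} A) (g : P₀ →ₗ[A] M) (h : P₁ →ₗ[A] LinearMap.ker g) (J : ModuleCat.{v} R),
    IsProjectiveCover g ∧ IsProjectiveCover h ∧ IsEnvelopeOfTop R J ∧
    ∃ e : N ≃+ (Transpose ((LinearMap.ker g).subtype ∘ₗ h) →ₗ[R] J),
      ∀ (a : A) (n : N) (x : Transpose ((LinearMap.ker g).subtype ∘ₗ h)),
        e (a • n) x = e n (op a • x)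

/-- The arrows of the resolution quiver, whose vertices are the isomorphism classes of simple
modules: there is an arrow `S → T` if and only if `T ≅ τ (soc P(S))`, with `P(S)` the projective
cover of `S`. -/
def ResolutionArrow (a b : SimpleClass A) : Prop :=
  ∃ S T : {S : ModuleCat.{u} A // IsSimpleModule A S},
    SimpleClass.mk A S = a ∧ SimpleClass.mk A T = b ∧
    ∃ (P : ModuleCat.{u} A) (f : P →ₗ[A] S.1),
      IsProjectiveCover f ∧ IsARTranslate R (A := A) (socle A P) T.1

/-- The (oriented) cycles of the resolution quiver: nonempty, with distinct vertices. Loops are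
cycles with one vertex. -/
def IsResolutionCycle (c : Cycle (SimpleClass A)) : Prop :=
  c ≠ Cycle.nil ∧ c.Nodup ∧ c.Chain (ResolutionArrow R)

end ArtinAlgebra

section Homological

variable {A : Type u} [Ring A]

/-- A vertex is black if the simple module has projective dimension at least 2. -/
def IsBlack (a : SimpleClass A) : Prop :=
  ∃ S : {S : ModuleCat.{u} A // IsSimpleModule A S},
    SimpleClass.mk A S = a ∧ 2 ≤ projectiveDimension S.1

/-- A vertex is red if it is not black. -/
def IsRed (a : SimpleClass A) : Prop := ¬ IsBlack a

variable (A)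

/-- `A` has finite injective dimension as a left module and as a right module. -/
def IsGorensteinAlgebra : Prop :=
  injectiveDimension (ModuleCat.of A A) ≠ ⊤ ∧
    injectiveDimension (ModuleCat.of Aᵐᵒᵖ A) ≠ ⊤

/-- `M` is Gorenstein projective: it is isomorphic to the image of a differential of a complete
projective resolution, that is of an exact complex `⋯ → P (i + 1) → P i → ⋯`, indexed by `ℤ`, of
finitely generated projective modules that stays exact under `Hom_A(-, A)`. -/
def IsGorensteinProjective (M : Type u) [AddCommGroup M] [Module A M] : Prop :=
  ∃ (P : ℤ → ModuleCat.{u} A) (d : ∀ i, P (i + 1) →ₗ[A] P i),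
    (∀ i, Module.Finite A (P i) ∧ Module.Projective A (P i)) ∧
    (∀ i, Function.Exact (d (i + 1)) (d i)) ∧
    (∀ i, Function.Exact (fun φ : P i →ₗ[A] A => φ ∘ₗ d i)
      (fun φ : P (i + 1) →ₗ[A] A => φ ∘ₗ d (i + 1))) ∧
    Nonempty (M ≃ₗ[A] LinearMap.range (d (-1)))

/-- Every Gorenstein projective module is projective. -/
def IsCMFree : Prop :=
  ∀ (M : Type u) [AddCommGroup M] [Module A M],
    IsGorensteinProjective A M → Module.Projective A M

end Homological

end NakayamaGP

-- Everything is read off from one permutation and one length function. For each class `i` of simple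
-- modules choose a primitive idempotent `e i`. Since no simple module is projective, the radical of
-- `A e i` is generated by a nonzero arrow, which can be taken in `e (σ i) A e i`. Uniseriality of
-- the right projectives makes `σ` a permutation and the same arrows generators of the right
-- radicals (`exists_serialData`). Every nonzero element of `A e i` is then a path followed by a
-- left invertible element (`left_form`).
--
-- Let `c i` be the least length of a vanishing path from `i`, and write `(i, n)` for `A e i / A
-- path i n`. Its syzygy is `(σ ^ n i, c i - n)`, so its second syzygy has top `next i = σ ^ c i i`.
-- This is the arrow of the resolution quiver: the socle of the projective at `i` sits at `σ ^ (c i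
-- - 1) i`, and `τ` moves a simple module by `σ` (`resolutionArrow_iff`). The radical of `A e i` is
-- a quotient of `A e (σ i)`, so `i` is red exactly when `c (σ i) = c i - 1`, and black when `c i ≤
-- c (σ i)` (`isBlack_iff`). Blackness of `i` is also equivalent to `Ext^1((i, n), A) = 0` for each
-- `0 < n < c i`. Dimension shifting turns all groups `Ext^(k+1)((i, n), A)` into questions about
-- the colours met along iterated syzygies (`IsGenerator.extVanishes_iff`).
--
-- Gorenstein property. If all periodic vertices of `next` are black, the high `Ext` groups from
-- simple modules to `A` vanish, so `A` has finite left injective dimension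
-- (`exists_hasInjectiveDimensionLE`). The right-hand side follows from a combinatorial symmetry:
-- the length functions of the two sides define adjoint monotone maps of `ℤ`, and strict growth
-- along periodic orbits passes to the adjoint (`op_black_of_black`). Conversely, when `p > s`, the
-- period `t` of `i` under `σ` is less than every `c j`. Then `(i, t)` has second syzygy `(next i,
-- t)`, so the colour of a periodic `i` reappears in arbitrarily high `Ext` groups
-- (`black_of_hasInjectiveDimensionLE`).
--
-- CM-freeness. A Gorenstein projective module has no positive extensions with `A`. If it is not
-- projective, it has a summand `(i, n)` with `0 < n < c i`, and all vertices `next^k i` must be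
-- black; this forces a black cycle (`projective_of_extVanishes`). Conversely, around a black cycle
-- the paths of lengths `t` and `c j - t` alternate to form a complete resolution with a
-- nonprojective image (`exists_isGorensteinProjective`).

universe w

/-! ### Serial data: paths, normal forms of elements, and annihilators of paths. -/

namespace NakayamaGP

/-- The product of `n` consecutive arrows starting at `i`. -/
def arrowPath {A : Type u} [Ring A] {ι : Type w} (σ : Equiv.Perm ι) (e arr : ι → A) : ℕ → ι → A
  | 0, i => e i
  | n + 1, i => arrowPath σ e arr n (σ i) * arr i

/-- Idempotents `e i` and arrows `arr i` from `i` to `σ i` which control the one-sided ideals of a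
Nakayama ring: every element of `A e i` generates `A e i` or is a left multiple of `arr i`, and
every element of `e (σ i) A` generates `e (σ i) A` or is a right multiple of `arr i`. -/
structure SerialData (A : Type u) [Ring A] (ι : Type w) where
  e : ι → A
  σ : Equiv.Perm ι
  arr : ι → A
  e_mul_e : ∀ i, e i * e i = e i
  arr_ne_zero : ∀ i, arr i ≠ 0
  e_mul_arr : ∀ i, e (σ i) * arr i = arr i
  arr_mul_e : ∀ i, arr i * e i = arr i
  left_gen : ∀ i u, u * e i = u → (∃ v, v * u = e i) ∨ ∃ v, u = v * arr i
  right_gen : ∀ i u, e (σ i) * u = u → (∃ v, u * v = e (σ i)) ∨ ∃ v, u = arr i * v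
  nil : ∀ i t, IsNilpotent (arr i * t)
  iso_eq : ∀ i j u v, v * e j * u = e i → i = j
  full : (1 : A) ∈ AddSubmonoid.closure {x | ∃ u i v, x = u * e i * v}
  path_nil : ∃ n, ∀ i, arrowPath σ e arr n i = 0

lemma isNilpotent_mul_swap {A : Type u} [Ring A] {a b : A} (h : IsNilpotent (a * b)) :
    IsNilpotent (b * a) := by
  obtain ⟨n, hn⟩ := h
  refine ⟨n + 1, ?_⟩
  have : ∀ n : ℕ, (b * a) ^ (n + 1) = b * (a * b) ^ n * a := by
    intro n
    induction n with
    | zero => simp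
    | succ n ih => rw [pow_succ, ih, pow_succ (a * b)]; noncomm_ring
  rw [this, hn]; simp

lemma eq_zero_of_eq_mul_nilpotent {A : Type u} [Ring A] {y z : A} (h : y = y * z)
    (hz : IsNilpotent z) : y = 0 := by
  obtain ⟨n, hn⟩ := hz
  have : ∀ n : ℕ, y = y * z ^ n := by
    intro n
    induction n with
    | zero => simp
    | succ n ih => rw [pow_succ, ← mul_assoc, ← ih, ← h]
  rw [this n, hn, mul_zero]

lemma eq_zero_of_eq_mul_mul {A : Type u} [Ring A] {p w g : A} (h : p = w * p * g)
    (hw : IsNilpotent w) : p = 0 := by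
  obtain ⟨n, hn⟩ := hw
  have : ∀ n : ℕ, p = w ^ n * p * g ^ n := by
    intro n
    induction n with
    | zero => simp
    | succ n ih =>
      calc p = w ^ n * p * g ^ n := ih
        _ = w ^ n * (w * p * g) * g ^ n := by rw [← h]
        _ = _ := by rw [pow_succ, pow_succ']; noncomm_ring
  rw [this n, hn, zero_mul, zero_mul]

namespace SerialData

variable {A : Type u} [Ring A] {ι : Type w} (D : SerialData A ι)

/-- The path of length `n` starting at `i`. -/
def path (i : ι) (n : ℕ) : A := arrowPath D.σ D.e D.arr n i

@[simp] lemma path_zero (i : ι) : D.path i 0 = D.e i := rfl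

lemma path_succ (i : ι) (n : ℕ) : D.path i (n + 1) = D.path (D.σ i) n * D.arr i := rfl

@[simp] lemma path_mul_e (i : ι) (n : ℕ) : D.path i n * D.e i = D.path i n := by
  cases n with
  | zero => exact D.e_mul_e i
  | succ n => rw [path_succ, mul_assoc, D.arr_mul_e]

@[simp] lemma e_mul_path (i : ι) (n : ℕ) : D.e ((D.σ ^ n) i) * D.path i n = D.path i n := by
  induction n generalizing i with
  | zero => exact D.e_mul_e i
  | succ n ih =>
    rw [path_succ, ← mul_assoc, pow_succ, Equiv.Perm.mul_apply, ih]

lemma path_add (i : ι) (m n : ℕ) :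
    D.path i (m + n) = D.path ((D.σ ^ m) i) n * D.path i m := by
  induction m generalizing i with
  | zero => simp
  | succ m ih =>
    rw [show m + 1 + n = (m + n) + 1 by ring, path_succ, ih, path_succ, mul_assoc, pow_succ,
      Equiv.Perm.mul_apply]

lemma path_one (i : ι) : D.path i 1 = D.arr i := by
  rw [path_succ, path_zero, D.e_mul_arr]

lemma path_succ' (i : ι) (n : ℕ) : D.path i (n + 1) = D.arr ((D.σ ^ n) i) * D.path i n := by
  rw [path_add, path_one]

lemma exists_path_eq_zero (i : ι) : ∃ n, D.path i n = 0 :=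
  D.path_nil.imp fun _ h => h i

open Classical in
/-- The length of the projective module `A e i`. -/
noncomputable def c (i : ι) : ℕ := Nat.find (D.exists_path_eq_zero i)

lemma path_eq_zero_of_le {i : ι} {m n : ℕ} (h : D.path i m = 0) (hmn : m ≤ n) :
    D.path i n = 0 := by
  obtain ⟨k, rfl⟩ := Nat.exists_eq_add_of_le hmn
  rw [path_add, h, mul_zero]

lemma path_eq_zero_iff {i : ι} {n : ℕ} : D.path i n = 0 ↔ D.c i ≤ n := by
  classical
  exact ⟨fun h => Nat.find_min' _ h,
    fun h => D.path_eq_zero_of_le (Nat.find_spec (D.exists_path_eq_zero i)) h⟩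

lemma path_ne_zero_iff {i : ι} {n : ℕ} : D.path i n ≠ 0 ↔ n < D.c i := by
  rw [Ne, path_eq_zero_iff, not_le]

lemma e_ne_zero (i : ι) : D.e i ≠ 0 := fun h => D.arr_ne_zero i (by rw [← D.arr_mul_e, h, mul_zero])

lemma one_lt_c (i : ι) : 1 < D.c i := by
  rw [← path_ne_zero_iff, path_one]; exact D.arr_ne_zero i

lemma c_pos (i : ι) : 0 < D.c i := (Nat.zero_lt_one).trans (D.one_lt_c i)

lemma c_le (i : ι) : D.c i ≤ D.c (D.σ i) + 1 := by
  rw [← path_eq_zero_iff, path_succ, D.path_eq_zero_iff.2 le_rfl, zero_mul]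

lemma c_le_add (i : ι) (n : ℕ) : D.c i ≤ D.c ((D.σ ^ n) i) + n := by
  rw [← path_eq_zero_iff, add_comm, path_add, D.path_eq_zero_iff.2 le_rfl, zero_mul]

lemma arrowPath_op (σ : Equiv.Perm ι) (e arr : ι → A) (hl : ∀ i, e (σ i) * arr i = arr i)
    (hr : ∀ i, arr i * e i = arr i) (n : ℕ) (i : ι) :
    arrowPath σ⁻¹ (fun i => op (e i)) (fun i => op (arr (σ⁻¹ i))) n i =
      op (arrowPath σ e arr n ((σ⁻¹ ^ n) i)) := by
  have key : ∀ n i, arrowPath σ e arr (n + 1) i = arr ((σ ^ n) i) * arrowPath σ e arr n i := by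
    intro n
    induction n with
    | zero => intro i; simp [arrowPath, hl, hr]
    | succ n ih =>
      intro i
      rw [arrowPath, ih, arrowPath, mul_assoc, pow_succ, Equiv.Perm.mul_apply]
  induction n generalizing i with
  | zero => rfl
  | succ n ih =>
    rw [arrowPath, ih, key, op_mul, ← Equiv.Perm.mul_apply, ← pow_succ]
    congr 3
    rw [← Equiv.Perm.mul_apply]
    congr 1
    group

/-- The opposite data, for the opposite ring. -/
def op : SerialData Aᵐᵒᵖ ι where
  e i := MulOpposite.op (D.e i)
  σ := D.σ⁻¹
  arr i := MulOpposite.op (D.arr (D.σ⁻¹ i))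
  e_mul_e i := by rw [← op_mul, D.e_mul_e]
  arr_ne_zero i := by simpa using D.arr_ne_zero _
  e_mul_arr i := by rw [← op_mul, D.arr_mul_e]
  arr_mul_e i := by
    rw [← op_mul]
    congr 1
    simpa using D.e_mul_arr (D.σ⁻¹ i)
  left_gen i u hu := by
    have := D.right_gen (D.σ⁻¹ i) u.unop (by simpa using congrArg unop hu)
    rw [show D.σ (D.σ⁻¹ i) = i from D.σ.apply_symm_apply i] at this
    refine this.imp ?_ ?_
    · rintro ⟨v, hv⟩; exact ⟨MulOpposite.op v, by rw [← hv]; rfl⟩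
    · rintro ⟨v, hv⟩; exact ⟨MulOpposite.op v, unop_injective hv⟩
  right_gen i u hu := by
    have := D.left_gen (D.σ⁻¹ i) u.unop (by simpa using congrArg unop hu)
    refine this.imp ?_ ?_
    · rintro ⟨v, hv⟩; exact ⟨MulOpposite.op v, by rw [← hv]; rfl⟩
    · rintro ⟨v, hv⟩; exact ⟨MulOpposite.op v, unop_injective hv⟩
  nil i t := by
    obtain ⟨n, hn⟩ := isNilpotent_mul_swap (D.nil (D.σ⁻¹ i) t.unop)
    exact ⟨n, unop_injective (by simpa using hn)⟩
  iso_eq i j u v h := D.iso_eq i j v.unop u.unop (by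
    have := congrArg unop h
    simpa [mul_assoc] using this)
  full := by
    have h := AddSubmonoid.mem_map_of_mem
      (opAddEquiv : A ≃+ Aᵐᵒᵖ).toAddMonoidHom D.full
    rw [AddMonoidHom.map_mclosure] at h
    refine AddSubmonoid.closure_mono ?_ h
    rintro _ ⟨_, ⟨u, i, v, rfl⟩, rfl⟩
    exact ⟨MulOpposite.op v, i, MulOpposite.op u, by simp [mul_assoc]⟩
  path_nil := D.path_nil.imp fun n hn i => by
    rw [arrowPath_op _ _ _ D.e_mul_arr D.arr_mul_e, hn, op_zero]

lemma op_path (i : ι) (n : ℕ) :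
    D.op.path i n = MulOpposite.op (D.path ((D.σ⁻¹ ^ n) i) n) :=
  arrowPath_op _ _ _ D.e_mul_arr D.arr_mul_e n i

/-- Nonzero elements of `A e i` are, up to left invertible elements, paths. -/
lemma left_form {i : ι} {x f : A} (hx : x * D.e i = x) (h0 : x ≠ 0) (hf : f * f = f)
    (hfx : f * x = x) : ∃ d < D.c i, ∃ u v, x = u * D.path i d ∧ v * u = D.e ((D.σ ^ d) i) ∧
      u * D.e ((D.σ ^ d) i) = u ∧ f * u = u := by
  classical
  -- Divide `x` by the longest possible path. The quotient is not a left multiple of the next arrow,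
  -- so `left_gen` makes it left invertible.
  have hP : ∃ n, ¬ ∃ u, x = u * D.path i n :=
    ⟨D.c i, fun ⟨u, hu⟩ => h0 (by rw [hu, D.path_eq_zero_iff.2 le_rfl, mul_zero])⟩
  have h1 := Nat.find_spec hP
  have h2 : ∀ m < Nat.find hP, ∃ u, x = u * D.path i m := fun m hm =>
    not_not.1 (Nat.find_min hP hm)
  generalize Nat.find hP = n at h1 h2
  cases n with
  | zero => exact absurd ⟨x, by simp [hx]⟩ h1
  | succ d =>
    obtain ⟨u, hu⟩ := h2 d (Nat.lt_succ_self d)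
    have hu' : x = (f * u * D.e ((D.σ ^ d) i)) * D.path i d := by
      rw [mul_assoc, e_mul_path, mul_assoc, ← hu, hfx]
    refine ⟨d, ?_, f * u * D.e ((D.σ ^ d) i), ?_⟩
    · rw [← path_ne_zero_iff]
      intro h
      rw [h, mul_zero] at hu
      exact h0 hu
    · rcases D.left_gen ((D.σ ^ d) i) (f * u * D.e ((D.σ ^ d) i))
        (by rw [mul_assoc, D.e_mul_e]) with ⟨v, hv⟩ | ⟨v, hv⟩
      · exact ⟨v, hu', hv, by rw [mul_assoc, D.e_mul_e], by simp only [← mul_assoc, hf]⟩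
      · exact absurd ⟨v, by rw [hu', hv, path_succ', mul_assoc]⟩ h1

lemma right_form {k : ι} {x f : A} (hx : D.e k * x = x) (h0 : x ≠ 0) (hf : f * f = f)
    (hfx : x * f = x) : ∃ d j, (D.σ ^ d) j = k ∧ d < D.c j ∧ ∃ u v, x = D.path j d * u ∧
      u * v = D.e j ∧ D.e j * u = u ∧ u * f = u := by
  obtain ⟨d, hd, u, v, h1, h2, h3, h4⟩ := D.op.left_form (i := k) (x := MulOpposite.op x)
    (f := MulOpposite.op f) (congrArg MulOpposite.op hx) (by simpa using h0)
    (congrArg MulOpposite.op hf) (congrArg MulOpposite.op hfx)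
  rw [op_path] at h1
  refine ⟨d, (D.σ⁻¹ ^ d) k, ?_, ?_, u.unop, v.unop, congrArg unop h1, congrArg unop h2,
    congrArg unop h3, congrArg unop h4⟩
  · rw [← Equiv.Perm.mul_apply]; simp
  · rw [← path_ne_zero_iff]
    intro h
    rw [h] at h1
    exact h0 (by simpa using congrArg unop h1)

lemma not_isNilpotent_e (i : ι) : ¬ IsNilpotent (D.e i) := by
  intro h
  exact D.e_ne_zero i (eq_zero_of_eq_mul_nilpotent (D.e_mul_e i).symm h)

/-- One-sided inverses in the local ring `e i A e i` are two-sided. -/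
lemma mul_eq_e_swap {i : ι} {u v : A} (hu : D.e i * u = u) (hv : v * D.e i = v)
    (hv' : D.e i * v = v) (h : v * u = D.e i) : u * v = D.e i := by
  rcases D.left_gen i v hv with ⟨w, hw⟩ | ⟨w, hw⟩
  · have : w * D.e i = u := by rw [← h, ← mul_assoc, hw, hu]
    rw [← this, mul_assoc, hv', hw]
  · exfalso
    rw [hw, mul_assoc] at h
    refine D.not_isNilpotent_e i ?_
    rw [← h]
    apply isNilpotent_mul_swap
    rw [mul_assoc]
    exact D.nil _ _

/-- Nonzero elements of `e k A e i` are paths, up to units on either side. -/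
lemma two_sided_form {i k : ι} {x : A} (hx : x * D.e i = x) (hx' : D.e k * x = x) (h0 : x ≠ 0) :
    ∃ d < D.c i, (D.σ ^ d) i = k ∧
      (∃ u v, x = u * D.path i d ∧ v * u = D.e k ∧ u * v = D.e k ∧ D.e k * u = u ∧ u * D.e k = u) ∧
      ∃ u, x = D.path i d * u ∧ D.e i * u = u := by
  obtain ⟨d, hd, u, v, h1, h2, h3, h4⟩ := D.left_form hx h0 (D.e_mul_e k) hx'
  have hk : (D.σ ^ d) i = k := D.iso_eq _ k u v (by rw [mul_assoc, h4, h2])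
  rw [hk] at h2 h3
  obtain ⟨n, j, hj, hn, g, h, k1, k2, k3, k4⟩ := D.right_form hx' h0 (D.e_mul_e i) hx
  have hji : j = i := D.iso_eq j i h g (by rw [k4, k2])
  subst hji
  have hv2 : (D.e k * v * D.e k) * u = D.e k := by rw [mul_assoc, h4, mul_assoc, h2, D.e_mul_e]
  refine ⟨d, hd, hk, ⟨u, D.e k * v * D.e k, h1, hv2,
    D.mul_eq_e_swap h4 (by rw [mul_assoc, D.e_mul_e])
      (by rw [← mul_assoc, ← mul_assoc, D.e_mul_e]) hv2, h4, h3⟩, g, ?_, k3⟩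
  suffices n = d by rw [← this, k1]
  have hvx : v * x = D.path j d := by rw [h1, ← mul_assoc, h2, ← hk, e_mul_path]
  have hxh : x * h = D.path j n := by rw [k1, mul_assoc, k2, path_mul_e]
  -- The lengths in the left and right normal forms agree: a path that factors through a longer one
  -- from the same vertex equals itself times a nilpotent element on the left, hence vanishes.
  have key : ∀ {m n : ℕ} {a b : A}, m < n → D.path j m = a * D.path j n * b → D.path j m = 0 := by
    intro m n a b hmn h
    obtain ⟨t, rfl⟩ := Nat.exists_eq_add_of_lt hmn
    refine eq_zero_of_eq_mul_mul (w := a * D.path ((D.σ ^ m) j) (t + 1)) (g := b) ?_ ?_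
    · rw [add_assoc, path_add] at h
      rw [mul_assoc a, ← h]
    · rw [path_succ, ← mul_assoc]
      exact isNilpotent_mul_swap (D.nil _ _)
  rcases lt_trichotomy n d with hnd | hnd | hnd
  · exact absurd (key hnd (a := u) (b := h) (by rw [← h1, hxh])) (D.path_ne_zero_iff.2 hn)
  · exact hnd
  · exact absurd (key hnd (a := v) (b := g) (by rw [mul_assoc, ← k1, hvx])) (D.path_ne_zero_iff.2 hd)

/-- A path of length `d` ending at `i` is one starting at `σ⁻¹ ^ d i`. Along a `σ`-orbit this is the
adjunction between the left and right length functions. -/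
lemma c_le_iff_op (i : ι) (d : ℕ) : D.op.c i ≤ d ↔ D.c ((D.σ⁻¹ ^ d) i) ≤ d := by
  rw [← path_eq_zero_iff, ← path_eq_zero_iff, op_path]
  simp

/-- This computes syzygies: right multiplication by a path of length `n` has kernel generated by the
path of complementary length, by the normal form of `x`. -/
lemma mul_path_eq_zero_iff {i k : ι} {x : A} {n : ℕ} (hk : (D.σ ^ n) i = k) (hn : n ≤ D.c i)
    (hx : x * D.e k = x) : x * D.path i n = 0 ↔ ∃ v, x = v * D.path k (D.c i - n) := by
  constructor
  · intro h
    by_cases h0 : x = 0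
    · exact ⟨0, by rw [h0, zero_mul]⟩
    obtain ⟨d, hd, u, v, h1, h2, -⟩ := D.left_form hx h0 (one_mul 1) (one_mul x)
    subst hk
    have : D.path i (n + d) = 0 := by
      rw [path_add, ← D.e_mul_path ((D.σ ^ n) i), ← h2, mul_assoc v, ← h1, mul_assoc, h, mul_zero]
    rw [path_eq_zero_iff] at this
    obtain ⟨t, rfl⟩ := Nat.exists_eq_add_of_le (show D.c i - n ≤ d by omega)
    exact ⟨u * D.path ((D.σ ^ (D.c i - n)) ((D.σ ^ n) i)) t, by rw [h1, path_add, mul_assoc]⟩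
  · rintro ⟨v, rfl⟩
    subst hk
    rw [mul_assoc, ← path_add, Nat.add_sub_cancel' hn, D.path_eq_zero_iff.2 le_rfl, mul_zero]

/-- The map sending `i` to the vertex `τ soc P(i)` of the resolution quiver. -/
noncomputable def next (i : ι) : ι := (D.σ ^ D.c i) i

/-- The combinatorial form of the condition that the simple module at `i` has projective dimension
at least two. -/
def Black (i : ι) : Prop := D.c i ≤ D.c (D.σ i)

/-- A shorter left factor of `y` would be a path of length `m < n` ending at `k`, so starting at
some `σ ^ (t + 1) i`. Its extension by `c i - n` would vanish, although lengths drop by at most one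
per step after `σ i`, where by blackness they are still at least `c i`. -/
lemma exists_eq_path_mul {i k : ι} {n : ℕ} {y : A} (hi : D.Black i) (hk : (D.σ ^ n) i = k)
    (hn : n < D.c i) (hy : D.e k * y = y) (h : D.path k (D.c i - n) * y = 0) :
    ∃ t, y = D.path i n * t := by
  by_cases h0 : y = 0
  · exact ⟨0, by rw [h0, mul_zero]⟩
  obtain ⟨m, z, hz, hm, u, v, h1, h2, -⟩ := D.right_form hy h0 (one_mul 1) (mul_one y)
  rcases le_or_gt n m with hnm | hnm
  · obtain ⟨t, rfl⟩ := Nat.exists_eq_add_of_le hnm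
    have : (D.σ ^ t) z = i := by
      apply (D.σ ^ n).injective
      rw [← Equiv.Perm.mul_apply, ← pow_add, hz, hk]
    exact ⟨D.path z t * u, by rw [h1, ← mul_assoc, add_comm n t, path_add, this]⟩
  · exfalso
    obtain ⟨t, rfl⟩ := Nat.exists_eq_add_of_lt hnm
    have hzi : z = (D.σ ^ (t + 1)) i := by
      apply (D.σ ^ m).injective
      rw [← Equiv.Perm.mul_apply, ← pow_add, hz, ← hk, add_assoc]
    have : D.path z (m + (D.c i - (m + t + 1))) = 0 := by
      rw [path_add, hz, ← D.path_mul_e z m, ← h2, ← mul_assoc (D.path z m), ← h1, ← mul_assoc, h,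
        zero_mul]
    rw [path_eq_zero_iff] at this
    have h3 := D.c_le_add (D.σ i) t
    rw [← Equiv.Perm.mul_apply, ← pow_succ, ← hzi] at h3
    have h4 : D.c i ≤ D.c (D.σ i) := hi
    omega

/-- The witness is the path of length `n - 1` from `σ i`. For red `i` its extension by `c i - n`
already vanishes, while being a right multiple of `path i n` would make it a multiple of itself by a
nilpotent element. -/
lemma exists_ne_path_mul {i : ι} {n : ℕ} (hi : ¬ D.Black i) (h0 : 0 < n) (hn : n < D.c i) :
    ∃ y, D.e ((D.σ ^ n) i) * y = y ∧ D.path ((D.σ ^ n) i) (D.c i - n) * y = 0 ∧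
      ∀ t, y ≠ D.path i n * t := by
  obtain ⟨m, rfl⟩ := Nat.exists_eq_succ_of_ne_zero h0.ne'
  have hk : (D.σ ^ (m + 1)) i = (D.σ ^ m) (D.σ i) := by rw [pow_succ, Equiv.Perm.mul_apply]
  have hi' : D.c (D.σ i) < D.c i := not_le.1 hi
  simp only [Nat.succ_eq_add_one, hk] at *
  refine ⟨D.path (D.σ i) m, D.e_mul_path _ _, ?_, fun t ht => ?_⟩
  · rw [← path_add, path_eq_zero_iff]
    omega
  · have := D.c_le i
    refine D.path_ne_zero_iff.2 (show m < D.c (D.σ i) by omega) ?_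
    refine eq_zero_of_eq_mul_nilpotent ?_ (D.nil i t)
    rwa [← mul_assoc, ← path_succ]

end SerialData

end NakayamaGP

/-! ### Left-right symmetry: black periodic orbits and adjoint monotone maps of the integers. -/

namespace NakayamaGP

lemma galoisConnection_iterate {α : Type w} [Preorder α] {F G : α → α}
    (h : GaloisConnection F G) (k : ℕ) : GaloisConnection F^[k] G^[k] := by
  induction k with
  | zero => exact GaloisConnection.id
  | succ k ih =>
    rw [Function.iterate_succ F, Function.iterate_succ' G]
    exact h.compose ih

lemma iterate_add_const {F : ℤ → ℤ} {s : ℤ} (hF : ∀ n, F (n + s) = F n + s) (k : ℕ) (n : ℤ) :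
    F^[k] (n + s) = F^[k] n + s := by
  induction k generalizing n with
  | zero => rfl
  | succ k ih => rw [Function.iterate_succ_apply, hF, ih, Function.iterate_succ_apply]

/-- If `F` is strictly increasing at its periodic points modulo `s`, then so is its adjoint. -/
lemma adjoint_lt_of_periodic {F G : ℤ → ℤ} (hgc : GaloisConnection F G) {s : ℤ} (hs : 0 < s)
    (hF : ∀ n, F (n + s) = F n + s) (hG : ∀ n, G (n + s) = G n + s) {k : ℕ} (hk : 0 < k)
    (hper : ∀ y, F^[k] y = y + s → F y < F (y + 1)) {x : ℤ} (hx : G^[k] x = x - s) :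
    G (x - 1) < G x := by
  have hgk := galoisConnection_iterate hgc k
  have hGx : G^[k] (x + s) = x := by rw [iterate_add_const hG, hx]; ring
  -- Adjunction gives `h x ≤ x` and `x + 1 ≤ h (x + 1)`. Hence the iterates of `h` at `x` decrease
  -- but stay above `x + 1 - s`, and they stop at a fixed point `e`, which is periodic for `F`
  -- modulo `s`.
  set h : ℤ → ℤ := fun n => F^[k] n - s with hdef
  have hmono : Monotone h := fun a b hab => sub_le_sub_right (hgk.monotone_l hab) s
  have hshift : ∀ n, h (n + s) = h n + s := fun n => by
    simp only [hdef, iterate_add_const hF]; ring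
  have h1 : h x ≤ x := by
    have := (hgk x (x + s)).2 hGx.ge
    simp only [hdef]; omega
  have h2 : x + 1 ≤ h (x + 1) := by
    by_contra hcon
    have := (hgk (x + 1) (x + s)).1 (by simp only [hdef] at hcon; omega)
    omega
  have h2' : x + 1 - s ≤ h (x + 1 - s) := by
    have := hshift (x + 1 - s)
    rw [sub_add_cancel] at this
    omega
  have hlow : ∀ m, x + 1 - s ≤ h^[m] x := by
    intro m
    have h3 : x + 1 - s ≤ h^[m] (x + 1 - s) := by
      induction m with
      | zero => rfl
      | succ m ih =>
        rw [Function.iterate_succ_apply']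
        exact h2'.trans (hmono ih)
    exact h3.trans (hmono.iterate m (by omega))
  obtain ⟨m, hm⟩ : ∃ m, h^[m + 1] x = h^[m] x := by
    by_contra! hne
    have hdec : ∀ m : ℕ, h^[m] x ≤ x - m := by
      intro m
      induction m with
      | zero => simp
      | succ m ih =>
        have h3 : h^[m + 1] x ≤ h^[m] x := by
          rw [Function.iterate_succ_apply]
          exact hmono.iterate m h1
        have h4 := hne m
        push_cast
        omega
    have h3 := hdec s.toNat
    have h4 := hlow s.toNat
    omega
  obtain ⟨e, he⟩ : ∃ e, e = h^[m] x := ⟨_, rfl⟩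
  rw [Function.iterate_succ_apply', ← he] at hm
  have hFe : F^[k] e = e + s := by simp only [hdef] at hm; omega
  -- Each `F^[j] e` is again periodic, so strict growth applies at every stage of the orbit.
  have hstep : ∀ j, F^[j] e + 1 ≤ F^[j] (e + 1) := by
    intro j
    induction j with
    | zero => rfl
    | succ j ih =>
      rw [Function.iterate_succ_apply', Function.iterate_succ_apply']
      refine le_trans (hper (F^[j] e) ?_) (hgc.monotone_l ih)
      rw [← Function.iterate_add_apply, add_comm, Function.iterate_add_apply, hFe,
        iterate_add_const hF]
  have h3 : ∀ m, e + 1 ≤ h^[m] (e + 1) := by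
    intro m
    induction m with
    | zero => rfl
    | succ m ih =>
      rw [Function.iterate_succ_apply']
      refine le_trans ?_ (hmono ih)
      have := hstep k
      simp only [hdef]; omega
  -- If `e < x`, then `e + 1 ≤ h^[m] (e + 1) ≤ h^[m] x = e`, which is absurd. So `x` itself is
  -- periodic for `F`.
  have hex : e = x := by
    have hle : e ≤ x := by
      rw [he]
      clear he h3 hFe hm hstep
      induction m with
      | zero => rfl
      | succ m ih => 
        rw [Function.iterate_succ_apply']
        exact (hmono ih).trans h1
    by_contra hne
    have h4 := hmono.iterate m (show e + 1 ≤ x by omega)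
    have h5 := h3 m
    omega
  subst hex
  obtain ⟨j, rfl⟩ := Nat.exists_eq_succ_of_ne_zero hk.ne'
  -- Periodicity puts `x` in the image of `F`; a preimage lies below `G x` but not below `G (x -
  -- 1)`.
  have hy : F (F^[j] (e - s)) = e := by
    have h4 := iterate_add_const hF (j + 1) (e - s)
    rw [sub_add_cancel, hFe] at h4
    rw [← Function.iterate_succ_apply' F]
    show F^[j + 1] (e - s) = e
    omega
  have h4 : F^[j] (e - s) ≤ G e := (hgc _ _).1 hy.le
  have h5 : ¬ F^[j] (e - s) ≤ G (e - 1) := fun hcon => by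
    have := (hgc _ _).2 hcon
    omega
  omega

namespace SerialData

variable {A : Type u} [Ring A] {ι : Type w} (D : SerialData A ι)

/-- Unroll the `σ`-orbit of `i` along `ℤ`. The maps `n ↦ n + c` and `n ↦ n - c^op` lift `next` and
its opposite and are adjoint. Blackness at `n` says that the first map grows strictly from `n` to `n
+ 1`; blackness on the right says that the second grows strictly from `n - 1` to `n`. -/
lemma op_black_of_black (hD : ∀ i ∈ Function.periodicPts D.next, D.Black i) :
    ∀ i ∈ Function.periodicPts D.op.next, D.op.Black i := by
  rintro i ⟨k, hk, hi⟩
  set F : ℤ → ℤ := fun n => n + D.c ((D.σ ^ n) i) with hF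
  set G : ℤ → ℤ := fun n => n - D.op.c ((D.σ ^ n) i) with hG
  have hgc : GaloisConnection F G := by
    intro n m
    simp only [hF, hG]
    rcases lt_or_ge m n with hmn | hmn
    · have h1 := D.c_pos ((D.σ ^ n) i)
      have h2 := D.op.c_pos ((D.σ ^ m) i)
      constructor <;> intro h <;> omega
    · obtain ⟨d, rfl⟩ := Int.le.dest hmn
      have h := D.c_le_iff_op ((D.σ ^ (n + d)) i) d
      rw [← Equiv.Perm.mul_apply, show D.σ⁻¹ ^ d * D.σ ^ (n + (d : ℤ)) = D.σ ^ n by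
        rw [add_comm, zpow_add, zpow_natCast]; group] at h
      omega
  have hσG : ∀ (j : ℕ) (n : ℤ), (D.σ ^ (G^[j] n)) i = D.op.next^[j] ((D.σ ^ n) i) := by
    intro j
    induction j with
    | zero => intro n; rfl
    | succ j ih =>
      intro n
      rw [Function.iterate_succ_apply, ih, Function.iterate_succ_apply]
      congr 1
      rw [next, ← Equiv.Perm.mul_apply]
      congr 1
      simp only [hG, op]
      rw [sub_eq_add_neg, add_comm, zpow_add, zpow_neg, zpow_natCast, inv_pow]
  have hσF : ∀ (j : ℕ) (n : ℤ), (D.σ ^ (F^[j] n)) i = D.next^[j] ((D.σ ^ n) i) := by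
    intro j
    induction j with
    | zero => intro n; rfl
    | succ j ih =>
      intro n
      rw [Function.iterate_succ_apply, ih, Function.iterate_succ_apply]
      congr 1
      rw [next, ← Equiv.Perm.mul_apply]
      congr 1
      simp only [hF]
      rw [add_comm, zpow_add, zpow_natCast]
  obtain ⟨s, hs⟩ : ∃ s, s = - G^[k] 0 := ⟨_, rfl⟩
  have hsi : (D.σ ^ s) i = i := by
    have h1 : (D.σ ^ (-s)) i = i := by
      rw [hs, neg_neg, hσG, zpow_zero, Equiv.Perm.one_apply]
      exact hi
    conv_lhs => rw [← h1]
    rw [← Equiv.Perm.mul_apply, ← zpow_add]; simp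
  have hsn : ∀ n : ℤ, (D.σ ^ (n + s)) i = (D.σ ^ n) i := fun n => by
    rw [zpow_add, Equiv.Perm.mul_apply, hsi]
  have hs0 : 0 < s := by
    have : ∀ j : ℕ, G^[j] 0 ≤ - j := by
      intro j
      induction j with
      | zero => simp
      | succ j ih =>
        rw [Function.iterate_succ_apply']
        have := D.op.c_pos ((D.σ ^ (G^[j] 0)) i)
        simp only [hG] at ih this ⊢
        push_cast
        omega
    have := this k
    omega
  have := adjoint_lt_of_periodic hgc hs0 (fun n => by simp only [hF, hsn]; ring)
    (fun n => by simp only [hG, hsn]; ring) hk (x := 0) ?_ (by omega)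
  · simp only [hG] at this
    have h0 : (D.σ ^ (0 - 1 : ℤ)) i = D.op.σ i := by simp [op]
    rw [h0] at this
    simp only [zpow_zero, Equiv.Perm.one_apply] at this
    show D.op.c i ≤ D.op.c (D.op.σ i)
    omega
  · intro y hy
    have h1 : D.Black ((D.σ ^ y) i) := hD _ ⟨k, hk, by
      rw [Function.IsPeriodicPt, Function.IsFixedPt, ← hσF, hy, hsn]⟩
    have h2 : D.c ((D.σ ^ y) i) ≤ D.c (D.σ ((D.σ ^ y) i)) := h1
    rw [← Equiv.Perm.mul_apply, ← zpow_one_add, add_comm 1 y] at h2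
    simp only [hF]
    omega

end SerialData

end NakayamaGP

/-! ### Extension groups with the ring, and syzygies of modules with a generator. -/

namespace NakayamaGP

section Ext

variable {A : Type u} [Ring A]

/-- The vanishing of `Ext^n(M, Y)`. -/
def ExtVanishes (M Y : Type u) [AddCommGroup M] [Module A M] [AddCommGroup Y] [Module A Y]
    (n : ℕ) : Prop :=
  Subsingleton (Abelian.Ext.{u} (ModuleCat.of A M) (ModuleCat.of A Y) n)

variable {K P M N Y : Type u} [AddCommGroup K] [Module A K] [AddCommGroup P] [Module A P]
  [AddCommGroup M] [Module A M] [AddCommGroup Y] [Module A Y] [AddCommGroup N] [Module A N]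

lemma ExtVanishes.of_retract {n : ℕ} (h : ExtVanishes (A := A) N Y n) (i : M →ₗ[A] N)
    (r : N →ₗ[A] M) (hri : r ∘ₗ i = LinearMap.id) : ExtVanishes (A := A) M Y n := by
  have h' : Subsingleton (Abelian.Ext.{u} (ModuleCat.of A N) (ModuleCat.of A Y) n) := h
  refine subsingleton_of_forall_eq 0 fun x => ?_
  have h1 : ModuleCat.ofHom i ≫ ModuleCat.ofHom r = 𝟙 _ := by
    rw [← ModuleCat.ofHom_comp, hri]; rfl
  rw [← Abelian.Ext.mk₀_id_comp x, ← h1, ← Abelian.Ext.mk₀_comp_mk₀, Abelian.Ext.comp_assoc_of_second_deg_zero,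
    Subsingleton.elim ((Abelian.Ext.mk₀ (ModuleCat.ofHom r)).comp x (zero_add n)) 0,
    Abelian.Ext.comp_zero]

lemma shortExact_of_exact (j : K →ₗ[A] P) (p : P →ₗ[A] M) (hj : Function.Injective j)
    (hp : Function.Surjective p) (h : Function.Exact j p) :
    (ShortComplex.mk (ModuleCat.ofHom j) (ModuleCat.ofHom p) (by
      rw [← ModuleCat.ofHom_comp, h.linearMap_comp_eq_zero]; rfl)).ShortExact where
  exact := (ShortComplex.ShortExact.moduleCat_exact_iff_function_exact _).2 h
  mono_f := (ModuleCat.mono_iff_injective _).2 hj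
  epi_g := (ModuleCat.epi_iff_surjective _).2 hp

variable {j : K →ₗ[A] P} {p : P →ₗ[A] M}

lemma extVanishes_succ_iff [Module.Projective A P] (hj : Function.Injective j)
    (hp : Function.Surjective p) (h : Function.Exact j p) {n : ℕ} (hn : 0 < n) :
    ExtVanishes (A := A) M Y (n + 1) ↔ ExtVanishes (A := A) K Y n := by
  have hS := shortExact_of_exact j p hj hp h
  have : Projective (ModuleCat.of A P) := inferInstance
  constructor
  · intro h1
    have h1' : Subsingleton (Abelian.Ext.{u} (ModuleCat.of A M) (ModuleCat.of A Y) (n + 1)) := h1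
    refine subsingleton_of_forall_eq 0 fun x => ?_
    obtain ⟨y, rfl⟩ := Abelian.Ext.contravariant_sequence_exact₁ hS _ x (add_comm 1 n)
      (Subsingleton.elim _ _)
    obtain ⟨m, rfl⟩ := Nat.exists_eq_succ_of_ne_zero hn.ne'
    rw [Abelian.Ext.eq_zero_of_projective y, Abelian.Ext.comp_zero]
  · intro h1
    have h1' : Subsingleton (Abelian.Ext.{u} (ModuleCat.of A K) (ModuleCat.of A Y) n) := h1
    refine subsingleton_of_forall_eq 0 fun x => ?_
    obtain ⟨y, rfl⟩ := Abelian.Ext.contravariant_sequence_exact₃ hS _ x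
      (Abelian.Ext.eq_zero_of_projective _) (add_comm 1 n)
    rw [Subsingleton.elim y 0, Abelian.Ext.comp_zero]

lemma extVanishes_one_iff [Module.Projective A P] (hj : Function.Injective j)
    (hp : Function.Surjective p) (h : Function.Exact j p) :
    ExtVanishes (A := A) M Y 1 ↔ ∀ φ : K →ₗ[A] Y, ∃ ψ : P →ₗ[A] Y, ψ ∘ₗ j = φ := by
  have hS := shortExact_of_exact j p hj hp h
  have : Projective (ModuleCat.of A P) := inferInstance
  constructor
  · intro h1 φ
    have h1' : Subsingleton (Abelian.Ext.{u} (ModuleCat.of A M) (ModuleCat.of A Y) 1) := h1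
    obtain ⟨y, hy⟩ := Abelian.Ext.contravariant_sequence_exact₁ hS _
      (Abelian.Ext.mk₀ (ModuleCat.ofHom φ)) (add_zero 1) (Subsingleton.elim _ _)
    obtain ⟨ψ, rfl⟩ := (Abelian.Ext.mk₀_bijective _ _).2 y
    rw [Abelian.Ext.mk₀_comp_mk₀] at hy
    have := (Abelian.Ext.mk₀_bijective _ _).1 hy
    exact ⟨ψ.hom, by simpa using congrArg ModuleCat.Hom.hom this⟩
  · intro h1
    refine subsingleton_of_forall_eq 0 fun x => ?_
    obtain ⟨y, rfl⟩ := Abelian.Ext.contravariant_sequence_exact₃ hS _ x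
      (Abelian.Ext.eq_zero_of_projective _) (add_zero 1)
    obtain ⟨φ, rfl⟩ := (Abelian.Ext.mk₀_bijective _ _).2 y
    obtain ⟨ψ, hψ⟩ := h1 φ.hom
    have h2 : φ = ModuleCat.ofHom j ≫ ModuleCat.ofHom ψ :=
      ModuleCat.hom_ext hψ.symm
    rw [h2, ← Abelian.Ext.mk₀_comp_mk₀, ← Abelian.Ext.comp_assoc]
    · have := hS.extClass_comp 
      rw [this, Abelian.Ext.zero_comp]
    all_goals rfl

lemma exists_map_of_span_singleton {M N : Type*} [AddCommGroup M] [Module A M] [AddCommGroup N]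
    [Module A N] {m : M} {y : N} (hm : Submodule.span A {m} = ⊤)
    (h : ∀ a : A, a • m = 0 → a • y = 0) : ∃ φ : M →ₗ[A] N, φ m = y := by
  have hs : Function.Surjective (LinearMap.toSpanSingleton A M m) := by
    rw [← LinearMap.range_eq_top, LinearMap.range_toSpanSingleton, hm]
  have hk : LinearMap.ker (LinearMap.toSpanSingleton A M m) ≤
      LinearMap.ker (LinearMap.toSpanSingleton A N y) := fun a ha => by
    simpa using h a (by simpa using ha)
  refine ⟨(Submodule.liftQ _ _ hk) ∘ₗ
    (LinearMap.quotKerEquivOfSurjective _ hs).symm.toLinearMap, ?_⟩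
  have : (LinearMap.quotKerEquivOfSurjective _ hs).symm m = Submodule.Quotient.mk 1 := by
    rw [LinearEquiv.symm_apply_eq]
    simp
  simp [this]

end Ext

namespace SerialData

variable {A : Type u} [Ring A] {ι : Type w} (D : SerialData A ι)

/-- `m` generates a module isomorphic to `A e i / A path i n`. -/
structure IsGenerator {M : Type*} [AddCommGroup M] [Module A M] (i : ι) (n : ℕ) (m : M) : Prop where
  span : Submodule.span A {m} = ⊤
  smul_eq_zero_iff : ∀ x : A, x • m = 0 ↔ ∃ v, x * D.e i = v * D.path i n

/-- The pair describing the first syzygy of the module described by a pair. -/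
noncomputable def syz (q : ι × ℕ) : ι × ℕ := ((D.σ ^ q.2) q.1, D.c q.1 - q.2)

lemma syz_le {q : ι × ℕ} : (D.syz q).2 ≤ D.c (D.syz q).1 := by
  have := D.c_le_add q.1 q.2
  simp only [syz]; omega

/-- The exponents `n` and `c i - n` add up to `c i`, so the top of the second syzygy does not depend
on `n`. -/
lemma syz_syz {q : ι × ℕ} (hq : q.2 ≤ D.c q.1) : (D.syz (D.syz q)).1 = D.next q.1 := by
  simp only [syz, next]
  rw [← Equiv.Perm.mul_apply, ← pow_add, Nat.sub_add_cancel hq]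

variable {D}
variable {M : Type u} [AddCommGroup M] [Module A M]

lemma projective_span_idem {e : A} (he : e * e = e) :
    Module.Projective A (Submodule.span A {e}) := by
  refine Module.Projective.of_split (M := A) (Submodule.subtype _)
    (LinearMap.toSpanSingleton A (Submodule.span A {e}) ⟨e, Submodule.mem_span_singleton_self e⟩) ?_
  ext ⟨x, hx⟩
  obtain ⟨a, rfl⟩ := Submodule.mem_span_singleton.1 hx
  simp [mul_assoc, he]

instance (i : ι) : Module.Projective A (Submodule.span A {D.e i}) :=
  projective_span_idem (D.e_mul_e i)

lemma span_path_le (i : ι) (n : ℕ) : Submodule.span A {D.path i n} ≤ Submodule.span A {D.e i} := by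
  rw [Submodule.span_singleton_le_iff_mem, Submodule.mem_span_singleton]
  exact ⟨D.path i n, D.path_mul_e i n⟩

lemma IsGenerator.e_smul {i : ι} {n : ℕ} {m : M} (h : D.IsGenerator i n m) : D.e i • m = m := by
  have := (h.smul_eq_zero_iff (1 - D.e i)).2 ⟨0, by simp [sub_mul, D.e_mul_e]⟩
  rw [sub_smul, one_smul, sub_eq_zero] at this
  exact this.symm

lemma span_singleton_self_eq_top {R M : Type*} [Ring R] [AddCommGroup M] [Module R M] (m : M) :
    Submodule.span R {(⟨m, Submodule.mem_span_singleton_self m⟩ : Submodule.span R {m})} = ⊤ := by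
  rw [eq_top_iff]
  rintro ⟨x, hx⟩ -
  obtain ⟨a, rfl⟩ := Submodule.mem_span_singleton.1 hx
  exact Submodule.mem_span_singleton.2 ⟨a, rfl⟩

lemma isGenerator_path {i : ι} {n : ℕ} (hn : n ≤ D.c i) :
    D.IsGenerator ((D.σ ^ n) i) (D.c i - n)
      (⟨D.path i n, Submodule.mem_span_singleton_self _⟩ : Submodule.span A {D.path i n}) where
  span := span_singleton_self_eq_top _
  smul_eq_zero_iff x := by
    rw [← D.mul_path_eq_zero_iff rfl hn (by rw [mul_assoc, D.e_mul_e]), mul_assoc, D.e_mul_path,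
      Subtype.ext_iff]
    rfl

/-- The cover of a module with a generator. -/
noncomputable def cover (D : SerialData A ι) (i : ι) (m : M) : Submodule.span A {D.e i} →ₗ[A] M :=
  LinearMap.toSpanSingleton A M m ∘ₗ Submodule.subtype _

lemma IsGenerator.cover_surjective {i : ι} {n : ℕ} {m : M} (h : D.IsGenerator i n m) :
    Function.Surjective (D.cover i m) := by
  intro x
  obtain ⟨a, rfl⟩ := Submodule.mem_span_singleton.1 (h.span ▸ Submodule.mem_top : x ∈ Submodule.span A {m})
  refine ⟨⟨a * D.e i, Submodule.mem_span_singleton.2 ⟨a, rfl⟩⟩, ?_⟩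
  simp [cover, mul_smul, h.e_smul]

lemma IsGenerator.exact_cover {i : ι} {n : ℕ} {m : M} (h : D.IsGenerator i n m) :
    Function.Exact (Submodule.inclusion (span_path_le (D := D) i n)) (D.cover i m) := by
  rintro ⟨x, hx⟩
  obtain ⟨a, rfl⟩ := Submodule.mem_span_singleton.1 hx
  have : D.cover i m ⟨a • D.e i, hx⟩ = 0 ↔ (a * D.e i) • m = 0 := by simp [cover]
  rw [this, h.smul_eq_zero_iff, mul_assoc, D.e_mul_e]
  constructor
  · rintro ⟨v, hv⟩
    exact ⟨⟨a * D.e i, Submodule.mem_span_singleton.2 ⟨v, hv.symm⟩⟩, rfl⟩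
  · rintro ⟨⟨y, hy⟩, hyx⟩
    obtain ⟨v, rfl⟩ := Submodule.mem_span_singleton.1 hy
    exact ⟨v, (congrArg Subtype.val hyx).symm⟩

/-- Homomorphisms from the syzygy `A path i n` to `A` correspond to elements `y` of `e k A`, `k = σ
^ n i`, killed by the complementary path. Extending one to `A e i` means writing `y` as a right
multiple of `path i n`, which is what blackness decides. -/
lemma IsGenerator.extVanishes_one_iff {i : ι} {n : ℕ} {m : M} (h : D.IsGenerator i n m)
    (hn : n ≤ D.c i) :
    ExtVanishes (A := A) M A 1 ↔ (0 < n → n < D.c i → D.Black i) := by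
  rw [NakayamaGP.extVanishes_one_iff (Submodule.inclusion_injective _) h.cover_surjective
    h.exact_cover]
  have hg := isGenerator_path hn
  constructor
  · intro hext h0 h1
    by_contra hb
    obtain ⟨y, hy1, hy2, hy3⟩ := D.exists_ne_path_mul hb h0 h1
    obtain ⟨φ, hφ⟩ := exists_map_of_span_singleton hg.span (y := y) (fun a ha => by
      obtain ⟨v, hv⟩ := (hg.smul_eq_zero_iff a).1 ha
      rw [smul_eq_mul, ← hy1, ← mul_assoc, hv, mul_assoc, hy2, mul_zero])
    obtain ⟨ψ, hψ⟩ := hext φ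
    refine hy3 (ψ ⟨D.e i, Submodule.mem_span_singleton_self _⟩) ?_
    rw [← hφ, ← hψ, ← smul_eq_mul, ← map_smul, LinearMap.comp_apply]
    congr 1
    exact Subtype.ext (D.path_mul_e i n).symm
  · intro hb φ
    set y := φ ⟨D.path i n, Submodule.mem_span_singleton_self _⟩ with hy
    have hy1 : D.e ((D.σ ^ n) i) * y = y := by
      rw [hy, ← smul_eq_mul, ← map_smul, hg.e_smul]
    have hy2 : D.path ((D.σ ^ n) i) (D.c i - n) * y = 0 := by
      rw [hy, ← smul_eq_mul, ← map_smul, (hg.smul_eq_zero_iff _).2 ⟨1, by simp⟩, map_zero]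
    obtain ⟨t, ht⟩ : ∃ t, y = D.path i n * t := by
      rcases Nat.eq_zero_or_pos n with rfl | h0
      · exact ⟨y, by simpa using hy1.symm⟩
      rcases hn.eq_or_lt with rfl | h1
      · exact ⟨0, by rw [← hy1]; simpa using hy2⟩
      exact D.exists_eq_path_mul (hb h0 h1) rfl h1 hy1 hy2
    refine ⟨LinearMap.toSpanSingleton A A t ∘ₗ Submodule.subtype _, ?_⟩
    ext ⟨x, hx⟩
    obtain ⟨a, rfl⟩ := Submodule.mem_span_singleton.1 hx
    have : (⟨a • D.path i n, hx⟩ : Submodule.span A {D.path i n}) =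
      a • ⟨D.path i n, Submodule.mem_span_singleton_self _⟩ := rfl
    rw [this, map_smul, map_smul, ← hy, ht]
    rfl

/-- The vanishing of `Ext^(k+1)(M, A)` for a module with a generator. -/
lemma IsGenerator.extVanishes_iff {q : ι × ℕ} {m : M} (h : D.IsGenerator q.1 q.2 m)
    (hq : q.2 ≤ D.c q.1) (k : ℕ) :
    ExtVanishes (A := A) M A (k + 1) ↔
      (0 < (D.syz^[k] q).2 → (D.syz^[k] q).2 < D.c (D.syz^[k] q).1 → D.Black (D.syz^[k] q).1) := by
  induction k generalizing M q with
  | zero => exact h.extVanishes_one_iff hq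
  | succ k ih =>
    rw [extVanishes_succ_iff (Submodule.inclusion_injective _) h.cover_surjective h.exact_cover
      k.succ_pos, ih (isGenerator_path (n := q.2) hq) (D.syz_le (q := q))]
    rfl

end SerialData

end NakayamaGP

/-! ### Finite injective dimension and periodic vertices. -/

namespace NakayamaGP

section InjectiveDimension

variable {A : Type u} [Ring A]

lemma ExtVanishes.middle {K P M Y : Type u} [AddCommGroup K] [Module A K] [AddCommGroup P]
    [Module A P] [AddCommGroup M] [Module A M] [AddCommGroup Y] [Module A Y]
    {j : K →ₗ[A] P} {p : P →ₗ[A] M} (hj : Function.Injective j)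
    (hp : Function.Surjective p) (h : Function.Exact j p) {n : ℕ}
    (h1 : ExtVanishes (A := A) K Y n) (h2 : ExtVanishes (A := A) M Y n) :
    ExtVanishes (A := A) P Y n := by
  have hS := shortExact_of_exact j p hj hp h
  have h1' : Subsingleton (Abelian.Ext.{u} (ModuleCat.of A K) (ModuleCat.of A Y) n) := h1
  have h2' : Subsingleton (Abelian.Ext.{u} (ModuleCat.of A M) (ModuleCat.of A Y) n) := h2
  refine subsingleton_of_forall_eq 0 fun x => ?_
  obtain ⟨y, rfl⟩ := Abelian.Ext.contravariant_sequence_exact₂ hS _ x (Subsingleton.elim _ _)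
  rw [Subsingleton.elim y 0, Abelian.Ext.comp_zero]

lemma ExtVanishes.of_subsingleton {M Y : Type u} [AddCommGroup M] [Module A M] [AddCommGroup Y]
    [Module A Y] [Subsingleton M] (n : ℕ) : ExtVanishes (A := A) M Y n := by
  refine subsingleton_of_forall_eq 0 fun x => ?_
  have : Abelian.Ext.mk₀ (𝟙 (ModuleCat.of A M)) = 0 := by
    rw [(ModuleCat.isZero_of_subsingleton (ModuleCat.of A M)).eq_of_src (𝟙 _) 0, Abelian.Ext.mk₀_zero]
  rw [← Abelian.Ext.mk₀_id_comp x, this, Abelian.Ext.zero_comp]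

lemma ExtVanishes.of_isFiniteLength {Y : Type u} [AddCommGroup Y] [Module A Y] {n : ℕ}
    (hs : ∀ (S : Type u) [AddCommGroup S] [Module A S], IsSimpleModule A S →
      ExtVanishes (A := A) S Y n)
    {M : Type u} [AddCommGroup M] [Module A M] (hM : IsFiniteLength A M) :
    ExtVanishes (A := A) M Y n := by
  induction hM with
  | of_subsingleton => exact .of_subsingleton n
  | @of_simple_quotient M _ _ N _ _ ih =>
    exact ih.middle N.injective_subtype N.mkQ_surjective (LinearMap.exact_subtype_mkQ N)
      (hs _ inferInstance)

/-- For `n = 0` this is Baer's criterion; embedding `Y` in an injective module and passing to the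
cokernel lowers the degree by one. -/
lemma hasInjectiveDimensionLT_of_ext_quotient (n : ℕ) (Y : ModuleCat.{u} A)
    (h : ∀ I : Ideal A, ExtVanishes (A := A) (A ⧸ I) Y (n + 1)) :
    HasInjectiveDimensionLT Y (n + 1) := by
  induction n generalizing Y with
  | zero =>
    have hB : Module.Baer A Y := by
      intro I g
      obtain ⟨ψ, hψ⟩ := (extVanishes_one_iff I.injective_subtype I.mkQ_surjective
        (LinearMap.exact_subtype_mkQ I)).1 (h I) g
      exact ⟨ψ, fun x hx => LinearMap.congr_fun hψ ⟨x, hx⟩⟩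
    have := hB.injective
    have : Injective Y := Module.injective_object_of_injective_module A Y
    infer_instance
  | succ n ih =>
    let S : ShortComplex (ModuleCat.{u} A) :=
      ShortComplex.mk (Injective.ι Y) (Limits.cokernel.π (Injective.ι Y)) (by simp)
    have hS : S.ShortExact :=
      { exact := ShortComplex.exact_of_g_is_cokernel _ (Limits.cokernelIsCokernel _)
        mono_f := inferInstanceAs (Mono (Injective.ι Y))
        epi_g := inferInstanceAs (Epi (Limits.cokernel.π _)) }
    have hinj : Injective S.X₂ := inferInstanceAs (Injective (Injective.under Y))
    refine (hS.hasInjectiveDimensionLT_X₃_iff n hinj).1 (ih _ fun I => ?_)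
    have h' : Subsingleton (Abelian.Ext.{u} (ModuleCat.of A (A ⧸ I)) Y (n + 1 + 1)) := h I
    refine subsingleton_of_forall_eq 0 fun x => ?_
    obtain ⟨y, rfl⟩ := Abelian.Ext.covariant_sequence_exact₃ (ModuleCat.of A (A ⧸ I)) hS x rfl
      (h'.elim _ _)
    rw [Abelian.Ext.eq_zero_of_injective y, Abelian.Ext.zero_comp]

end InjectiveDimension

lemma mem_span_smul_of_full {A : Type u} [Ring A] {ι : Type w} {e : ι → A}
    (full : (1 : A) ∈ AddSubmonoid.closure {x | ∃ u i v, x = u * e i * v})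
    {M : Type*} [AddCommGroup M] [Module A M] (x : M) :
    x ∈ Submodule.span A {y | ∃ i v, y = e i • (v : A) • x} := by
  have : ∀ a ∈ AddSubmonoid.closure {x | ∃ u i v, x = u * e i * v},
      a • x ∈ Submodule.span A {y | ∃ i v, y = e i • (v : A) • x} := by
    intro a ha
    induction ha using AddSubmonoid.closure_induction with
    | mem a ha =>
      obtain ⟨u, i, v, rfl⟩ := ha
      rw [mul_assoc, mul_smul]
      refine Submodule.smul_mem _ _ (Submodule.subset_span ⟨i, v, mul_smul _ _ _⟩)
    | zero => simp
    | add a b _ _ ha hb => rw [add_smul]; exact Submodule.add_mem _ ha hb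
  simpa using this 1 full

lemma exists_iterate_mem_periodicPts {α : Type*} [Finite α] (f : α → α) (x : α) :
    ∃ m, f^[m] x ∈ Function.periodicPts f := by
  obtain ⟨a, b, hne, hab⟩ := Finite.exists_ne_map_eq_of_infinite (fun n : ℕ => f^[n] x)
  wlog hlt : a < b generalizing a b
  · exact this b a hne.symm hab.symm (by omega)
  obtain ⟨k, rfl⟩ := Nat.exists_eq_add_of_lt hlt
  refine ⟨a, k + 1, by omega, ?_⟩
  rw [Function.IsPeriodicPt, Function.IsFixedPt, ← Function.iterate_add_apply]
  rw [show k + 1 + a = a + k + 1 by omega]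
  exact hab.symm

lemma iterate_mem_periodicPts {α : Type*} {f : α → α} {x : α} (h : x ∈ Function.periodicPts f)
    (n : ℕ) : f^[n] x ∈ Function.periodicPts f :=
  let ⟨k, hk, hx⟩ := h
  ⟨k, hk, hx.apply_iterate n⟩

lemma exists_forall_iterate_mem_periodicPts {α : Type*} [Finite α] (f : α → α) :
    ∃ N, ∀ n ≥ N, ∀ x, f^[n] x ∈ Function.periodicPts f := by
  have := Fintype.ofFinite α
  choose m hm using exists_iterate_mem_periodicPts f
  refine ⟨Finset.univ.sup m, fun n hn x => ?_⟩
  obtain ⟨k, rfl⟩ := Nat.exists_eq_add_of_le ((Finset.le_sup (Finset.mem_univ x)).trans hn)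
  rw [add_comm, Function.iterate_add_apply]
  exact iterate_mem_periodicPts (hm x) k

namespace SerialData

variable {A : Type u} [Ring A] {ι : Type w} (D : SerialData A ι)

lemma syz_iterate_two_mul {q : ι × ℕ} (hq : q.2 ≤ D.c q.1) (k : ℕ) :
    (D.syz^[2 * k] q).1 = D.next^[k] q.1 ∧ (D.syz^[2 * k] q).2 ≤ D.c (D.syz^[2 * k] q).1 := by
  induction k with
  | zero => exact ⟨rfl, hq⟩
  | succ k ih =>
    rw [show 2 * (k + 1) = (2 * k + 1) + 1 by ring, Function.iterate_succ_apply',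
      Function.iterate_succ_apply', Function.iterate_succ_apply']
    exact ⟨by rw [D.syz_syz ih.2, ih.1], D.syz_le⟩

lemma mem_span_e_smul {M : Type*} [AddCommGroup M] [Module A M] (x : M) :
    x ∈ Submodule.span A {y | ∃ i v, y = D.e i • (v : A) • x} :=
  mem_span_smul_of_full D.full x

lemma exists_e_smul_eq_self {M : Type*} [AddCommGroup M] [Module A M] [Nontrivial M] :
    ∃ i, ∃ x : M, D.e i • x = x ∧ x ≠ 0 := by
  obtain ⟨x, hx⟩ := exists_ne (0 : M)
  by_contra! h
  refine hx ?_
  have h1 := D.mem_span_e_smul x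
  have : {y | ∃ i v, y = D.e i • (v : A) • x} ⊆ ({0} : Set M) := by
    rintro _ ⟨i, v, rfl⟩
    exact h i _ (by rw [← mul_smul, D.e_mul_e])
  simpa using Submodule.span_mono (R := A) this h1

lemma smul_eq_zero_of_isNilpotent {M : Type*} [AddCommGroup M] [Module A M] {a : A} {x : M}
    (ha : IsNilpotent a) (h : a • x = x) : x = 0 := by
  obtain ⟨n, hn⟩ := ha
  have : ∀ n : ℕ, a ^ n • x = x := fun n => by
    induction n with
    | zero => simp
    | succ n ih => rw [pow_succ, mul_smul, h, ih]
  rw [← this n, hn, zero_smul]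

lemma arr_smul_eq_zero {S : Type*} [AddCommGroup S] [Module A S] [IsSimpleModule A S] (i : ι)
    (x : S) : D.arr i • x = 0 := by
  by_contra h
  obtain ⟨v, hv⟩ := IsSimpleModule.toSpanSingleton_surjective A h x
  have hv' : (v * D.arr i) • x = x := by rw [mul_smul]; exact hv
  refine h ?_
  rw [smul_eq_zero_of_isNilpotent (isNilpotent_mul_swap (D.nil i v)) hv', smul_zero]

lemma isGenerator_of_isSimpleModule {S : Type*} [AddCommGroup S] [Module A S] [IsSimpleModule A S]
    {i : ι} {x : S} (hx : D.e i • x = x) (h0 : x ≠ 0) : D.IsGenerator i 1 x where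
  span := by
    rw [← LinearMap.range_toSpanSingleton, LinearMap.range_eq_top]
    exact IsSimpleModule.toSpanSingleton_surjective A h0
  smul_eq_zero_iff a := by
    constructor
    · intro ha
      rcases D.left_gen i (a * D.e i) (by rw [mul_assoc, D.e_mul_e]) with ⟨v, hv⟩ | ⟨v, hv⟩
      · exfalso
        rw [← hx, ← hv, mul_smul, mul_smul, hx, ha, smul_zero] at h0
        exact h0 rfl
      · exact ⟨v, by rw [path_one, hv]⟩
    · rintro ⟨v, hv⟩
      rw [← hx, ← mul_smul, hv, path_one, mul_smul, D.arr_smul_eq_zero, smul_zero]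

/-- If all periodic vertices are black, then the ring has finite injective dimension. -/
theorem exists_hasInjectiveDimensionLE [Finite ι] [IsArtinianRing A]
    (h : ∀ i ∈ Function.periodicPts D.next, D.Black i) :
    ∃ n, HasInjectiveDimensionLE (ModuleCat.of A A) n := by
  obtain ⟨N, hN⟩ := exists_forall_iterate_mem_periodicPts D.next
  -- After `2 * N` syzygies the vertex is `next^[N]` of the starting vertex, hence periodic by the
  -- choice of `N`.
  refine ⟨2 * N, hasInjectiveDimensionLT_of_ext_quotient _ _ fun I => ?_⟩
  refine ExtVanishes.of_isFiniteLength (fun S _ _ _ => ?_)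
    (isFiniteLength_iff_isNoetherian_isArtinian.2 ⟨inferInstance, inferInstance⟩)
  have := IsSimpleModule.nontrivial A S
  obtain ⟨i, x, hx, h0⟩ := D.exists_e_smul_eq_self (M := S)
  have hq : (i, 1).2 ≤ D.c (i, 1).1 := (D.one_lt_c i).le
  refine ((D.isGenerator_of_isSimpleModule hx h0).extVanishes_iff (q := (i, 1)) hq _).2
    fun _ _ => h _ ?_
  rw [(D.syz_iterate_two_mul hq N).1]
  exact hN N le_rfl _

/-- If the ring has finite injective dimension, then a periodic vertex is black, provided that its
period under `σ` is smaller than the length of the projective module. -/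
theorem black_of_hasInjectiveDimensionLE {n : ℕ} [HasInjectiveDimensionLE (ModuleCat.of A A) n]
    {i : ι} (hi : i ∈ Function.periodicPts D.next) {t : ℕ} (ht0 : 0 < t)
    (ht : ∀ j, t < D.c j) (hti : (D.σ ^ t) i = i) : D.Black i := by
  obtain ⟨k, hk, hki⟩ := hi
  have hq : (i, t).2 ≤ D.c (i, t).1 := (ht i).le
  have hnext : ∀ m, (D.σ ^ t) (D.next^[m] i) = D.next^[m] i := by
    intro m
    induction m with
    | zero => exact hti
    | succ m ih =>
      rw [Function.iterate_succ_apply', next, ← Equiv.Perm.mul_apply, ← pow_add, add_comm, pow_add,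
        Equiv.Perm.mul_apply, ih]
  -- Because `σ ^ t` fixes the whole `next`-orbit, the lengths along it alternate between `t` and `c
  -- - t`.
  have hsyz : ∀ m, D.syz^[2 * m] (i, t) = (D.next^[m] i, t) := by
    intro m
    induction m with
    | zero => rfl
    | succ m ih =>
      rw [show 2 * (m + 1) = (2 * m + 1) + 1 by ring, Function.iterate_succ_apply',
        Function.iterate_succ_apply', ih]
      refine Prod.ext ?_ ?_
      · rw [D.syz_syz (ht _).le, Function.iterate_succ_apply']
      · have := ht (D.next^[m] i)
        simp only [syz, hnext]
        omega
  -- The test module is the first syzygy of `(i, t)`, realised as a left ideal; hence the shift by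
  -- one in the degree. A multiple of `2 * k` syzygies returns to `(i, t)`.
  have hgen := isGenerator_path (D := D) (ht i).le
  have hext : ExtVanishes (A := A) (Submodule.span A {D.path i t}) A
      (2 * (k * (n + 1)) - 1 + 1) := by
    refine HasInjectiveDimensionLT.subsingleton _ (n + 1) _ ?_ _
    have : n + 1 ≤ k * (n + 1) := Nat.le_mul_of_pos_left _ hk
    omega
  rw [hgen.extVanishes_iff (q := D.syz (i, t)) D.syz_le, ← Function.iterate_succ_apply,
    show Nat.succ (2 * (k * (n + 1)) - 1) = 2 * (k * (n + 1)) from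
      Nat.succ_pred_eq_of_pos (Nat.mul_pos two_pos (Nat.mul_pos hk n.succ_pos)), hsyz] at hext
  have := hext ht0 (ht _)
  rwa [show D.next^[k * (n + 1)] i = i from hki.mul_const _] at this

end SerialData

end NakayamaGP

/-! ### Splitting off generated submodules of maximal length. -/

namespace NakayamaGP

namespace SerialData

variable {A : Type u} [Ring A] {ι : Type w} (D : SerialData A ι)
variable {M : Type u} [AddCommGroup M] [Module A M]

lemma exists_isGenerator {i : ι} {m : M} (hm : D.e i • m = m) (h0 : m ≠ 0) :
    ∃ d, 0 < d ∧ d ≤ D.c i ∧ D.IsGenerator i d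
      (⟨m, Submodule.mem_span_singleton_self m⟩ : Submodule.span A {m}) := by
  classical
  have hex : ∃ d, D.path i d • m = 0 :=
    ⟨D.c i, by rw [D.path_eq_zero_iff.2 le_rfl, zero_smul]⟩
  refine ⟨Nat.find hex, Nat.pos_of_ne_zero fun h => ?_, Nat.find_min' hex ?_,
    span_singleton_self_eq_top m, fun x => ?_⟩
  · have := Nat.find_spec hex
    rw [h, path_zero, hm] at this
    exact h0 this
  · rw [D.path_eq_zero_iff.2 le_rfl, zero_smul]
  · rw [Subtype.ext_iff]
    change x • m = 0 ↔ _
    constructor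
    · intro hx
      by_cases hxe : x * D.e i = 0
      · exact ⟨0, by rw [hxe, zero_mul]⟩
      obtain ⟨k, hk, u, v, h1, h2, -⟩ := D.left_form (x := x * D.e i) (i := i)
        (by rw [mul_assoc, D.e_mul_e]) hxe (one_mul 1) (one_mul _)
      have : D.path i k • m = 0 := by
        rw [← D.e_mul_path, ← h2, mul_assoc, ← h1, mul_smul, mul_smul, hm, hx, smul_zero]
      obtain ⟨t, rfl⟩ := Nat.exists_eq_add_of_le (Nat.find_min' hex this)
      exact ⟨u * D.path ((D.σ ^ Nat.find hex) i) t, by rw [h1, path_add, mul_assoc]⟩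
    · rintro ⟨v, hv⟩
      rw [← hm, ← mul_smul, hv, mul_smul, Nat.find_spec hex, smul_zero]

/-- A module generated at `i` with full length is projective. -/
lemma IsGenerator.projective {D : SerialData A ι} {i : ι} {m : M}
    (h : D.IsGenerator i (D.c i) m) : Module.Projective A M := by
  refine Module.Projective.of_equiv (M := Submodule.span A {D.e i})
    (LinearEquiv.ofBijective (D.cover i m) ⟨?_, h.cover_surjective⟩)
  rw [injective_iff_map_eq_zero]
  intro x hx
  obtain ⟨⟨y, hy⟩, rfl⟩ := (h.exact_cover x).1 hx
  rw [D.path_eq_zero_iff.2 le_rfl, Submodule.span_singleton_eq_bot.2 rfl] at hy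
  exact Subtype.ext hy

lemma IsGenerator.path_smul_ne_zero {D : SerialData A ι} {i : ι} {n d : ℕ} {m : M}
    (h : D.IsGenerator i n m) (hd : d < n) (hn : n ≤ D.c i) : D.path i d • m ≠ 0 := by
  intro h0
  obtain ⟨v, hv⟩ := (h.smul_eq_zero_iff _).1 h0
  obtain ⟨t, rfl⟩ := Nat.exists_eq_add_of_lt hd
  rw [path_mul_e, add_assoc, path_add, ← mul_assoc] at hv
  refine D.path_ne_zero_iff.2 (hd.trans_le hn)
    (eq_zero_of_eq_mul_mul (w := v * D.path ((D.σ ^ d) i) (t + 1)) (g := 1) (by simpa using hv) ?_)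
  rw [path_succ, ← mul_assoc]
  exact isNilpotent_mul_swap (D.nil _ _)

/-- A generator of maximal length satisfies the lifting condition for extending homomorphisms. -/
lemma IsGenerator.exists_path_smul_eq {D : SerialData A ι} {i j : ι} {d n : ℕ} {m : M}
    (h : D.IsGenerator i d m) (hd : d ≤ D.c i) (hn : n ≤ d) {y : M}
    (hy : D.e ((D.σ ^ n) j) • y = y) (hy0 : D.path ((D.σ ^ n) j) (d - n) • y = 0) :
    ∃ t, D.e j • t = t ∧ D.path j n • t = y := by
  suffices ∃ t, D.path j n • t = y by
    obtain ⟨t, ht⟩ := this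
    exact ⟨D.e j • t, by rw [← mul_smul, D.e_mul_e], by rw [← mul_smul, path_mul_e, ht]⟩
  by_cases h0 : y = 0
  · exact ⟨0, by rw [h0, smul_zero]⟩
  obtain ⟨k, hk⟩ : ∃ k, k = (D.σ ^ n) j := ⟨_, rfl⟩
  rw [← hk] at hy hy0
  obtain ⟨s', hs'⟩ := Submodule.mem_span_singleton.1 (h.span ▸ Submodule.mem_top : y ∈ Submodule.span A {m})
  set s := D.e k * s' * D.e i with hs
  have hsm : s • m = y := by rw [hs, mul_smul, h.e_smul, mul_smul, hs', hy]
  have hs0 : s ≠ 0 := by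
    rintro hs0
    rw [hs0, zero_smul] at hsm
    exact h0 hsm.symm
  obtain ⟨l, hl, hlk, ⟨u, v, h1, h2, h3, h4, h5⟩, g, h6, -⟩ := D.two_sided_form (x := s) (i := i)
    (k := k) (by rw [hs, mul_assoc, D.e_mul_e]) (by rw [hs, ← mul_assoc, ← mul_assoc, D.e_mul_e]) hs0
  rcases le_or_gt n l with hnl | hnl
  · obtain ⟨t, rfl⟩ := Nat.exists_eq_add_of_le hnl
    have : (D.σ ^ t) i = j := by
      apply (D.σ ^ n).injective
      rw [← Equiv.Perm.mul_apply, ← pow_add, hlk, hk]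
    exact ⟨(D.path i t * g) • m, by
      rw [← mul_smul, ← hsm, h6, add_comm n t, path_add, this, mul_assoc]⟩
  -- If `l < n`, then `path k (d - n) * u * path i l` kills the generator although its length is
  -- less than `d`. Comparing with multiples of `path i d` gives `p = (nilpotent) * p * v`, so `p =
  -- 0` and `path i (l + r)` vanishes too early.
  · exfalso
    obtain ⟨t, rfl⟩ := Nat.exists_eq_add_of_lt hnl
    obtain ⟨r, rfl⟩ := Nat.exists_eq_add_of_le hn
    rw [Nat.add_sub_cancel_left] at hy0
    set p := D.path k r with hp
    have hpath : D.path i (l + t + 1 + r) = D.path k (r + (t + 1)) * D.path i l := by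
      rw [← hlk, ← path_add]; congr 1; ring
    have h7 : (p * u * D.path i l) • m = 0 := by
      rw [mul_assoc, ← h1, mul_smul, hsm, hy0]
    obtain ⟨v', hv'⟩ := (h.smul_eq_zero_iff _).1 h7
    rw [mul_assoc, path_mul_e, hpath, ← mul_assoc, ← sub_eq_zero, ← sub_mul,
      D.mul_path_eq_zero_iff hlk hl.le (by
        rw [sub_mul, mul_assoc, h5, mul_assoc, path_mul_e])] at hv'
    obtain ⟨v'', hv''⟩ := hv'
    obtain ⟨b, hb⟩ := Nat.exists_eq_add_of_le (show r + (t + 1) ≤ D.c i - l by omega)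
    have h8 : ∃ w, p * u = w * D.path k (r + (t + 1)) :=
      ⟨v' + v'' * D.path ((D.σ ^ (r + (t + 1))) k) b, by
        rw [add_mul, mul_assoc v'', ← path_add, ← hb, ← hv'']; abel⟩
    obtain ⟨w, hw⟩ := h8
    have h9 : p = (w * D.path ((D.σ ^ r) k) (t + 1)) * p * v := by
      rw [mul_assoc w, hp, ← path_add, ← hw, mul_assoc, h3, path_mul_e]
    have h10 : p = 0 := eq_zero_of_eq_mul_mul h9 (by
      rw [path_succ, ← mul_assoc]
      exact isNilpotent_mul_swap (D.nil _ _))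
    have h11 : D.path i (l + r) = 0 := by rw [path_add, hlk, ← hp, h10, zero_mul]
    rw [path_eq_zero_iff] at h11
    omega

/-- A generated submodule of maximal length is a direct summand. -/
lemma exists_retraction [IsNoetherian A M] {i : ι} {d : ℕ} {m : M}
    (h : D.IsGenerator i d (⟨m, Submodule.mem_span_singleton_self m⟩ : Submodule.span A {m}))
    (hd : d ≤ D.c i) (hmax : ∀ j (x : M), D.path j d • x = 0) :
    ∃ f : M →ₗ[A] Submodule.span A {m}, ∀ x : Submodule.span A {m}, f x = x := by
  classical
  set m' : Submodule.span A {m} := ⟨m, Submodule.mem_span_singleton_self m⟩ with hm'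
  -- Baer's argument: take a largest submodule to which the identity of `A m` extends, and enlarge
  -- it by one element `x`.
  let T : Set (Submodule A M) := {N | ∃ (hN : m ∈ N) (f : N →ₗ[A] Submodule.span A {m}),
    f ⟨m, hN⟩ = m'}
  have hT : T.Nonempty := ⟨_, Submodule.mem_span_singleton_self m, LinearMap.id, rfl⟩
  obtain ⟨N, ⟨hN, f, hf⟩, hNmax⟩ := set_has_maximal_iff_noetherian.2 ‹IsNoetherian A M› T hT
  suffices N = ⊤ by
    subst this
    refine ⟨f ∘ₗ Submodule.topEquiv.symm.toLinearMap, ?_⟩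
    rintro ⟨x, hx⟩
    obtain ⟨a, rfl⟩ := Submodule.mem_span_singleton.1 hx
    have h1 : (⟨a • m, hx⟩ : Submodule.span A {m}) = a • m' := rfl
    rw [h1]
    change (f ∘ₗ Submodule.topEquiv.symm.toLinearMap) (a • m) = _
    rw [map_smul]
    exact congrArg (a • ·) hf
  by_contra hNtop
  obtain ⟨j, x, hx, hxN⟩ : ∃ j x, D.e j • x = x ∧ x ∉ N := by
    by_contra! hcon
    refine hNtop (eq_top_iff.2 fun x _ => ?_)
    have := D.mem_span_e_smul x
    refine Submodule.span_le.2 ?_ this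
    rintro _ ⟨j, v, rfl⟩
    exact hcon j _ (by rw [← mul_smul, D.e_mul_e])
  -- With `n` least, `N` meets `A x` in the multiples of `path j n • x`. So the only condition on
  -- the image `t` of `x` is `path j n • t = f (path j n • x)`.
  have hex : ∃ n, D.path j n • x ∈ N := ⟨d, by rw [hmax]; exact N.zero_mem⟩
  obtain ⟨n, hnN, hnmin⟩ : ∃ n, D.path j n • x ∈ N ∧ ∀ k, D.path j k • x ∈ N → n ≤ k :=
    ⟨Nat.find hex, Nat.find_spec hex, fun k hk => Nat.find_min' hex hk⟩
  have hnd : n ≤ d := hnmin d (by rw [hmax]; exact N.zero_mem)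
  obtain ⟨t, ht, hty⟩ := h.exists_path_smul_eq (j := j) hd hnd (y := f ⟨_, hnN⟩)
    (by rw [← map_smul]; congr 1; exact Subtype.ext (by
          change D.e _ • _ • x = _; rw [← mul_smul, e_mul_path]))
    (by
      rw [← map_smul]
      convert map_zero f
      refine Subtype.ext ?_
      change D.path _ _ • _ • x = 0
      rw [← mul_smul, ← path_add, Nat.add_sub_cancel' hnd, hmax])
  have key : ∀ (z : A) (hz : z • x ∈ N), f ⟨z • x, hz⟩ = z • t := by
    intro z hz
    have hzx : z • x = (z * D.e j) • x := by rw [mul_smul, hx]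
    have hzt : z • t = (z * D.e j) • t := by rw [mul_smul, ht]
    obtain ⟨w, hw⟩ : ∃ w, z * D.e j = w * D.path j n := by
      by_cases hze : z * D.e j = 0
      · exact ⟨0, by rw [hze, zero_mul]⟩
      obtain ⟨k, hk, u, v, h1, h2, -⟩ := D.left_form (x := z * D.e j) (i := j)
        (by rw [mul_assoc, D.e_mul_e]) hze (one_mul 1) (one_mul _)
      have : D.path j k • x ∈ N := by
        rw [← D.e_mul_path, ← h2, mul_assoc, ← h1, mul_smul, ← hzx]
        exact N.smul_mem _ hz
      obtain ⟨b, rfl⟩ := Nat.exists_eq_add_of_le (hnmin k this)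
      exact ⟨u * D.path ((D.σ ^ n) j) b, by rw [h1, path_add, mul_assoc]⟩
    rw [hzt, hw, mul_smul, hty, ← map_smul]
    congr 1
    refine Subtype.ext ?_
    change z • x = w • D.path j n • x
    rw [hzx, hw, mul_smul]
  obtain ⟨φ, hφ⟩ := exists_map_of_span_singleton (span_singleton_self_eq_top (R := A) x) (y := t)
    (fun a ha => by
      have ha' : a • x = 0 := congrArg Subtype.val ha
      rw [← key a (by rw [ha']; exact N.zero_mem)]
      convert map_zero f
      exact ha')
  let F : M →ₗ.[A] Submodule.span A {m} := ⟨N, f⟩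
  let G : M →ₗ.[A] Submodule.span A {m} := ⟨Submodule.span A {x}, φ⟩
  have hFG : ∀ (a : F.domain) (b : G.domain), (a : M) = b → F a = G b := by
    rintro ⟨a, ha⟩ ⟨b, hb⟩ (rfl : a = b)
    obtain ⟨z, rfl⟩ := Submodule.mem_span_singleton.1 hb
    change f ⟨z • x, ha⟩ = φ (z • ⟨x, Submodule.mem_span_singleton_self x⟩)
    rw [key, map_smul, hφ]
  have hlt : N < N ⊔ Submodule.span A {x} := by
    rw [left_lt_sup, Submodule.span_singleton_le_iff_mem]
    exact hxN
  refine hNmax (N ⊔ Submodule.span A {x}) ⟨hlt.le hN, (F.sup G hFG).toFun, ?_⟩ hlt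
  have := (LinearPMap.left_le_sup F G hFG).2 (x := ⟨m, hN⟩) (y := ⟨m, hlt.le hN⟩) rfl
  exact this.symm.trans hf

end SerialData

end NakayamaGP

/-! ### Gorenstein projective modules. -/

namespace NakayamaGP

section GorensteinProjective

variable {A : Type u} [Ring A]

lemma IsGorensteinProjective.finite {M : Type u} [AddCommGroup M] [Module A M]
    (h : IsGorensteinProjective A M) : Module.Finite A M := by
  obtain ⟨P, d, hP, -, -, ⟨f⟩⟩ := h
  have := (hP (-1 + 1)).1
  exact Module.Finite.equiv f.symm

/-- The images of the differentials are syzygies of one another, which reduces all degrees to the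
first. There, exactness of the dual complex says exactly that maps from an image to `A` extend. -/
lemma IsGorensteinProjective.extVanishes {M : Type u} [AddCommGroup M] [Module A M]
    (h : IsGorensteinProjective A M) (n : ℕ) : ExtVanishes (A := A) M A (n + 1) := by
  obtain ⟨P, d, hP, hd, hH, ⟨f⟩⟩ := h
  have hex : ∀ i, Function.Exact (LinearMap.range (d (i + 1))).subtype (d i).rangeRestrict := by
    intro i x
    rw [← LinearMap.coe_range, Submodule.range_subtype, SetLike.mem_coe, LinearMap.mem_range,
      Subtype.ext_iff]
    exact hd i x
  have key : ∀ (n : ℕ) (i : ℤ), ExtVanishes (A := A) (LinearMap.range (d i)) A (n + 1) := by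
    intro n
    induction n with
    | zero =>
      intro i
      have := (hP (i + 1)).2
      refine (extVanishes_one_iff (LinearMap.range (d (i + 1))).injective_subtype
        (d i).surjective_rangeRestrict (hex i)).2 fun φ => ?_
      obtain ⟨χ, hχ⟩ := (hH (i + 1) (φ ∘ₗ (d (i + 1)).rangeRestrict)).1 (by
        ext x
        have h0 : (d (i + 1)) ((d (i + 1 + 1)) x) = 0 := (hd (i + 1)).apply_apply_eq_zero x
        refine (congrArg φ (Subtype.ext ?_)).trans (map_zero φ)
        exact h0)
      refine ⟨χ, ?_⟩
      ext ⟨x, y, rfl⟩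
      exact LinearMap.congr_fun hχ y
    | succ n ih =>
      intro i
      have := (hP (i + 1)).2
      exact (extVanishes_succ_iff (LinearMap.range (d (i + 1))).injective_subtype
        (d i).surjective_rangeRestrict (hex i) n.succ_pos).2 (ih (i + 1))
  exact (key n (-1)).of_retract f.toLinearMap f.symm.toLinearMap (by ext; simp)

end GorensteinProjective

namespace SerialData

variable {A : Type u} [Ring A] {ι : Type w} (D : SerialData A ι)

/-- A section of `A e i → P` sends `p` to some `z` in `e i A e i` with `z • p = p`. Such a `z` is
not nilpotent, hence a unit of this local ring, so anything that kills `p` kills `e i`. -/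
lemma isGenerator_of_projective {P : Type u} [AddCommGroup P] [Module A P] [Module.Projective A P]
    {i : ι} {p : P} (hspan : Submodule.span A {p} = ⊤) (hp : D.e i • p = p) (h0 : p ≠ 0) :
    D.IsGenerator i (D.c i) p := by
  refine ⟨hspan, fun x => ?_⟩
  rw [D.path_eq_zero_iff.2 le_rfl]
  simp only [mul_zero, exists_const]
  constructor
  · intro hx
    have hsurj : Function.Surjective (D.cover i p) := by
      intro y
      obtain ⟨a, rfl⟩ := Submodule.mem_span_singleton.1
        (hspan ▸ Submodule.mem_top : y ∈ Submodule.span A {p})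
      refine ⟨⟨a * D.e i, Submodule.mem_span_singleton.2 ⟨a, rfl⟩⟩, ?_⟩
      simp [cover, mul_smul, hp]
    obtain ⟨s, hs⟩ := Module.projective_lifting_property (D.cover i p) LinearMap.id hsurj
    have hsp : (s p : A) • p = p := LinearMap.congr_fun hs p
    obtain ⟨z, hz⟩ : ∃ z, z = (s p : A) := ⟨_, rfl⟩
    have hze : z * D.e i = z := by
      obtain ⟨b, hb⟩ := Submodule.mem_span_singleton.1 (s p).2
      rw [hz, ← hb, smul_eq_mul, mul_assoc, D.e_mul_e]
    have hez : D.e i * z = z := by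
      rw [hz]
      nth_rw 2 [← hp]
      rw [map_smul]; rfl
    have hxz : x * z = 0 := by
      have : s (x • p) = 0 := by rw [hx, map_zero]
      rw [map_smul] at this
      rw [hz]
      exact congrArg Subtype.val this
    rw [← hz] at hsp
    rcases D.left_gen i z hze with ⟨v, hv⟩ | ⟨v, hv⟩
    · have h1 := D.mul_eq_e_swap (u := z) (v := D.e i * v * D.e i) hez
        (by rw [mul_assoc, D.e_mul_e]) (by rw [← mul_assoc, ← mul_assoc, D.e_mul_e])
        (by rw [mul_assoc, hez, mul_assoc, hv, D.e_mul_e])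
      rw [← h1, ← mul_assoc, hxz, zero_mul]
    · refine absurd (smul_eq_zero_of_isNilpotent ?_ hsp) h0
      rw [hv]
      exact isNilpotent_mul_swap (D.nil _ _)
  · intro hx
    rw [← hp, ← mul_smul, hx, zero_smul]

lemma IsGenerator.not_projective {D : SerialData A ι} {M : Type u} [AddCommGroup M] [Module A M]
    {i : ι} {n : ℕ} {m : M} (h : D.IsGenerator i n m) (h0 : 0 < n) (hn : n < D.c i) :
    ¬ Module.Projective A M := by
  intro hp
  have hm : m ≠ 0 := by
    have := h.path_smul_ne_zero h0 hn.le
    rwa [path_zero, h.e_smul] at this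
  have h1 := D.isGenerator_of_projective h.span h.e_smul hm
  exact h1.path_smul_ne_zero hn le_rfl ((h.smul_eq_zero_iff _).2 ⟨1, by simp⟩)

/-- A nonprojective module of finite length has a nonprojective direct summand with a generator. -/
lemma exists_nonprojective_retract {M : Type u} [AddCommGroup M] [Module A M] [IsNoetherian A M]
    [IsArtinian A M] (N : Submodule A M) (hN : ¬ Module.Projective A N) :
    ∃ (U : Type u) (_ : AddCommGroup U) (_ : Module A U) (i : ι) (n : ℕ) (m : U),
      D.IsGenerator i n m ∧ 0 < n ∧ n < D.c i ∧
      ∃ (a : U →ₗ[A] N) (b : N →ₗ[A] U), b ∘ₗ a = LinearMap.id := by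
  induction N using IsWellFounded.induction (· < · : Submodule A M → Submodule A M → Prop) with
  | _ N ih =>
  have hnt : Nontrivial N := by
    by_contra h
    rw [not_nontrivial_iff_subsingleton] at h
    exact hN inferInstance
  -- A uniform bound on path lengths lets one choose a generated submodule of the largest possible
  -- `d`; it is then a direct summand.
  obtain ⟨l, hl⟩ := D.path_nil
  have hl' : ∀ i, D.c i ≤ l := fun i => D.path_eq_zero_iff.1 (hl i)
  let T : Set ℕ := {d | ∃ i, ∃ m : N, D.e i • m = m ∧ m ≠ 0 ∧ 0 < d ∧ d ≤ D.c i ∧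
    D.IsGenerator i d (⟨m, Submodule.mem_span_singleton_self m⟩ : Submodule.span A {m})}
  have hT : T.Nonempty := by
    obtain ⟨i, m, hm, h0⟩ := D.exists_e_smul_eq_self (M := N)
    obtain ⟨d, h1, h2, h3⟩ := D.exists_isGenerator hm h0
    exact ⟨d, i, m, hm, h0, h1, h2, h3⟩
  have hTb : BddAbove T := ⟨l, fun d ⟨i, m, _, _, _, h, _⟩ => h.trans (hl' i)⟩
  obtain ⟨i, m, hm, h0, hd0, hdc, hgen⟩ := Nat.sSup_mem hT hTb
  set d := sSup T with hd
  obtain ⟨f, hf⟩ := D.exists_retraction hgen hdc (fun j x => by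
    rw [← D.path_mul_e j d, mul_smul]
    by_cases hx : D.e j • x = 0
    · rw [hx, smul_zero]
    have hx1 : D.e j • D.e j • x = D.e j • x := by rw [← mul_smul, D.e_mul_e]
    obtain ⟨d', h1, h2, h3⟩ := D.exists_isGenerator hx1 hx
    obtain ⟨t, ht⟩ := Nat.exists_eq_add_of_le
      (le_csSup hTb (show d' ∈ T from ⟨j, _, hx1, hx, h1, h2, h3⟩))
    rw [← hd] at ht
    have h4 := (h3.smul_eq_zero_iff (D.path j d)).2
      ⟨D.path ((D.σ ^ d') j) t, by rw [path_mul_e, ht, path_add]⟩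
    exact congrArg Subtype.val h4)
  rcases hdc.lt_or_eq with hlt | heq
  · exact ⟨Submodule.span A {m}, inferInstance, inferInstance, i, d, _, hgen, hd0, hlt,
      Submodule.subtype _, f, by ext x; simp [hf]⟩
  -- Here the summand is projective, so its complement is not, and the induction continues with that
  -- smaller submodule.
  · rw [heq] at hgen
    have hproj := hgen.projective
    have hcompl := LinearMap.isCompl_of_proj hf
    let K : Submodule A M := (LinearMap.ker f).map N.subtype
    have eK : LinearMap.ker f ≃ₗ[A] K :=
      Submodule.equivMapOfInjective _ N.injective_subtype _
    have hK : ¬ Module.Projective A K := by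
      intro hK
      have : Module.Projective A (LinearMap.ker f) := Module.Projective.of_equiv eK.symm
      exact hN (Module.Projective.of_equiv (Submodule.prodEquivOfIsCompl _ _ hcompl))
    have hKlt : K < N := by
      refine lt_of_le_of_ne (Submodule.map_subtype_le _ _) fun hKN => h0 ?_
      have h1 : (m : M) ∈ K := by rw [hKN]; exact m.2
      obtain ⟨m', hm', h2⟩ := (Submodule.mem_map).1 h1
      have h3 : m' = m := Subtype.ext h2
      subst h3
      have h4 := hf ⟨m', Submodule.mem_span_singleton_self m'⟩
      rw [LinearMap.mem_ker.1 hm'] at h4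
      exact (congrArg Subtype.val h4).symm
    obtain ⟨U, _, _, i', n, u, h1, h2, h3, a, b, hab⟩ := ih K hKlt hK
    obtain ⟨r, hr⟩ : ∃ r : N →ₗ[A] LinearMap.ker f, ∀ x : LinearMap.ker f, r x = x :=
      ⟨Submodule.projectionOnto _ _ hcompl.symm, fun x =>
        Submodule.projectionOnto_apply_left hcompl.symm x⟩
    refine ⟨U, _, _, i', n, u, h1, h2, h3,
      (LinearMap.ker f).subtype ∘ₗ eK.symm.toLinearMap ∘ₗ a, b ∘ₗ eK.toLinearMap ∘ₗ r, ?_⟩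
    ext x
    simpa [hr] using LinearMap.congr_fun hab x

/-- If no forward orbit of the resolution quiver is black, then a module of finite length all of
whose positive self-extension groups with the ring vanish is projective. -/
theorem projective_of_extVanishes [Finite ι] [IsArtinianRing A]
    (h : ∀ i ∈ Function.periodicPts D.next, ∃ k, ¬ D.Black (D.next^[k] i))
    {M : Type u} [AddCommGroup M] [Module A M] [Module.Finite A M]
    (hM : ∀ n, ExtVanishes (A := A) M A (n + 1)) : Module.Projective A M := by
  by_contra hnp
  have hnp' : ¬ Module.Projective A (⊤ : Submodule A M) := fun hp =>
    hnp (Module.Projective.of_equiv Submodule.topEquiv)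
  obtain ⟨U, _, _, i, n, m, hgen, hn0, hnc, a, b, hab⟩ := D.exists_nonprojective_retract _ hnp'
  have hU : ∀ k, ExtVanishes (A := A) U A (k + 1) := fun k =>
    (hM k).of_retract (Submodule.subtype _ ∘ₗ a) (b ∘ₗ Submodule.topEquiv.symm.toLinearMap) (by
      ext x
      exact LinearMap.congr_fun hab x)
  have hq : (i, n).2 ≤ D.c (i, n).1 := hnc.le
  -- Vanishing of `Ext` makes the vertex black, and a proper nonzero quotient at a black vertex has
  -- a syzygy of the same kind. Thus no syzygy is ever zero or projective.
  have hsyz : ∀ k, 0 < (D.syz^[k] (i, n)).2 ∧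
      (D.syz^[k] (i, n)).2 < D.c (D.syz^[k] (i, n)).1 := by
    intro k
    induction k with
    | zero => exact ⟨hn0, hnc⟩
    | succ k ih =>
      have hb : D.Black (D.syz^[k] (i, n)).1 :=
        (hgen.extVanishes_iff (q := (i, n)) hq k).1 (hU k) ih.1 ih.2
      rw [Function.iterate_succ_apply']
      generalize D.syz^[k] (i, n) = q at ih hb
      obtain ⟨t, ht⟩ := Nat.exists_eq_succ_of_ne_zero ih.1.ne'
      have h1 := D.c_le_add (D.σ q.1) t
      rw [← Equiv.Perm.mul_apply, ← pow_succ, ← Nat.succ_eq_add_one, ← ht] at h1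
      have h2 : D.c q.1 ≤ D.c (D.σ q.1) := hb
      simp only [syz]
      omega
  have hblack : ∀ k, D.Black (D.next^[k] i) := fun k => by
    have := (hgen.extVanishes_iff (q := (i, n)) hq (2 * k)).1 (hU _) (hsyz _).1 (hsyz _).2
    rwa [(D.syz_iterate_two_mul hq k).1] at this
  obtain ⟨k, hk⟩ := exists_iterate_mem_periodicPts D.next i
  obtain ⟨k', hk'⟩ := h _ hk
  rw [← Function.iterate_add_apply] at hk'
  exact hk' (hblack _)

/-- The map between the modules `A e (w (i + 1))` and `A e (w i)` given by right multiplication by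
a path is exact with the next one. -/
lemma exact_cover_cover {i j k : ι} {n : ℕ} (hj : (D.σ ^ n) i = j) (hn : n ≤ D.c i)
    (hk : (D.σ ^ (D.c i - n)) j = k) (x : Submodule.span A {D.e j})
    (y : Submodule.span A {D.e i}) (hx : (x : A) = D.path j (D.c i - n))
    (hy : (y : A) = D.path i n) :
    Function.Exact (D.cover k x) (D.cover j y) := by
  rintro ⟨a, ha⟩
  obtain ⟨z, rfl⟩ := Submodule.mem_span_singleton.1 ha
  have h1 : D.cover j y ⟨z • D.e j, ha⟩ = 0 ↔ (z * D.e j) * D.path i n = 0 := by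
    rw [← hy, Subtype.ext_iff]; rfl
  rw [h1, D.mul_path_eq_zero_iff hj hn (by rw [mul_assoc, D.e_mul_e])]
  constructor
  · rintro ⟨v, hv⟩
    refine ⟨⟨v * D.e k, Submodule.mem_span_singleton.2 ⟨v, rfl⟩⟩, Subtype.ext ?_⟩
    change (v * D.e k) * (x : A) = z * D.e j
    rw [hx, hv, ← hk, mul_assoc, D.e_mul_path]
  · rintro ⟨⟨b, hb⟩, hbx⟩
    exact ⟨b, by rw [← hx]; exact (congrArg Subtype.val hbx).symm⟩

/-- A doubly infinite sequence of black vertices joined by paths of complementary lengths gives a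
Gorenstein projective module. -/
lemma isGorensteinProjective_of_sequence (w : ℤ → ι) (l : ℤ → ℕ)
    (hw : ∀ i, (D.σ ^ l i) (w i) = w (i + 1)) (hl : ∀ i, l i + l (i + 1) = D.c (w i))
    (hl0 : ∀ i, 0 < l i) (hb : ∀ i, D.Black (w i)) :
    IsGorensteinProjective A (Submodule.span A {D.path (w (-1)) (l (-1))}) := by
  have hmem : ∀ i, D.path (w i) (l i) ∈ Submodule.span A {D.e (w i)} := fun i =>
    span_path_le _ _ (Submodule.mem_span_singleton_self _)
  have hlc : ∀ i, l i < D.c (w i) := fun i => by have := hl i; have := hl0 (i + 1); omega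
  have hsub : ∀ i, D.c (w i) - l i = l (i + 1) := fun i => by have := hl i; omega
  refine ⟨fun i => ModuleCat.of A (Submodule.span A {D.e (w i)}),
    fun i => D.cover (w (i + 1)) (⟨_, hmem i⟩ : Submodule.span A {D.e (w i)}),
    fun i => ⟨Module.Finite.span_singleton A _, inferInstanceAs (Module.Projective A
      (Submodule.span A {D.e (w i)}))⟩, fun i => ?_, fun i => ?_, ?_⟩
  · exact D.exact_cover_cover (hw i) (hlc i).le (by rw [hsub, hw]) _ _ (by rw [hsub]) rfl
  · intro φ
    constructor
    · intro hφ
      -- A cocycle is determined by its value on the idempotent, and this value is killed by the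
      -- next path; blackness factors it through the preceding differential.
      obtain ⟨t, ht⟩ := D.exists_eq_path_mul (hb i) (hw i) (hlc i)
        (y := φ ⟨D.e (w (i + 1)), Submodule.mem_span_singleton_self _⟩)
        (by
          rw [← smul_eq_mul, ← map_smul]
          exact congrArg φ (Subtype.ext (D.e_mul_e _)))
        (by
          have h1 := LinearMap.congr_fun hφ ⟨D.e (w (i + 1 + 1)), Submodule.mem_span_singleton_self _⟩
          rw [hsub, ← smul_eq_mul, ← map_smul]
          refine (congrArg φ (Subtype.ext ?_)).trans h1
          change D.path _ _ * D.e _ = D.e _ * D.path _ _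
          rw [path_mul_e, ← hw (i + 1), e_mul_path])
      refine ⟨LinearMap.toSpanSingleton A A t ∘ₗ Submodule.subtype _, ?_⟩
      ext ⟨x, hx⟩
      obtain ⟨a, rfl⟩ := Submodule.mem_span_singleton.1 hx
      have h2 : (⟨a • D.e (w (i + 1)), hx⟩ : Submodule.span A {D.e (w (i + 1))}) =
        a • ⟨D.e (w (i + 1)), Submodule.mem_span_singleton_self _⟩ := rfl
      rw [h2]
      erw [map_smul φ]
      rw [ht]
      change (a * D.e _) * D.path _ _ * t = a * (D.path _ _ * t)
      rw [mul_assoc a, ← hw i, e_mul_path, mul_assoc]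
    · rintro ⟨χ, rfl⟩
      have h1 : Function.Exact
          (D.cover (w (i + 1 + 1)) (⟨_, hmem (i + 1)⟩ : Submodule.span A {D.e (w (i + 1))}))
          (D.cover (w (i + 1)) (⟨_, hmem i⟩ : Submodule.span A {D.e (w i)})) :=
        D.exact_cover_cover (hw i) (hlc i).le (by rw [hsub, hw]) _ _ (by rw [hsub]) rfl
      ext x
      exact (congrArg χ (h1.apply_apply_eq_zero x)).trans (map_zero χ)
  · refine ⟨LinearEquiv.trans (LinearEquiv.ofEq _ _ ?_)
      (Submodule.equivMapOfInjective (Submodule.subtype (Submodule.span A {D.e (w (-1))}))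
        (Submodule.injective_subtype _) (LinearMap.range (D.cover (w (-1 + 1))
        (⟨_, hmem (-1)⟩ : Submodule.span A {D.e (w (-1))})))).symm⟩
    rw [← LinearMap.range_comp]
    refine le_antisymm ?_ ?_
    · rw [Submodule.span_singleton_le_iff_mem]
      refine ⟨⟨D.e (w (-1 + 1)), Submodule.mem_span_singleton_self _⟩, ?_⟩
      change D.e _ * D.path _ _ = _
      rw [← hw (-1), e_mul_path]
    · rintro _ ⟨⟨x, hx⟩, rfl⟩
      exact Submodule.mem_span_singleton.2 ⟨x, rfl⟩

/-- If some periodic orbit of the resolution quiver is black, and its period under `σ` is smaller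
than the lengths of the projective modules, then there is a Gorenstein projective module which is
not projective. -/
theorem exists_isGorensteinProjective {i : ι} (hi : i ∈ Function.periodicPts D.next)
    (hb : ∀ k, D.Black (D.next^[k] i)) {t : ℕ} (ht0 : 0 < t)
    (ht : ∀ j, t < D.c j) (hti : (D.σ ^ t) i = i) :
    ∃ (M : Type u) (_ : AddCommGroup M) (_ : Module A M),
      IsGorensteinProjective A M ∧ ¬ Module.Projective A M := by
  obtain ⟨N, hN, hNi⟩ := hi
  have hN' : (0 : ℤ) < N := by exact_mod_cast hN
  have hnext : ∀ m, (D.σ ^ t) (D.next^[m] i) = D.next^[m] i := by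
    intro m
    induction m with
    | zero => exact hti
    | succ m ih =>
      rw [Function.iterate_succ_apply', next, ← Equiv.Perm.mul_apply, ← pow_add, add_comm, pow_add,
        Equiv.Perm.mul_apply, ih]
  -- The periodic orbit is continued to negative indices by reducing modulo its period `N`, as a
  -- complete resolution runs in both directions.
  obtain ⟨g, hg⟩ : ∃ g : ℤ → ι, g = fun q => D.next^[(q % (N : ℤ)).toNat] i := ⟨_, rfl⟩
  have hgb : ∀ q, D.Black (g q) := fun q => by rw [hg]; exact hb _
  have hgt : ∀ q, (D.σ ^ t) (g q) = g q := fun q => by rw [hg]; exact hnext _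
  have hgs : ∀ q, g (q + 1) = D.next (g q) := by
    intro q
    rw [hg]
    have h1 := Int.emod_nonneg q hN'.ne'
    have h2 := Int.emod_lt_of_pos q hN'
    rw [← Function.iterate_succ_apply' D.next]
    change D.next^[((q + 1) % (N : ℤ)).toNat] i = D.next^[(q % (N : ℤ)).toNat + 1] i
    rw [← Int.emod_add_emod]
    rcases (show q % N + 1 < N ∨ q % N + 1 = N by omega) with h3 | h3
    · rw [Int.emod_eq_of_lt (by omega) h3]
      congr 2
      omega
    · rw [h3, Int.emod_self, show (q % N).toNat + 1 = N by omega]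
      exact hNi.symm
  -- Each vertex of the orbit occurs twice: the path of length `t` returns to it, and the path of
  -- length `c - t` leads to its image under `next`.
  obtain ⟨w, hw⟩ : ∃ w : ℤ → ι, w = fun q => g (q / 2) := ⟨_, rfl⟩
  obtain ⟨l, hl⟩ : ∃ l : ℤ → ℕ, l = fun q => if q % 2 = 0 then t else D.c (w q) - t := ⟨_, rfl⟩
  have heven : ∀ q : ℤ, q % 2 = 0 → w (q + 1) = w q ∧ l q = t ∧ l (q + 1) = D.c (w q) - t := by
    intro q hq
    have h1 : w (q + 1) = w q := by rw [hw]; change g _ = g _; congr 1; omega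
    refine ⟨h1, by rw [hl]; exact if_pos hq, ?_⟩
    rw [← h1, hl]
    exact if_neg (by omega)
  have hodd : ∀ q : ℤ, q % 2 ≠ 0 → w (q + 1) = D.next (w q) ∧ l q = D.c (w q) - t ∧
      l (q + 1) = t := by
    intro q hq
    refine ⟨?_, by rw [hl]; exact if_neg hq, by rw [hl]; exact if_pos (by omega)⟩
    rw [hw]
    change g _ = D.next (g _)
    rw [← hgs]; congr 1; omega
  have hwt : ∀ q, (D.σ ^ t) (w q) = w q := fun q => by rw [hw]; exact hgt _
  refine ⟨_, _, _, D.isGorensteinProjective_of_sequence w l (fun q => ?_) (fun q => ?_)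
    (fun q => ?_) (fun q => by rw [hw]; exact hgb _), fun hp => ?_⟩
  · by_cases hq : q % 2 = 0
    · rw [(heven q hq).1, (heven q hq).2.1, hwt]
    · rw [(hodd q hq).1, (hodd q hq).2.1, next]
      nth_rw 2 [← hwt q]
      rw [← Equiv.Perm.mul_apply, ← pow_add, Nat.sub_add_cancel (ht _).le]
  · have := ht (w q)
    by_cases hq : q % 2 = 0
    · rw [(heven q hq).2.1, (heven q hq).2.2]; omega
    · rw [(hodd q hq).2.1, (hodd q hq).2.2]; omega
  · have := ht (w q)
    by_cases hq : q % 2 = 0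
    · rw [(heven q hq).2.1]; omega
    · rw [(hodd q hq).2.1]; omega
  · have h1 : l (-1) = D.c (w (-1)) - t := (hodd (-1) (by decide)).2.1
    have h2 := ht (w (-1))
    refine (isGenerator_path (D := D) (i := w (-1)) (n := l (-1)) (by omega)).not_projective
      (by omega) ?_ hp
    have := ht ((D.σ ^ l (-1)) (w (-1)))
    omega

end SerialData

end NakayamaGP

/-! ### Primitive idempotents in serial rings. -/

namespace NakayamaGP

section Primitive

variable {A : Type u} [Ring A]

/-- An idempotent `g` such that `A g` is indecomposable. -/
def IsPrimitiveIdem (g : A) : Prop := g * g = g ∧ IsIndecomposable A (Submodule.span A {g})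

lemma exists_idempotents_of_isCompl {f : A} (hf : f * f = f)
    {p q : Submodule A (Submodule.span A {f})} (hpq : IsCompl p q) :
    ∃ x y : A, x * x = x ∧ y * y = y ∧ x * y = 0 ∧ y * x = 0 ∧ x + y = f ∧
      (x = 0 → p = ⊥) ∧ (y = 0 → q = ⊥) := by
  obtain ⟨x, hx, y, hy, hxy⟩ := Submodule.mem_sup.1
    (hpq.sup_eq_top ▸ Submodule.mem_top :
      (⟨f, Submodule.mem_span_singleton_self f⟩ : Submodule.span A {f}) ∈ p ⊔ q)
  have hxf : ∀ z : Submodule.span A {f}, (z : A) * f = z := by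
    rintro ⟨z, hz⟩
    obtain ⟨b, rfl⟩ := Submodule.mem_span_singleton.1 hz
    simp [mul_assoc, hf]
  have hxy' : (x : A) + y = f := congrArg Subtype.val hxy
  have key : ∀ z : Submodule.span A {f}, z = (z : A) • x + (z : A) • y := by
    intro z
    rw [← smul_add, hxy]
    exact Subtype.ext (hxf z).symm
  have hzero : ∀ a ∈ p, ∀ b ∈ q, a = b → a = 0 := fun a ha b hb hab => by
    have := hpq.inf_eq_bot
    rw [← Submodule.mem_bot A, ← this]
    exact ⟨ha, hab ▸ hb⟩
  have hp : ∀ z ∈ p, (z : A) • x = z ∧ (z : A) • y = 0 := by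
    intro z hz
    have h1 : z - (z : A) • x = (z : A) • y := by
      rw [sub_eq_iff_eq_add, add_comm]; exact key z
    have h2 := hzero _ (p.sub_mem hz (p.smul_mem _ hx)) _ (q.smul_mem _ hy) h1
    exact ⟨(sub_eq_zero.1 h2).symm, by rw [← h1, h2]⟩
  have hq : ∀ z ∈ q, (z : A) • y = z ∧ (z : A) • x = 0 := by
    intro z hz
    have h1 : (z : A) • x = z - (z : A) • y := by
      rw [eq_sub_iff_add_eq]; exact (key z).symm
    have h2 := hzero _ (p.smul_mem _ hx) _ (q.sub_mem hz (q.smul_mem _ hy)) h1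
    refine ⟨?_, h2⟩
    rw [h1] at h2
    exact (sub_eq_zero.1 h2).symm
  refine ⟨x, y, congrArg Subtype.val (hp x hx).1, congrArg Subtype.val (hq y hy).1,
    congrArg Subtype.val (hp x hx).2, congrArg Subtype.val (hq y hy).2, hxy',
    fun h => ?_, fun h => ?_⟩
  · rw [eq_bot_iff]
    intro z hz
    rw [Submodule.mem_bot, ← (hp z hz).1, show x = 0 from Subtype.ext h, smul_zero]
  · rw [eq_bot_iff]
    intro z hz
    rw [Submodule.mem_bot, ← (hq z hz).1, show y = 0 from Subtype.ext h, smul_zero]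

/-- An idempotent that is not primitive splits into two orthogonal ones generating strictly smaller
left ideals, so the descending chain condition ends the process. -/
lemma one_mem_closure_isPrimitiveIdem [IsArtinianRing A] :
    (1 : A) ∈ AddSubmonoid.closure {g : A | IsPrimitiveIdem g} := by
  suffices ∀ (N : Ideal A) (f : A), f * f = f → Submodule.span A {f} = N →
      f ∈ AddSubmonoid.closure {g : A | IsPrimitiveIdem g} from this _ 1 (mul_one 1) rfl
  intro N
  induction N using IsWellFounded.induction (· < · : Ideal A → Ideal A → Prop) with
  | _ N ih =>
  intro f hf hN
  subst hN
  by_cases hnt : Nontrivial (Submodule.span A {f})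
  swap
  · have : f = 0 := by
      rw [not_nontrivial_iff_subsingleton] at hnt
      exact congrArg Subtype.val
        (hnt.elim ⟨f, Submodule.mem_span_singleton_self f⟩ 0)
    rw [this]
    exact zero_mem _
  by_cases hi : IsPrimitiveIdem f
  · exact AddSubmonoid.subset_closure hi
  have hi' : ¬ ∀ p q : Submodule A (Submodule.span A {f}), IsCompl p q → p = ⊥ ∨ q = ⊥ :=
    fun h => hi ⟨hf, hnt, h⟩
  push Not at hi'
  obtain ⟨p, q, hpq, hp, hq⟩ := hi'
  obtain ⟨x, y, hxx, hyy, hxy, hyx, rfl, hxp, hyq⟩ := exists_idempotents_of_isCompl hf hpq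
  have hlt : ∀ a b : A, a * a = a → b * b = b → a * b = 0 → b ≠ 0 →
      Submodule.span A {a} < Submodule.span A {a + b} := by
    intro a b ha hb hab hb0
    refine lt_of_le_of_ne ?_ fun h => hb0 ?_
    · exact (Submodule.span_singleton_le_iff_mem _ _).2
        (Submodule.mem_span_singleton.2 ⟨a, by rw [smul_eq_mul, mul_add, ha, hab, add_zero]⟩)
    · obtain ⟨c, hc⟩ := Submodule.mem_span_singleton.1
        (h ▸ Submodule.mem_span_singleton_self (a + b))
      rw [← hb, ← zero_add (b * b), ← hab, ← add_mul, ← hc, smul_eq_mul, mul_assoc, hab, mul_zero]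
  exact add_mem (ih _ (hlt x y hxx hyy hxy fun h => hq (hyq h)) x hxx rfl)
    (ih _ (by rw [add_comm]; exact hlt y x hyy hxx hyx fun h => hp (hxp h)) y hyy rfl)

/-- Decompositions on either side amount to writing `g` as a sum of two orthogonal idempotents, a
symmetric condition. -/
lemma IsPrimitiveIdem.op {g : A} (hg : IsPrimitiveIdem g) : IsPrimitiveIdem (op g) := by
  obtain ⟨hgg, hnt, hg⟩ := hg
  have hop : MulOpposite.op g * MulOpposite.op g = MulOpposite.op g := by rw [← op_mul, hgg]
  refine ⟨hop, ?_, fun p q hpq => ?_⟩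
  · refine ⟨⟨MulOpposite.op g, Submodule.mem_span_singleton_self _⟩, 0, fun h => ?_⟩
    have h0 : g = 0 := by simpa using congrArg Subtype.val h
    rw [h0, Submodule.span_singleton_eq_bot.2 rfl] at hnt
    exact not_subsingleton _ (inferInstance : Subsingleton (⊥ : Submodule A A))
  · obtain ⟨x, y, hxx, hyy, hxy, hyx, hxyg, hxp, hyq⟩ := exists_idempotents_of_isCompl hop hpq
    obtain ⟨x, rfl⟩ := op_surjective x
    obtain ⟨y, rfl⟩ := op_surjective y
    rw [← op_mul, op_eq_zero_iff] at hxy hyx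
    rw [← op_mul, op_inj] at hxx hyy
    rw [← MulOpposite.op_add, op_inj] at hxyg
    rw [op_eq_zero_iff] at hxp hyq
    have hxg : x ∈ Submodule.span A {g} := Submodule.mem_span_singleton.2
      ⟨x, by rw [← hxyg, smul_eq_mul, mul_add, hxx, hyx, add_zero]⟩
    have hyg : y ∈ Submodule.span A {g} := Submodule.mem_span_singleton.2
      ⟨y, by rw [← hxyg, smul_eq_mul, mul_add, hyy, hxy, zero_add]⟩
    have hc : IsCompl ((Submodule.span A {x}).comap (Submodule.span A {g}).subtype)
        ((Submodule.span A {y}).comap (Submodule.span A {g}).subtype) := by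
      constructor
      · rw [Submodule.disjoint_def]
        rintro ⟨z, hz⟩ h1 h2
        obtain ⟨a, ha⟩ := Submodule.mem_span_singleton.1 (show z ∈ Submodule.span A {x} from h1)
        obtain ⟨b, hb⟩ := Submodule.mem_span_singleton.1 (show z ∈ Submodule.span A {y} from h2)
        refine Subtype.ext (show z = 0 from ?_)
        rw [← ha, smul_eq_mul, ← hxx, ← mul_assoc, ← smul_eq_mul a, ha, ← hb, smul_eq_mul,
          mul_assoc, hxy, mul_zero]
      · rw [codisjoint_iff, eq_top_iff]
        rintro ⟨z, hz⟩ -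
        obtain ⟨a, rfl⟩ := Submodule.mem_span_singleton.1 hz
        refine Submodule.mem_sup.2 ⟨⟨a • x, Submodule.smul_mem _ _ hxg⟩,
          Submodule.mem_span_singleton.2 ⟨a, rfl⟩, ⟨a • y, Submodule.smul_mem _ _ hyg⟩,
          Submodule.mem_span_singleton.2 ⟨a, rfl⟩, Subtype.ext ?_⟩
        change a • x + a • y = a • g
        rw [← smul_add, hxyg]
    refine (hg _ _ hc).imp (fun h => hxp ?_) (fun h => hyq ?_)
    · exact congrArg Subtype.val ((Submodule.eq_bot_iff _).1 h ⟨x, hxg⟩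
        (Submodule.mem_span_singleton_self x))
    · exact congrArg Subtype.val ((Submodule.eq_bot_iff _).1 h ⟨y, hyg⟩
        (Submodule.mem_span_singleton_self y))

lemma IsUniserial.le_or_le {M : Type u} [AddCommGroup M] [Module A M] {N : Submodule A M}
    (h : IsUniserial A N) {p q : Submodule A M} (hp : p ≤ N) (hq : q ≤ N) : p ≤ q ∨ q ≤ p := by
  refine (h (p.comap N.subtype) (q.comap N.subtype)).imp ?_ ?_
  · intro h1 x hx
    exact h1 (show (⟨x, hp hx⟩ : N) ∈ _ from hx)
  · intro h1 x hx
    exact h1 (show (⟨x, hq hx⟩ : N) ∈ _ from hx)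

lemma IsPrimitiveIdem.isUniserial (hA : IsLeftSerial A) {g : A} (hg : IsPrimitiveIdem g) :
    IsUniserial A (Submodule.span A {g}) :=
  hA _ (Module.Finite.span_singleton A g) (SerialData.projective_span_idem hg.1) hg.2

lemma IsPrimitiveIdem.ne_zero {g : A} (hg : IsPrimitiveIdem g) : g ≠ 0 := by
  rintro rfl
  have := hg.2.1
  rw [Submodule.span_singleton_eq_bot.2 rfl] at this
  exact not_subsingleton _ (inferInstance : Subsingleton (⊥ : Submodule A A))

/-- Choose a maximal left ideal `m` missing `u`. Then `g` is in `m + A u`, and since `A g` is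
uniserial, `m ∩ A g` lies inside `A u`; hence so does `g`. -/
lemma IsPrimitiveIdem.exists_mul_eq (hA : IsLeftSerial A) {g : A} (hg : IsPrimitiveIdem g) {u : A}
    (hu : u * g = u) (hr : u ∉ Ring.jacobson A) : ∃ v, v * u = g := by
  rw [Ring.jacobson_eq_sInf_isMaximal, Submodule.mem_sInf] at hr
  push Not at hr
  obtain ⟨m, hm, hum⟩ := hr
  have hm : Ideal.IsMaximal m := hm
  have htop : m ⊔ Submodule.span A {u} = ⊤ :=
    hm.1.2 _ (by rw [left_lt_sup, Submodule.span_singleton_le_iff_mem]; exact hum)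
  obtain ⟨n, hn, y, hy, hny⟩ := Submodule.mem_sup.1 (htop ▸ Submodule.mem_top : g ∈ _)
  obtain ⟨b, rfl⟩ := Submodule.mem_span_singleton.1 hy
  have hus : Submodule.span A {u} ≤ Submodule.span A {g} :=
    (Submodule.span_singleton_le_iff_mem _ _).2 (Submodule.mem_span_singleton.2 ⟨u, hu⟩)
  rcases (hg.isUniserial hA).le_or_le hus (inf_le_right : m ⊓ _ ≤ _) with h | h
  · exact absurd (h (Submodule.mem_span_singleton_self u)).1 hum
  · have hn' : n ∈ Submodule.span A {g} := by
      rw [eq_sub_of_add_eq hny]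
      exact Submodule.sub_mem _ (Submodule.mem_span_singleton_self g) (hus hy)
    obtain ⟨c, hc⟩ := Submodule.mem_span_singleton.1 (h ⟨hn, hn'⟩)
    exact ⟨c + b, by rw [add_mul, ← hny, ← hc]; rfl⟩

lemma smul_eq_zero_of_mem_jacobson {S : Type*} [AddCommGroup S] [Module A S] [IsSimpleModule A S]
    {a : A} (ha : a ∈ Ring.jacobson A) (x : S) : a • x = 0 := by
  have := IsSemisimpleModule.jacobson_le_annihilator A S ha
  exact Module.mem_annihilator.1 this x

lemma IsPrimitiveIdem.smul_eq_zero_iff (hA : IsLeftSerial A) {g : A} (hg : IsPrimitiveIdem g)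
    {S : Type*} [AddCommGroup S] [Module A S] [IsSimpleModule A S] {x : S} (hx : g • x ≠ 0)
    (z : A) : z • g • x = 0 ↔ z * g ∈ Ring.jacobson A := by
  constructor
  · intro h
    by_contra hz
    obtain ⟨v, hv⟩ := hg.exists_mul_eq hA (by rw [mul_assoc, hg.1]) hz
    refine hx ?_
    rw [← hv, mul_smul, mul_smul, h, smul_zero]
  · intro h
    rw [← mul_smul, smul_eq_zero_of_mem_jacobson h]

lemma span_singleton_eq_top_of_ne_zero {S : Type*} [AddCommGroup S] [Module A S]
    [IsSimpleModule A S] {x : S} (hx : x ≠ 0) : Submodule.span A {x} = ⊤ := by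
  rw [← LinearMap.range_toSpanSingleton, LinearMap.range_eq_top]
  exact IsSimpleModule.toSpanSingleton_surjective A hx

lemma IsPrimitiveIdem.nonempty_equiv (hA : IsLeftSerial A) {g : A} (hg : IsPrimitiveIdem g)
    {S T : Type u} [AddCommGroup S] [Module A S] [IsSimpleModule A S] [AddCommGroup T] [Module A T]
    [IsSimpleModule A T] {x : S} (hx : g • x ≠ 0) {y : T} (hy : g • y ≠ 0) :
    Nonempty (S ≃ₗ[A] T) := by
  obtain ⟨φ, hφ⟩ := exists_map_of_span_singleton (N := T) (y := g • y)
    (span_singleton_eq_top_of_ne_zero hx)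
    (fun a ha => by rwa [hg.smul_eq_zero_iff hA hy, ← hg.smul_eq_zero_iff hA hx])
  have : φ ≠ 0 := by
    rintro rfl
    exact hy hφ.symm
  exact ⟨LinearEquiv.ofBijective φ (LinearMap.bijective_of_ne_zero this)⟩

lemma exists_isPrimitiveIdem_smul_ne_zero {S : Type*} [AddCommGroup S] [Module A S]
    {s : AddSubmonoid A} {P : Set A} (hs : s = AddSubmonoid.closure P) (h1 : (1 : A) ∈ s)
    [Nontrivial S] : ∃ g ∈ P, ∃ x : S, g • x ≠ 0 := by
  by_contra! h
  obtain ⟨x, hx⟩ := exists_ne (0 : S)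
  have : ∀ a ∈ s, a • x = 0 := by
    intro a ha
    rw [hs] at ha
    induction ha using AddSubmonoid.closure_induction with
    | mem a ha => exact h a ha x
    | zero => exact zero_smul _ _
    | add a b _ _ ha hb => rw [add_smul, ha, hb, add_zero]
  exact hx (by simpa using this 1 h1)

/-- The submodules generated by single elements of `X` form a chain with a largest member. This
allows the generator to be chosen in a prescribed generating set, later the elements fixed by some
`e k`. -/
lemma exists_eq_span_singleton {B : Type u} [Ring B] [IsNoetherianRing B] {g : B}
    (hu : IsUniserial B (Submodule.span B {g})) {N : Ideal B} (hN : N ≤ Submodule.span B {g})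
    {X : Set B} (hX : X.Nonempty) (hXN : N = Submodule.span B X) :
    ∃ x ∈ X, N = Submodule.span B {x} := by
  obtain ⟨_, ⟨x, hx, rfl⟩, hmax⟩ := set_has_maximal_iff_noetherian.2
    (inferInstance : IsNoetherian B B) ((fun x => Submodule.span B {x}) '' X) (hX.image _)
  have hle : ∀ y ∈ X, Submodule.span B {y} ≤ Submodule.span B {g} := fun y hy =>
    (Submodule.span_mono (Set.singleton_subset_iff.2 hy)).trans (hXN ▸ hN)
  refine ⟨x, hx, le_antisymm ?_ ?_⟩
  · rw [hXN, Submodule.span_le]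
    intro y hy
    rcases hu.le_or_le (hle x hx) (hle y hy) with h | h
    · have := hmax _ ⟨y, hy, rfl⟩
      rw [SetLike.mem_coe, eq_of_le_of_not_lt h this]
      exact Submodule.mem_span_singleton_self y
    · exact h (Submodule.mem_span_singleton_self y)
  · rw [hXN]
    exact Submodule.span_mono (Set.singleton_subset_iff.2 hx)

end Primitive

end NakayamaGP

/-! ### Construction of the serial data of a Nakayama ring. -/

namespace NakayamaGP

section Existence

variable {A : Type u} [Ring A]

lemma exists_idempotents_of_classes [IsArtinianRing A] (hA : IsLeftSerial A) :
    ∃ e : SimpleClass A → A, (∀ i, IsPrimitiveIdem (e i)) ∧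
      ∀ (T : {S : ModuleCat.{u} A // IsSimpleModule A S}) (i : SimpleClass A),
        (∃ x : T.1, e i • x ≠ 0) ↔ SimpleClass.mk A T = i := by
  have h : ∀ i : SimpleClass A, ∃ g : A, IsPrimitiveIdem g ∧ ∃ x : (Quotient.out i).1, g • x ≠ 0 := by
    intro i
    have := (Quotient.out i).2
    have := IsSimpleModule.nontrivial A (Quotient.out i).1
    exact exists_isPrimitiveIdem_smul_ne_zero rfl one_mem_closure_isPrimitiveIdem
  choose e he y hy using h
  refine ⟨e, he, fun T i => ⟨?_, ?_⟩⟩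
  · rintro ⟨x, hx⟩
    rw [← Quotient.out_eq i]
    have := T.2
    have := (Quotient.out i).2
    exact Quotient.sound ((he i).nonempty_equiv hA hx (hy i))
  · rintro rfl
    obtain ⟨f⟩ : Nonempty ((Quotient.out (SimpleClass.mk A T)).1 ≃ₗ[A] T.1) :=
      Quotient.mk_out (s := simpleSetoid A) T
    refine ⟨f (y (SimpleClass.mk A T)), fun h => hy (SimpleClass.mk A T) ?_⟩
    rw [← map_smul] at h
    exact f.injective (h.trans (map_zero f).symm)

lemma finite_simpleClass [IsArtinianRing A] (hA : IsLeftSerial A) : Finite (SimpleClass A) := by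
  classical
  obtain ⟨l, hl, hl1⟩ := AddSubmonoid.exists_multiset_of_mem_closure
    (one_mem_closure_isPrimitiveIdem (A := A))
  have h : ∀ i : SimpleClass A, ∃ g ∈ l, ∃ x : (Quotient.out i).1, g • x ≠ 0 := by
    intro i
    have := (Quotient.out i).2
    have := IsSimpleModule.nontrivial A (Quotient.out i).1
    refine exists_isPrimitiveIdem_smul_ne_zero (P := {g | g ∈ l}) rfl ?_
    rw [← hl1]
    exact AddSubmonoid.multiset_sum_mem _ _ fun g hg => AddSubmonoid.subset_closure hg
  choose g hg y hy using h
  refine Finite.of_injective (β := {g // g ∈ l.toFinset})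
    (fun i => ⟨g i, Multiset.mem_toFinset.2 (hg i)⟩) fun i j hij => ?_
  have hij' : g i = g j := congrArg Subtype.val hij
  have := (Quotient.out i).2
  have := (Quotient.out j).2
  rw [← Quotient.out_eq i, ← Quotient.out_eq j]
  exact Quotient.sound ((hl _ (hg i)).nonempty_equiv hA (hy i) (hij' ▸ hy j))

lemma isNilpotent_of_mem_jacobson [IsArtinianRing A] {a : A} (ha : a ∈ Ring.jacobson A) :
    IsNilpotent a := by
  obtain ⟨n, hn⟩ := IsSemiprimaryRing.isNilpotent (R := A)
  refine ⟨n, ?_⟩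
  have := Ideal.pow_mem_pow ha n
  rwa [hn] at this

lemma IsPrimitiveIdem.notMem_jacobson [IsArtinianRing A] {g : A} (hg : IsPrimitiveIdem g) :
    g ∉ Ring.jacobson A := fun h =>
  hg.ne_zero (eq_zero_of_eq_mul_nilpotent hg.1.symm (isNilpotent_of_mem_jacobson h))

variable {e : SimpleClass A → A}

/-- Every primitive `g` factors through some `e i`: take a simple quotient of `A` in which `g` is
nonzero and let `i` be its class. Some `e i * b * g` is then outside the radical, hence a left
divisor argument recovers `g`. -/
lemma classes_full [IsArtinianRing A]
    (hcl : ∀ (T : {S : ModuleCat.{u} A // IsSimpleModule A S}) (i : SimpleClass A),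
      (∃ x : T.1, e i • x ≠ 0) ↔ SimpleClass.mk A T = i)
    (hA : IsLeftSerial A) :
    (1 : A) ∈ AddSubmonoid.closure {x | ∃ u i v, x = u * e i * v} := by
  refine AddSubmonoid.closure_mono ?_ (one_mem_closure_isPrimitiveIdem (A := A))
  intro g (hg : IsPrimitiveIdem g)
  have hgr := hg.notMem_jacobson
  rw [Ring.jacobson_eq_sInf_isMaximal, Submodule.mem_sInf] at hgr
  push Not at hgr
  obtain ⟨m, hm, hgm⟩ := hgr
  have hsimple : IsSimpleModule A (A ⧸ m) := isSimpleModule_iff_isCoatom.2 (Ideal.isMaximal_def.1 hm)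
  obtain ⟨x, hx⟩ := (hcl ⟨ModuleCat.of A (A ⧸ m), hsimple⟩ _).2 rfl
  generalize SimpleClass.mk A ⟨ModuleCat.of A (A ⧸ m), hsimple⟩ = i at hx
  have h0 : g • (Submodule.Quotient.mk 1 : A ⧸ m) ≠ 0 := by
    rw [← Submodule.Quotient.mk_smul, smul_eq_mul, mul_one, Ne, Submodule.Quotient.mk_eq_zero]
    exact hgm
  obtain ⟨b, hb⟩ := IsSimpleModule.toSpanSingleton_surjective A h0 x
  have hw : e i * b * g ∉ Ring.jacobson A := by
    intro h
    refine hx ?_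
    have h1 := smul_eq_zero_of_mem_jacobson h (Submodule.Quotient.mk 1 : A ⧸ m)
    rw [mul_smul, mul_smul] at h1
    rw [← hb]
    exact h1
  obtain ⟨v, hv⟩ := hg.exists_mul_eq hA (by rw [mul_assoc, hg.1]) hw
  exact ⟨v, i, b * g, by simpa only [mul_assoc] using hv.symm⟩

lemma classes_iso_eq
    (hcl : ∀ (T : {S : ModuleCat.{u} A // IsSimpleModule A S}) (i : SimpleClass A),
      (∃ x : T.1, e i • x ≠ 0) ↔ SimpleClass.mk A T = i)
    {i j : SimpleClass A} {u v : A} (h : v * e j * u = e i) : i = j := by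
  obtain ⟨T, rfl⟩ := Quotient.exists_rep i
  obtain ⟨x, hx⟩ := (hcl T _).2 rfl
  refine (hcl T j).1 ⟨u • x, fun h0 => hx ?_⟩
  change e (Quotient.mk _ T) • x = 0
  rw [← h, mul_smul, mul_smul, h0, smul_zero]

/-- The radical part of `A e i` is nonzero, since otherwise `A e i` would be a simple projective
module. -/
lemma exists_arrow [IsArtinianRing A] (he : ∀ i, IsPrimitiveIdem (e i))
    (hcl : ∀ (T : {S : ModuleCat.{u} A // IsSimpleModule A S}) (i : SimpleClass A),
      (∃ x : T.1, e i • x ≠ 0) ↔ SimpleClass.mk A T = i)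
    (hA : IsLeftSerial A) (hS : NoSimpleProjective A)
    (i : SimpleClass A) : ∃ k a, e k * a = a ∧ a * e i = a ∧ a ≠ 0 ∧
      Ring.jacobson A ⊓ Submodule.span A {e i} = Submodule.span A {a} := by
  set N := Ring.jacobson A ⊓ Submodule.span A {e i} with hN
  have hNe : ∀ y ∈ N, y * e i = y := by
    intro y hy
    obtain ⟨b, rfl⟩ := Submodule.mem_span_singleton.1 hy.2
    rw [smul_eq_mul, mul_assoc, (he i).1]
  have hN0 : N ≠ ⊥ := by
    intro h0
    refine hS (Submodule.span A {e i}) ?_ (SerialData.projective_span_idem (he i).1)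
    rw [isSimpleModule_iff_toSpanSingleton_surjective]
    refine ⟨(he i).2.1, fun x hx y => ?_⟩
    obtain ⟨b, hb⟩ := Submodule.mem_span_singleton.1 x.2
    have hxe : (x : A) * e i = x := by
      rw [← hb, smul_eq_mul, mul_assoc, (he i).1]
    have hxr : (x : A) ∉ Ring.jacobson A := by
      intro h
      have : (x : A) ∈ N := ⟨h, x.2⟩
      rw [h0] at this
      exact hx (Subtype.ext this)
    obtain ⟨v, hv⟩ := (he i).exists_mul_eq hA hxe hxr
    obtain ⟨c, hc⟩ := Submodule.mem_span_singleton.1 y.2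
    refine ⟨c * v, Subtype.ext ?_⟩
    change (c * v) * (x : A) = y
    rw [mul_assoc, hv, ← hc]; rfl
  obtain ⟨a, ⟨haN, k, hka⟩, ha⟩ := exists_eq_span_singleton ((he i).isUniserial hA)
    (N := N) inf_le_right (X := {y | y ∈ N ∧ ∃ k, e k * y = y})
    ⟨0, N.zero_mem, i, mul_zero _⟩ (by
      refine le_antisymm (fun y hy => ?_) (Submodule.span_le.2 fun y hy => hy.1)
      refine Submodule.span_mono ?_ (mem_span_smul_of_full (classes_full hcl hA) y)
      rintro _ ⟨k, v, rfl⟩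
      exact ⟨N.smul_mem _ (N.smul_mem _ hy), k, by
        rw [smul_eq_mul, ← mul_assoc, (he k).1]⟩)
  exact ⟨k, a, hka, hNe a haN, fun h => hN0 (by rw [ha, h, Submodule.span_singleton_eq_bot.2 rfl]),
    ha⟩

lemma exists_right_arrow [IsArtinianRing A] [IsArtinianRing Aᵐᵒᵖ] (he : ∀ i, IsPrimitiveIdem (e i))
    (hcl : ∀ (T : {S : ModuleCat.{u} A // IsSimpleModule A S}) (i : SimpleClass A),
      (∃ x : T.1, e i • x ≠ 0) ↔ SimpleClass.mk A T = i)
    (hA : IsNakayama A)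
    (k : SimpleClass A) : ∃ j a, e k * a = a ∧ a * e j = a ∧ a ∈ Ring.jacobson A ∧
      ∀ y ∈ Ring.jacobson A, e k * y = y → ∃ v, y = a * v := by
  let J : Ideal Aᵐᵒᵖ :=
    { carrier := {y | y.unop ∈ Ring.jacobson A}
      add_mem' := fun ha hb => (Ring.jacobson A).add_mem ha hb
      zero_mem' := (Ring.jacobson A).zero_mem
      smul_mem' := fun c x hx => (Ring.jacobson A).mul_mem_right _ hx }
  have hspan : ∀ y : A, op y ∈ Submodule.span Aᵐᵒᵖ {op (e k)} ↔ e k * y = y := by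
    intro y
    rw [Submodule.mem_span_singleton]
    constructor
    · rintro ⟨b, hb⟩
      have : e k * b.unop = y := congrArg unop hb
      rw [← this, ← mul_assoc, (he k).1]
    · intro h
      exact ⟨op y, by rw [smul_eq_mul, ← op_mul, h]⟩
  have hfull : (1 : Aᵐᵒᵖ) ∈ AddSubmonoid.closure {x | ∃ u i v, x = u * op (e i) * v} := by
    have h := AddSubmonoid.mem_map_of_mem
      (opAddEquiv : A ≃+ Aᵐᵒᵖ).toAddMonoidHom (classes_full hcl hA.1)
    rw [AddMonoidHom.map_mclosure] at h
    refine AddSubmonoid.closure_mono ?_ h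
    rintro _ ⟨_, ⟨u, i, v, rfl⟩, rfl⟩
    exact ⟨op v, i, op u, by simp [mul_assoc]⟩
  set N : Ideal Aᵐᵒᵖ := J ⊓ Submodule.span Aᵐᵒᵖ {op (e k)} with hN
  obtain ⟨a, ⟨haN, j, hja⟩, ha⟩ := exists_eq_span_singleton ((he k).op.isUniserial hA.2)
    (N := N) inf_le_right (X := {y | y ∈ N ∧ ∃ k, op (e k) * y = y})
    ⟨0, N.zero_mem, k, mul_zero _⟩ (by
      refine le_antisymm (fun y hy => ?_) (Submodule.span_le.2 fun y hy => hy.1)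
      refine Submodule.span_mono ?_ (mem_span_smul_of_full hfull y)
      rintro _ ⟨k, v, rfl⟩
      exact ⟨N.smul_mem _ (N.smul_mem _ hy), k, by
        rw [smul_eq_mul, ← mul_assoc, ← op_mul, (he k).1]⟩)
  refine ⟨j, a.unop, (hspan _).1 haN.2, congrArg unop hja, haN.1, fun y hy hky => ?_⟩
  have hyN : op y ∈ N := ⟨hy, (hspan y).2 hky⟩
  rw [ha] at hyN
  obtain ⟨b, hb⟩ := Submodule.mem_span_singleton.1 hyN
  exact ⟨b.unop, (congrArg unop hb).symm⟩

/-- Some `z = u * x * e j` is outside the radical and has a left inverse `s` in `e j A e k`. Since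
`s` is also left invertible, by `q` say, `z = q * e j` and therefore `z * s = e k`. -/
lemma exists_right_inverse [IsArtinianRing A] (he : ∀ i, IsPrimitiveIdem (e i))
    (hcl : ∀ (T : {S : ModuleCat.{u} A // IsSimpleModule A S}) (i : SimpleClass A),
      (∃ x : T.1, e i • x ≠ 0) ↔ SimpleClass.mk A T = i)
    (hA : IsLeftSerial A) {k : SimpleClass A} {u : A}
    (hu : e k * u = u) (hr : u ∉ Ring.jacobson A) : ∃ v, u * v = e k := by
  obtain ⟨x, j, hz⟩ : ∃ x j, u * x * e j ∉ Ring.jacobson A := by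
    by_contra! hcon
    have : ∀ a ∈ AddSubmonoid.closure {x | ∃ u i v, x = u * e i * v},
        u * a ∈ Ring.jacobson A := by
      intro a ha
      induction ha using AddSubmonoid.closure_induction with
      | mem a ha =>
        obtain ⟨x, j, y, rfl⟩ := ha
        have := (Ring.jacobson A).mul_mem_right y (hcon x j)
        simpa only [mul_assoc] using this
      | zero => simp
      | add a b _ _ ha hb => rw [mul_add]; exact add_mem ha hb
    exact hr (by simpa using this 1 (classes_full hcl hA))
  obtain ⟨z, hzdef⟩ : ∃ z, z = u * x * e j := ⟨_, rfl⟩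
  rw [← hzdef] at hz
  have hzj : z * e j = z := by rw [hzdef, mul_assoc, (he j).1]
  have hkz : e k * z = z := by rw [hzdef, ← mul_assoc, ← mul_assoc, hu]
  obtain ⟨v, hv⟩ := (he j).exists_mul_eq hA hzj hz
  obtain ⟨s, hs⟩ : ∃ s, s = e j * v * e k := ⟨_, rfl⟩
  have hsz : s * z = e j := by rw [hs, mul_assoc, hkz, mul_assoc, hv, (he j).1]
  have hsr : s ∉ Ring.jacobson A := fun h =>
    (he j).notMem_jacobson (hsz ▸ (Ring.jacobson A).mul_mem_right z h)
  obtain ⟨q, hq⟩ := (he k).exists_mul_eq hA (by rw [hs, mul_assoc, (he k).1]) hsr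
  have hqz : q * e j = z := by rw [← hsz, ← mul_assoc, hq, hkz]
  refine ⟨x * e j * s, ?_⟩
  have : e j * s = s := by rw [hs, ← mul_assoc, ← mul_assoc, (he j).1]
  rw [← mul_assoc, ← mul_assoc, ← hzdef, ← hqz, mul_assoc, this, hq]

/-- A Nakayama ring without simple projective modules is described by serial data indexed by the
isomorphism classes of simple modules. -/
theorem exists_serialData [IsArtinianRing A] [IsArtinianRing Aᵐᵒᵖ] (hA : IsNakayama A)
    (hS : NoSimpleProjective A) : ∃ D : SerialData A (SimpleClass A),
      ∀ (T : {S : ModuleCat.{u} A // IsSimpleModule A S}) (i : SimpleClass A),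
        (∃ x : T.1, D.e i • x ≠ 0) ↔ SimpleClass.mk A T = i := by
  obtain ⟨e, he, hcl⟩ := exists_idempotents_of_classes hA.1
  have hfin := finite_simpleClass hA.1
  choose σ arr hσ harr harr0 hJ using exists_arrow he hcl hA.1 hS
  choose ρ brr hρ hbrr hbJ hb using exists_right_arrow he hcl hA
  have harrJ : ∀ i, arr i ∈ Ring.jacobson A := fun i =>
    (show arr i ∈ Ring.jacobson A ⊓ Submodule.span A {e i} by
      rw [hJ]; exact Submodule.mem_span_singleton_self _).1
  have hmem : ∀ i u, u * e i = u → u ∈ Ring.jacobson A → ∃ v, u = v * arr i := by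
    intro i u hu hr
    have : u ∈ Ring.jacobson A ⊓ Submodule.span A {e i} :=
      ⟨hr, Submodule.mem_span_singleton.2 ⟨u, hu⟩⟩
    rw [hJ] at this
    obtain ⟨v, hv⟩ := Submodule.mem_span_singleton.1 this
    exact ⟨v, hv.symm⟩
  -- Write `arr i = brr (σ i) * t`. If `t` were in the radical, it would be a left multiple of `arr
  -- i` and `arr i` would vanish. So `t` is invertible between `e i` and `e (ρ (σ i))`, which
  -- identifies the vertices and makes the left and right arrows agree up to a unit.
  have key : ∀ i, i = ρ (σ i) ∧ ∃ s, brr (σ i) = arr i * s := by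
    intro i
    obtain ⟨v, hv⟩ := hb (σ i) (arr i) (harrJ i) (hσ i)
    set j := ρ (σ i) with hj
    set t := e j * v * e i with ht
    have hbt : brr (σ i) * t = arr i := by
      rw [ht, ← mul_assoc, ← mul_assoc, hbrr, ← hv, harr]
    have htr : t ∉ Ring.jacobson A := by
      intro h
      obtain ⟨b, hb'⟩ := hmem i t (by rw [ht, mul_assoc, (he i).1]) h
      refine harr0 i (eq_zero_of_eq_mul_mul (w := brr (σ i) * b) (g := 1) ?_
        (isNilpotent_of_mem_jacobson ((Ring.jacobson A).mul_mem_right _ (hbJ _))))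
      rw [mul_one, mul_assoc, ← hb', hbt]
    obtain ⟨q, hq⟩ := (he i).exists_mul_eq hA.1 (by rw [ht, mul_assoc, (he i).1]) htr
    have hij : i = j := classes_iso_eq hcl (v := q) (u := v * e i) (by
      simpa only [ht, mul_assoc] using hq)
    refine ⟨hij, ?_⟩
    obtain ⟨s, hs⟩ := exists_right_inverse he hcl hA.1 (k := j)
      (by rw [ht, ← mul_assoc, ← mul_assoc, (he j).1]) htr
    exact ⟨s, by rw [← hbt, mul_assoc, hs, hbrr]⟩
  have hinj : Function.Injective σ := fun i i' h => by
    rw [(key i).1, (key i').1, h]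
  obtain ⟨n, hn⟩ := IsSemiprimaryRing.isNilpotent (R := A)
  refine ⟨{ e := e
            σ := Equiv.ofBijective σ (Finite.injective_iff_bijective.1 hinj)
            arr := arr
            e_mul_e := fun i => (he i).1
            arr_ne_zero := harr0
            e_mul_arr := hσ
            arr_mul_e := harr
            left_gen := ?_
            right_gen := ?_
            nil := fun i t =>
              isNilpotent_of_mem_jacobson ((Ring.jacobson A).mul_mem_right t (harrJ i))
            iso_eq := fun i j u v => classes_iso_eq hcl
            full := classes_full hcl hA.1
            path_nil := ⟨n, fun i => ?_⟩ }, hcl⟩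
  · intro i u hu
    by_cases hr : u ∈ Ring.jacobson A
    · exact Or.inr (hmem i u hu hr)
    · exact Or.inl ((he i).exists_mul_eq hA.1 hu hr)
  · intro i u hu
    by_cases hr : u ∈ Ring.jacobson A
    · obtain ⟨v, rfl⟩ := hb (σ i) u hr hu
      obtain ⟨s, hs⟩ := (key i).2
      exact Or.inr ⟨s * v, by rw [hs, mul_assoc]⟩
    · exact Or.inl (exists_right_inverse he hcl hA.1 hu hr)
  · have : ∀ n i, arrowPath (Equiv.ofBijective σ (Finite.injective_iff_bijective.1 hinj)) e arr n i
        ∈ Ring.jacobson A ^ n := by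
      intro n
      induction n with
      | zero => intro i; rw [Submodule.pow_zero, Ideal.one_eq_top]; trivial
      | succ n ih =>
        intro i
        rw [Submodule.pow_succ]
        exact Ideal.mul_mem_mul (ih _) (harrJ i)
    have h1 := this n i
    rwa [hn] at h1

end Existence

end NakayamaGP

/-! ### Projective dimension, socle, projective cover and transpose in terms of vertices. -/

namespace NakayamaGP

namespace SerialData

variable {A : Type u} [Ring A] {ι : Type w} {D : SerialData A ι}

/-- The first syzygy is `(σ i, c i - 1)`, which is projective exactly when `c i - 1 = c (σ i)`; as
`c i ≤ c (σ i) + 1` always holds, the alternative is blackness. -/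
lemma two_le_projectiveDimension_iff {S : Type u} [AddCommGroup S] [Module A S] {i : ι}
    {x : S} (h : D.IsGenerator i 1 x) :
    2 ≤ projectiveDimension (ModuleCat.of A S) ↔ D.Black i := by
  have hS := shortExact_of_exact _ _ (Submodule.inclusion_injective (span_path_le (D := D) i 1))
    h.cover_surjective h.exact_cover
  have hP : Projective (ModuleCat.of A (Submodule.span A {D.e i})) := inferInstance
  have h1 : HasProjectiveDimensionLT (ModuleCat.of A S) 2 ↔
      Module.Projective A (Submodule.span A {D.path i 1}) := by
    rw [IsProjective.iff_projective]
    exact (hS.hasProjectiveDimensionLT_X₃_iff 0 hP).trans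
      projective_iff_hasProjectiveDimensionLT_one.symm
  have h2 := projectiveDimension_ge_iff (ModuleCat.of A S) 2
  rw [Nat.cast_ofNat] at h2
  rw [h2, h1]
  have h3 := isGenerator_path (D := D) (D.one_lt_c i).le
  have h4 := D.one_lt_c i
  have h5 := D.c_le i
  rw [pow_one] at h3
  constructor
  · intro hn
    by_contra hb
    have hb' : D.c (D.σ i) < D.c i := not_le.1 hb
    rw [show D.c i - 1 = D.c (D.σ i) by omega] at h3
    exact hn h3.projective
  · intro hb
    have hb' : D.c i ≤ D.c (D.σ i) := hb
    exact h3.not_projective (by omega) (by omega)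

lemma path_smul_mem_of_ne_bot {P : Type u} [AddCommGroup P] [Module A P] {i : ι} {p : P}
    (h : D.IsGenerator i (D.c i) p) {N : Submodule A P} (hN : N ≠ ⊥) :
    D.path i (D.c i - 1) • p ∈ N := by
  obtain ⟨x, hx, hx0⟩ := Submodule.exists_mem_ne_zero_of_ne_bot hN
  obtain ⟨z, rfl⟩ := Submodule.mem_span_singleton.1
    (h.span ▸ Submodule.mem_top : x ∈ Submodule.span A {p})
  have hz : z • p = (z * D.e i) • p := by rw [mul_smul, h.e_smul]
  have hz0 : z * D.e i ≠ 0 := fun h0 => hx0 (by rw [hz, h0, zero_smul])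
  obtain ⟨d, hd, u, v, h1, h2, -⟩ := D.left_form (x := z * D.e i) (i := i)
    (by rw [mul_assoc, D.e_mul_e]) hz0 (one_mul 1) (one_mul _)
  have h3 : D.path i d • p ∈ N := by
    rw [← D.e_mul_path, ← h2, mul_assoc, ← h1, mul_smul, ← hz]
    exact N.smul_mem _ hx
  rw [show D.c i - 1 = d + (D.c i - 1 - d) by omega, path_add, mul_smul]
  exact N.smul_mem _ h3

/-- The socle of an indecomposable projective module is simple, and its vertex is known. -/
lemma socle_of_isGenerator {P : Type u} [AddCommGroup P] [Module A P] {i : ι} {p : P}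
    (h : D.IsGenerator i (D.c i) p) : IsSimpleModule A (socle A P) ∧
      ∃ x : socle A P, D.e ((D.σ ^ (D.c i - 1)) i) • x = x ∧ x ≠ 0 := by
  have hc := D.c_pos i
  set x := D.path i (D.c i - 1) • p with hx
  have hx0 : x ≠ 0 := h.path_smul_ne_zero (by omega) le_rfl
  have hatom : IsSimpleModule A (Submodule.span A {x}) := by
    rw [isSimpleModule_iff_isAtom]
    refine ⟨by simpa using hx0, fun N hN => ?_⟩
    by_contra hN0
    exact hN.not_ge ((Submodule.span_singleton_le_iff_mem _ _).2 (path_smul_mem_of_ne_bot h hN0))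
  have hsoc : socle A P = Submodule.span A {x} := by
    refine le_antisymm (sSup_le fun N hN => ?_) (le_sSup hatom)
    have hN' : IsAtom N := isSimpleModule_iff_isAtom.1 hN
    have h1 := (Submodule.span_singleton_le_iff_mem _ _).2 (path_smul_mem_of_ne_bot h hN'.1)
    rcases hN'.le_iff.1 h1 with h2 | h2
    · exact absurd (by simpa using h2) hx0
    · exact h2.ge
  rw [hsoc]
  refine ⟨hatom, ⟨x, Submodule.mem_span_singleton_self x⟩, Subtype.ext ?_, fun h0 =>
    hx0 (congrArg Subtype.val h0)⟩
  change D.e _ • x = x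
  rw [hx, ← mul_smul, e_mul_path]

lemma exists_generator_of_isProjectiveCover {P M : Type u} [AddCommGroup P] [Module A P]
    [AddCommGroup M] [Module A M] {f : P →ₗ[A] M} (hf : IsProjectiveCover f) {i : ι} {m : M}
    (hm : Submodule.span A {m} = ⊤) (hme : D.e i • m = m) (hm0 : m ≠ 0) :
    ∃ p, f p = m ∧ D.IsGenerator i (D.c i) p := by
  obtain ⟨p, hp⟩ := hf.surjective m
  have hfp : f (D.e i • p) = m := by rw [map_smul, hp, hme]
  have := hf.projective
  refine ⟨D.e i • p, hfp, D.isGenerator_of_projective (hf.superfluous _ ?_)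
    (by rw [← mul_smul, D.e_mul_e]) (fun h0 => hm0 (by rw [← hfp, h0, map_zero]))⟩
  rw [eq_top_iff]
  intro y _
  obtain ⟨a, ha⟩ := Submodule.mem_span_singleton.1
    (hm ▸ Submodule.mem_top : f y ∈ Submodule.span A {m})
  refine Submodule.mem_sup.2 ⟨a • D.e i • p, Submodule.smul_mem _ _
    (Submodule.mem_span_singleton_self _), y - a • D.e i • p, ?_, by abel⟩
  rw [LinearMap.mem_ker, map_sub, map_smul, hfp, ha, sub_self]

/-- Nakayama's argument: if `p = n + z` with `f z = 0`, then `z` is a nilpotent multiple `(v * arr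
i) • p`, so `n` differs from `p` by a unit. -/
lemma IsGenerator.isProjectiveCover {P M : Type u} [AddCommGroup P] [Module A P]
    [AddCommGroup M] [Module A M] [Nontrivial M] {f : P →ₗ[A] M} (hf : Function.Surjective f)
    {i : ι} {p : P} (h : D.IsGenerator i (D.c i) p) : IsProjectiveCover f where
  projective := h.projective
  surjective := hf
  superfluous N hN := by
    have hfp : f p ≠ 0 := by
      intro h0
      obtain ⟨m, hm⟩ := exists_ne (0 : M)
      obtain ⟨y, rfl⟩ := hf m
      obtain ⟨a, rfl⟩ := Submodule.mem_span_singleton.1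
        (h.span ▸ Submodule.mem_top : y ∈ Submodule.span A {p})
      exact hm (by rw [map_smul, h0, smul_zero])
    obtain ⟨n, hn, z, hz, hnz⟩ := Submodule.mem_sup.1
      (hN ▸ Submodule.mem_top : p ∈ N ⊔ LinearMap.ker f)
    obtain ⟨a, ha⟩ := Submodule.mem_span_singleton.1
      (h.span ▸ Submodule.mem_top : z ∈ Submodule.span A {p})
    have hez : (a * D.e i) • p = z := by rw [mul_smul, h.e_smul, ha]
    have hpN : p ∈ N := by
      rcases D.left_gen i (a * D.e i) (by rw [mul_assoc, D.e_mul_e]) with ⟨v, hv⟩ | ⟨v, hv⟩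
      · exfalso
        rw [← h.e_smul, ← hv, mul_smul, hez, map_smul, LinearMap.mem_ker.1 hz, smul_zero] at hfp
        exact hfp rfl
      · have hnil : IsNilpotent (v * D.arr i) := isNilpotent_mul_swap (D.nil i v)
        obtain ⟨u, hu⟩ := (hnil.isUnit_one_sub).exists_left_inv
        have h1 : (1 - v * D.arr i) • p = n := by
          rw [sub_smul, one_smul, ← hv, hez, ← hnz, add_sub_cancel_right]
        rw [← one_smul A p, ← hu, mul_smul, h1]
        exact N.smul_mem _ hn
    rw [eq_top_iff, ← h.span, Submodule.span_singleton_le_iff_mem]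
    exact hpN

/-- The transpose of a simple module is a simple right module with known vertex. -/
lemma exists_transpose_generator {S P₀ P₁ : Type u} [AddCommGroup S] [Module A S]
    [AddCommGroup P₀] [Module A P₀] [AddCommGroup P₁] [Module A P₁] {g : P₀ →ₗ[A] S}
    {h : P₁ →ₗ[A] LinearMap.ker g} (hg : IsProjectiveCover g) (hh : IsProjectiveCover h)
    {k : ι} {x : S} (hx : D.IsGenerator k 1 x) :
    ∃ ξ : Transpose ((LinearMap.ker g).subtype ∘ₗ h), D.op.IsGenerator (D.σ k) 1 ξ := by
  have hx0 : x ≠ 0 := by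
    have := hx.path_smul_ne_zero Nat.zero_lt_one (D.one_lt_c k).le
    rwa [path_zero, hx.e_smul] at this
  obtain ⟨p, hgp, hp⟩ := exists_generator_of_isProjectiveCover hg hx.span hx.e_smul hx0
  have hap0 : D.arr k • p ≠ 0 := by
    have := hp.path_smul_ne_zero (D.one_lt_c k) le_rfl
    rwa [path_one] at this
  have hap : D.arr k • p ∈ LinearMap.ker g := by
    rw [LinearMap.mem_ker, map_smul, hgp, hx.smul_eq_zero_iff]
    exact ⟨1, by rw [path_one, one_mul, D.arr_mul_e]⟩
  set m : LinearMap.ker g := ⟨D.arr k • p, hap⟩ with hm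
  have hmspan : Submodule.span A {m} = ⊤ := by
    rw [eq_top_iff]
    rintro ⟨y, hy⟩ -
    obtain ⟨a, rfl⟩ := Submodule.mem_span_singleton.1
      (hp.span ▸ Submodule.mem_top : y ∈ Submodule.span A {p})
    rw [LinearMap.mem_ker, map_smul, hgp, hx.smul_eq_zero_iff] at hy
    obtain ⟨v, hv⟩ := hy
    refine Submodule.mem_span_singleton.2 ⟨v, Subtype.ext ?_⟩
    change v • D.arr k • p = a • p
    rw [← mul_smul, ← path_one, ← hv, mul_smul, hp.e_smul]
  obtain ⟨q, hq, hqgen⟩ := exists_generator_of_isProjectiveCover hh hmspan (i := D.σ k)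
    (Subtype.ext (by change D.e _ • D.arr k • p = _; rw [← mul_smul, D.e_mul_arr]))
    (fun h0 => hap0 (congrArg Subtype.val h0))
  have hFq : ((LinearMap.ker g).subtype ∘ₗ h) q = D.arr k • p := congrArg Subtype.val hq
  -- Dualising `A e (σ k) → A e k` gives left multiplication by `arr k` from `e k A` to `e (σ k) A`.
  -- The class of `φ₀`, which corresponds to `e (σ k)`, generates the cokernel.
  obtain ⟨φ₀, hφ₀⟩ := exists_map_of_span_singleton hqgen.span (y := D.e (D.σ k)) (fun a ha => by
    obtain ⟨v, hv⟩ := (hqgen.smul_eq_zero_iff a).1 ha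
    rw [smul_eq_mul, hv, D.path_eq_zero_iff.2 le_rfl, mul_zero])
  have hext : ∀ φ ψ : P₁ →ₗ[A] A, φ q = ψ q → φ = ψ := by
    intro φ ψ hφψ
    ext y
    obtain ⟨a, rfl⟩ := Submodule.mem_span_singleton.1
      (hqgen.span ▸ Submodule.mem_top : y ∈ Submodule.span A {q})
    rw [map_smul, map_smul, hφψ]
  refine ⟨Submodule.Quotient.mk φ₀, ?_, fun y => ?_⟩
  · rw [eq_top_iff]
    intro X _
    obtain ⟨φ, rfl⟩ := Submodule.Quotient.mk_surjective _ X
    refine Submodule.mem_span_singleton.2 ⟨MulOpposite.op (φ q), ?_⟩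
    rw [← Submodule.Quotient.mk_smul]
    congr 1
    apply hext
    change φ₀ q * φ q = φ q
    rw [hφ₀, ← smul_eq_mul, ← map_smul, hqgen.e_smul]
  · obtain ⟨y, rfl⟩ := op_surjective y
    rw [← Submodule.Quotient.mk_smul, Submodule.Quotient.mk_eq_zero]
    have hpath : D.op.path (D.σ k) 1 = MulOpposite.op (D.arr k) := by
      rw [op_path, pow_one, show D.σ⁻¹ (D.σ k) = k from D.σ.symm_apply_apply k, path_one]
    rw [hpath]
    constructor
    · rintro ⟨χ, hχ⟩
      refine ⟨MulOpposite.op (χ p), ?_⟩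
      have h1 : χ (((LinearMap.ker g).subtype ∘ₗ h) q) = φ₀ q * y := LinearMap.congr_fun hχ q
      rw [hFq, map_smul, hφ₀] at h1
      exact congrArg MulOpposite.op h1.symm
    · rintro ⟨v, hv⟩
      have hv' : D.e (D.σ k) * y = D.arr k * v.unop := congrArg unop hv
      obtain ⟨χ, hχ⟩ := exists_map_of_span_singleton hp.span (y := D.e k * v.unop) (fun a ha => by
        obtain ⟨w, hw⟩ := (hp.smul_eq_zero_iff a).1 ha
        rw [smul_eq_mul, ← mul_assoc, hw, D.path_eq_zero_iff.2 le_rfl, mul_zero, zero_mul])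
      refine ⟨χ, hext _ _ ?_⟩
      change χ (((LinearMap.ker g).subtype ∘ₗ h) q) = φ₀ q * y
      rw [hFq, map_smul, hφ₀, hχ, hv', smul_eq_mul, ← mul_assoc, D.arr_mul_e]

end SerialData

end NakayamaGP

/-! ### Injective envelopes over the base ring and duals of simple modules. -/

namespace NakayamaGP

section Envelope

variable {R : Type v} [CommRing R]

/-- Every module has an injective envelope. -/
lemma exists_injective_essential (M : Type v) [AddCommGroup M] [Module R M] :
    ∃ J : ModuleCat.{v} R, Module.Injective R J ∧ ∃ f : M →ₗ[R] J, Function.Injective f ∧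
      ∀ N : Submodule R J, N ⊓ LinearMap.range f = ⊥ → N = ⊥ := by
  obtain ⟨⟨I, hI, j, hj⟩⟩ := EnoughInjectives.presentation (ModuleCat.of R M)
  have hI' : Module.Injective R I := Module.injective_module_of_injective_object R I
  have hj' : Function.Injective j.hom := (ModuleCat.mono_iff_injective j).1 hj
  set B : Submodule R I := LinearMap.range j.hom with hB
  let 𝓔 : Set (Submodule R I) := {E | B ≤ E ∧ ∀ x ∈ E, Submodule.span R {x} ⊓ B = ⊥ → x = 0}
  have hBE : B ∈ 𝓔 := by
    refine ⟨le_rfl, fun x hx h => ?_⟩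
    have : x ∈ Submodule.span R {x} ⊓ B := ⟨Submodule.mem_span_singleton_self x, hx⟩
    rwa [h, Submodule.mem_bot] at this
  obtain ⟨E, -, hE⟩ := zorn_le_nonempty₀ 𝓔 (fun c hc hchain y hy => by
    refine ⟨sSup c, ⟨(hc hy).1.trans (le_sSup hy), fun x hx h => ?_⟩, fun z hz => le_sSup hz⟩
    obtain ⟨E, hEc, hxE⟩ := (Submodule.mem_sSup_of_directed ⟨y, hy⟩ hchain.directedOn).1 hx
    exact (hc hEc).2 x hxE h) B hBE
  -- `E` is a maximal essential extension of `B` inside `I`. For a maximal `C` disjoint from it, `E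
  -- → I / C` is essential, so the extension `g` of the inclusion of `E` is injective; its image is
  -- essential over `B`, hence is `E`. Thus `E` is a retract of `I`.
  let 𝓒 : Set (Submodule R I) := {C | C ⊓ E = ⊥}
  obtain ⟨C, -, hC⟩ := zorn_le_nonempty₀ 𝓒 (fun c hc hchain y hy => by
    refine ⟨sSup c, ?_, fun z hz => le_sSup hz⟩
    rw [Set.mem_ofPred_eq, eq_bot_iff]
    rintro x ⟨hx, hxE⟩
    obtain ⟨C, hCc, hxC⟩ := (Submodule.mem_sSup_of_directed ⟨y, hy⟩ hchain.directedOn).1 hx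
    have h1 : C ⊓ E = ⊥ := hc hCc
    exact h1.le ⟨hxC, hxE⟩) ⊥ (bot_inf_eq _)
  have hCE : C ⊓ E = ⊥ := hC.prop
  have hinj : Function.Injective (C.mkQ ∘ₗ E.subtype) := by
    rw [← LinearMap.ker_eq_bot, eq_bot_iff]
    intro x hx
    have hx' : (x : I) ∈ C := (Submodule.Quotient.mk_eq_zero C).1 hx
    exact Subtype.ext (hCE.le ⟨hx', x.2⟩ : (x : I) ∈ (⊥ : Submodule R I))
  obtain ⟨g, hg⟩ := hI'.out (C.mkQ ∘ₗ E.subtype) hinj E.subtype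
  have hess : ∀ N : Submodule R (I ⧸ C), (∀ x ∈ E, C.mkQ x ∈ N → x = 0) → N = ⊥ := by
    intro N hN
    have h1 : N.comap C.mkQ ≤ C := by
      refine hC.le_of_ge ?_ (fun x hx => ?_)
      · rw [Set.mem_ofPred_eq, eq_bot_iff]
        rintro x ⟨hx, hxE⟩
        exact hN x hxE hx
      · rw [Submodule.mem_comap, (C.mkQ_apply x), (Submodule.Quotient.mk_eq_zero C).2 hx]
        exact N.zero_mem
    rw [eq_bot_iff]
    intro y hy
    obtain ⟨y, rfl⟩ := Submodule.Quotient.mk_surjective _ y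
    exact (Submodule.Quotient.mk_eq_zero C).2 (h1 hy)
  have hgE : ∀ x ∈ E, g (C.mkQ x) = x := fun x hx => hg ⟨x, hx⟩
  have hker : LinearMap.ker g = ⊥ := hess _ fun x hx h => by rw [← hgE x hx]; exact h
  have hrange : LinearMap.range g ≤ E := by
    refine hE.le_of_ge ⟨fun b hb => ⟨C.mkQ b, hgE b (hE.prop.1 hb)⟩, ?_⟩
      (fun x hx => ⟨C.mkQ x, hgE x hx⟩)
    rintro _ ⟨y, rfl⟩ h
    have h1 : Submodule.span R {y} = ⊥ := by
      refine hess _ fun x hx h2 => hE.prop.2 x hx ?_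
      rw [eq_bot_iff, ← h]
      refine inf_le_inf_right _ ((Submodule.span_singleton_le_iff_mem _ _).2 ?_)
      obtain ⟨r, hr⟩ := Submodule.mem_span_singleton.1 h2
      exact Submodule.mem_span_singleton.2 ⟨r, by rw [← map_smul, hr, hgE x hx]⟩
    rw [Submodule.span_singleton_eq_bot.1 h1, map_zero]
  have hπ : ∀ x, (g ∘ₗ C.mkQ) x ∈ E := fun x => hrange ⟨_, rfl⟩
  refine ⟨ModuleCat.of R E, ⟨fun X Y _ _ _ _ f hf k => ?_⟩,
    LinearMap.codRestrict E j.hom (fun m => hE.prop.1 ⟨m, rfl⟩), fun a b hab =>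
      hj' (congrArg Subtype.val hab), fun N hN => ?_⟩
  · obtain ⟨h, hh⟩ := hI'.out f hf (E.subtype ∘ₗ k)
    refine ⟨LinearMap.codRestrict E (g ∘ₗ C.mkQ) hπ ∘ₗ h, fun x => Subtype.ext ?_⟩
    change g (C.mkQ (h (f x))) = k x
    rw [hh]
    exact hgE _ (k x).2
  · rw [eq_bot_iff]
    intro x hx
    refine Subtype.ext (hE.prop.2 x x.2 ?_)
    rw [eq_bot_iff]
    rintro y ⟨hy, m, hm⟩
    obtain ⟨r, hr⟩ := Submodule.mem_span_singleton.1 hy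
    have h1 : r • x ∈ N ⊓ LinearMap.range (LinearMap.codRestrict E j.hom
        (fun m => hE.prop.1 ⟨m, rfl⟩)) :=
      ⟨N.smul_mem r hx, m, Subtype.ext (hm.trans hr.symm)⟩
    rw [hN, Submodule.mem_bot] at h1
    rw [← hr]
    exact congrArg Subtype.val h1

lemma exists_isEnvelopeOfTop (R : Type v) [CommRing R] :
    ∃ J : ModuleCat.{v} R, IsEnvelopeOfTop R J :=
  exists_injective_essential (R ⧸ Ring.jacobson R)

/-- The part of an injective envelope of `R / rad R` killed by a maximal ideal is simple. -/
lemma IsEnvelopeOfTop.exists_generator [IsArtinianRing R] {J : Type v} [AddCommGroup J]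
    [Module R J] (hJ : IsEnvelopeOfTop R J) {m : Ideal R} (hm : m.IsMaximal) :
    ∃ j₀ : J, j₀ ≠ 0 ∧ (∀ z ∈ m, z • j₀ = 0) ∧
      ∀ j : J, (∀ z ∈ m, z • j = 0) → ∃ r : R, j = r • j₀ := by
  obtain ⟨-, f, hf, hess⟩ := hJ
  have hjac : ∀ y : R, y ∈ Ring.jacobson R ↔ ∀ n : Ideal R, n.IsMaximal → y ∈ n := fun y => by
    rw [Ring.jacobson_eq_sInf_isMaximal, Submodule.mem_sInf]; rfl
  have hfin := IsArtinianRing.setOfPred_isMaximal_finite R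
  -- The class of `y₀` spans the part of `R / rad R` killed by `m`. It exists because there are
  -- finitely many maximal ideals and a prime containing their intersection contains one of them.
  obtain ⟨y₀, hy₀, hy₀m⟩ : ∃ y₀ : R, (∀ n : Ideal R, n.IsMaximal → n ≠ m → y₀ ∈ n) ∧ y₀ ∉ m := by
    by_contra! hcon
    have h1 : (hfin.toFinset.erase m).inf id ≤ m := by
      intro y hy
      refine hcon y fun n hn hnm => ?_
      rw [Submodule.mem_finsetInf] at hy
      exact hy n (Finset.mem_erase.2 ⟨hnm, hfin.mem_toFinset.2 hn⟩)
    obtain ⟨n, hn, hnm⟩ := hm.isPrime.inf_le'.1 h1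
    obtain ⟨h2, h3⟩ := Finset.mem_erase.1 hn
    exact h2 ((hfin.mem_toFinset.1 h3 : n.IsMaximal).eq_of_le hm.ne_top hnm)
  refine ⟨f (Submodule.Quotient.mk y₀), ?_, fun z hz => ?_, fun j hj => ?_⟩
  · intro h0
    rw [← map_zero f] at h0
    exact hy₀m ((hjac y₀).1 ((Submodule.Quotient.mk_eq_zero _).1 (hf h0)) m hm)
  · rw [← map_smul, ← Submodule.Quotient.mk_smul, (Submodule.Quotient.mk_eq_zero _).2, map_zero]
    refine (hjac _).2 fun n hn => ?_
    by_cases hnm : n = m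
    · exact n.mul_mem_right _ (hnm ▸ hz)
    · exact n.mul_mem_left _ (hy₀ n hn hnm)
  · obtain ⟨y, rfl⟩ : ∃ y : R, f (Submodule.Quotient.mk y) = j := by
      by_cases hj0 : j = 0
      · exact ⟨0, by rw [hj0, Submodule.Quotient.mk_zero, map_zero]⟩
      have h1 : Submodule.span R {j} ⊓ LinearMap.range f ≠ ⊥ := fun h =>
        hj0 (Submodule.span_singleton_eq_bot.1 (hess _ h))
      obtain ⟨x, ⟨hx, y, hy⟩, hx0⟩ := Submodule.exists_mem_ne_zero_of_ne_bot h1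
      obtain ⟨r, rfl⟩ := Submodule.mem_span_singleton.1 hx
      obtain ⟨s, t, ht, hst⟩ := hm.exists_inv (fun hr => hx0 (hj r hr))
      obtain ⟨y, rfl⟩ := Submodule.Quotient.mk_surjective _ y
      refine ⟨s * y, ?_⟩
      rw [← smul_eq_mul, Submodule.Quotient.mk_smul, map_smul, hy]
      conv_rhs => rw [← one_smul R j, ← hst, add_smul, hj t ht, add_zero, mul_smul]
    obtain ⟨s, t, ht, hst⟩ := hm.exists_inv hy₀m
    refine ⟨y * s, ?_⟩
    rw [← map_smul, ← Submodule.Quotient.mk_smul]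
    congr 1
    have h1 := hj t ht
    rw [← map_smul, ← Submodule.Quotient.mk_smul, ← map_zero f] at h1
    have h2 := (Submodule.Quotient.mk_eq_zero _).1 (hf h1)
    rw [Submodule.Quotient.eq]
    rw [show y - (y * s) • y₀ = t • y by
      rw [smul_eq_mul, smul_eq_mul]; linear_combination (-y) * hst]
    exact h2

end Envelope

section Dual

variable (R : Type v) [CommRing R]

/-- The dual of a right `A`-module, as a left `A`-module. -/
def RDual (X : Type u) [AddCommGroup X] [Module R X] (J : Type v) [AddCommGroup J] [Module R J] :
    Type (max u v) := X →ₗ[R] J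

variable {R} {A : Type u} [Ring A] [Algebra R A] {X : Type u} [AddCommGroup X] [Module R X]
  {J : Type v} [AddCommGroup J] [Module R J]

instance : AddCommGroup (RDual R X J) := inferInstanceAs (AddCommGroup (X →ₗ[R] J))

variable [Module Aᵐᵒᵖ X] [IsScalarTower R Aᵐᵒᵖ X]

instance : Module A (RDual R X J) where
  smul a φ := LinearMap.comp (φ : X →ₗ[R] J) (Algebra.lsmul R R X (op a))
  one_smul φ := by
    let f : X →ₗ[R] J := φ
    refine LinearMap.ext fun x => ?_
    change f ((1 : Aᵐᵒᵖ) • x) = f x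
    rw [one_smul]
  mul_smul a b φ := by
    let f : X →ₗ[R] J := φ
    refine LinearMap.ext fun x => ?_
    change f ((op b * op a) • x) = f (op b • op a • x)
    rw [mul_smul]
  smul_zero a := LinearMap.ext fun _ => rfl
  smul_add a φ ψ := LinearMap.ext fun _ => rfl
  add_smul a b φ := by
    let f : X →ₗ[R] J := φ
    refine LinearMap.ext fun x => ?_
    change f ((op a + op b) • x) = f (op a • x) + f (op b • x)
    rw [add_smul, map_add]
  zero_smul φ := by
    let f : X →ₗ[R] J := φ
    refine LinearMap.ext fun x => ?_
    change f ((0 : Aᵐᵒᵖ) • x) = 0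
    rw [zero_smul, map_zero]

/-- The underlying linear map. -/
def RDual.hom : RDual R X J ≃+ (X →ₗ[R] J) := AddEquiv.refl _

lemma RDual.hom_smul_apply (a : A) (φ : RDual R X J) (x : X) :
    RDual.hom (a • φ) x = RDual.hom φ (op a • x) := rfl

lemma RDual.hom_algebraMap_smul (r : R) (φ : RDual R X J) :
    RDual.hom (algebraMap R A r • φ) = r • RDual.hom φ :=
  LinearMap.ext fun x => by
    rw [RDual.hom_smul_apply, ← MulOpposite.algebraMap_apply, algebraMap_smul, map_smul,
      LinearMap.smul_apply]

variable (A) in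
/-- The annihilator of a simple module over an artinian commutative ring is maximal. -/
lemma isMaximal_annihilator [IsArtinianRing R] [IsSimpleModule Aᵐᵒᵖ X] :
    (Module.annihilator R X).IsMaximal := by
  have := IsSimpleModule.nontrivial Aᵐᵒᵖ X
  have hp : (Module.annihilator R X).IsPrime := by
    refine ⟨fun h => ?_, fun {r s} hrs => or_iff_not_imp_right.2 fun hs => ?_⟩
    · obtain ⟨x, hx⟩ := exists_ne (0 : X)
      exact hx (by
        rw [← one_smul R x]
        exact Module.mem_annihilator.1 (h ▸ Submodule.mem_top : (1 : R) ∈ _) x)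
    · let f : X →ₗ[Aᵐᵒᵖ] X :=
        { toFun x := s • x
          map_add' := smul_add s
          map_smul' a x := smul_comm s a x }
      have hf : Function.Surjective f := by
        rcases f.surjective_or_eq_zero with h | h
        · exact h
        · exact absurd (Module.mem_annihilator.2 fun x => LinearMap.congr_fun h x) hs
      refine Module.mem_annihilator.2 fun x => ?_
      obtain ⟨y, rfl⟩ := hf x
      change r • s • y = 0
      rw [← mul_smul, Module.mem_annihilator.1 hrs y]
  exact IsArtinianRing.isMaximal_of_isPrime _

/-- Over an artinian module, finitely many maps from a given set have the same common kernel as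
all of them. -/
lemma exists_finset_common_ker [IsArtinian R X] (W : Set (X →ₗ[R] J)) :
    ∃ s : Finset (X →ₗ[R] J), ↑s ⊆ W ∧ ∀ x, (∀ φ ∈ s, φ x = 0) → ∀ φ ∈ W, φ x = 0 := by
  classical
  obtain ⟨K, ⟨⟨s, hs⟩, rfl⟩, hmin⟩ := IsArtinian.set_has_minimal
    (Set.range fun s : {s : Finset (X →ₗ[R] J) // ↑s ⊆ W} => s.1.inf LinearMap.ker)
    ⟨_, ⟨∅, by simp⟩, rfl⟩
  refine ⟨s, hs, fun x hx φ hφ => ?_⟩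
  have h1 := hmin _ ⟨⟨insert φ s, by
    rw [Finset.coe_insert]; exact Set.insert_subset hφ hs⟩, rfl⟩
  dsimp only at h1
  rw [Finset.inf_insert] at h1
  have h2 : LinearMap.ker φ ⊓ s.inf LinearMap.ker = s.inf LinearMap.ker :=
    eq_of_le_of_not_lt inf_le_right h1
  have h3 : x ∈ s.inf LinearMap.ker := by
    rw [Submodule.mem_finsetInf]
    exact hx
  rw [← h2] at h3
  exact h3.1

/-- The dual of a simple module is simple. -/
lemma isSimpleModule_rDual [IsArtinianRing R] [IsSimpleModule Aᵐᵒᵖ X] [Module.Finite R X]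
    (hJ : IsEnvelopeOfTop R J) : IsSimpleModule A (RDual R X J) := by
  classical
  have := IsSimpleModule.nontrivial Aᵐᵒᵖ X
  have hm := isMaximal_annihilator (R := R) (X := X) A
  obtain ⟨j₀, hj₀, hmj, hJm⟩ := hJ.exists_generator hm
  have hinj := hJ.1
  have hkill : ∀ (φ : X →ₗ[R] J) (x : X), ∀ z ∈ Module.annihilator R X, z • φ x = 0 :=
    fun φ x z hz => by rw [← map_smul, Module.mem_annihilator.1 hz, map_zero]
  -- Every `φ` takes values in `R j₀`, on which an endomorphism of `J` acts as a scalar.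
  have hend : ∀ (g : J →ₗ[R] J) (φ : X →ₗ[R] J), ∃ r : R, g ∘ₗ φ = r • φ := by
    intro g φ
    obtain ⟨r, hr⟩ := hJm (g j₀) fun z hz => by rw [← map_smul, hmj z hz, map_zero]
    refine ⟨r, LinearMap.ext fun x => ?_⟩
    obtain ⟨t, ht⟩ := hJm (φ x) (hkill φ x)
    rw [LinearMap.comp_apply, LinearMap.smul_apply, ht, map_smul, hr, smul_comm]
  have hnt : Nontrivial (RDual R X J) := by
    obtain ⟨x, hx⟩ := exists_ne (0 : X)
    obtain ⟨φ, hφ⟩ := exists_map_of_span_singleton (A := R)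
      (M := Submodule.span R {x}) (m := ⟨x, Submodule.mem_span_singleton_self x⟩)
      (SerialData.span_singleton_self_eq_top x) (y := j₀) (fun a ha => hmj a (by
        by_contra hr
        obtain ⟨s, t, ht, hst⟩ := hm.exists_inv hr
        have hax : a • x = 0 := congrArg Subtype.val ha
        apply hx
        rw [← one_smul R x, ← hst, add_smul, mul_smul, hax, Module.mem_annihilator.1 ht,
          smul_zero, add_zero]))
    obtain ⟨ψ, hψ⟩ := Module.Injective.extension_property R J _ _
      (Submodule.span R {x}).subtype (Submodule.subtype_injective _) φ
    refine ⟨⟨ψ, 0, fun h0 => hj₀ ?_⟩⟩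
    rw [← hφ, ← hψ]
    exact LinearMap.congr_fun h0 x
  rw [isSimpleModule_iff_toSpanSingleton_surjective]
  refine ⟨hnt, fun φ hφ ψ => ?_⟩
  set W : Set (X →ₗ[R] J) := Set.range fun a : A => RDual.hom (a • φ) with hW
  obtain ⟨s, hs, hker⟩ := exists_finset_common_ker W
  have hφ' : ∃ x, RDual.hom φ x ≠ 0 := by
    by_contra! h
    exact hφ (RDual.hom.map_eq_zero_iff.1 (LinearMap.ext h))
  have hker0 : ∀ x : X, (∀ χ ∈ s, χ x = 0) → x = 0 := by
    intro x hx
    by_contra hx0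
    obtain ⟨y, hy⟩ := hφ'
    obtain ⟨a, rfl⟩ := IsSimpleModule.toSpanSingleton_surjective Aᵐᵒᵖ hx0 y
    obtain ⟨a, rfl⟩ := op_surjective a
    exact hy (hker x hx (RDual.hom (a • φ)) ⟨a, rfl⟩)
  -- Finitely many translates of `φ` embed `X` in a power of `J`, and injectivity extends `ψ` to
  -- that power. The components of `G` act by scalars, so `ψ` is a combination of translates of `φ`.
  obtain ⟨G, hG⟩ := Module.Injective.extension_property R J _ _
    (LinearMap.pi fun χ : s => (χ : X →ₗ[R] J)) (by
      rw [← LinearMap.ker_eq_bot, LinearMap.ker_eq_bot']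
      exact fun x hx => hker0 x fun χ hχ => congrFun hx ⟨χ, hχ⟩) (RDual.hom ψ)
  have hs' : ∀ χ : s, ∃ a : A, RDual.hom (a • φ) =
      (G ∘ₗ LinearMap.single R (fun _ : s => J) χ) ∘ₗ (χ : X →ₗ[R] J) := by
    intro χ
    obtain ⟨r, hr⟩ := hend (G ∘ₗ LinearMap.single R (fun _ : s => J) χ) χ
    obtain ⟨a, ha⟩ := hs χ.2
    refine ⟨algebraMap R A r * a, ?_⟩
    rw [hr, mul_smul, RDual.hom_algebraMap_smul, ← ha]
  choose a ha using hs'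
  refine ⟨∑ χ, a χ, RDual.hom.injective ?_⟩
  rw [LinearMap.toSpanSingleton_apply, Finset.sum_smul, map_sum, ← hG]
  ext x
  rw [LinearMap.sum_apply, LinearMap.comp_apply,
    ← Finset.univ_sum_single (LinearMap.pi (fun χ : s => (χ : X →ₗ[R] J)) x), map_sum]
  exact Finset.sum_congr rfl fun χ _ => LinearMap.congr_fun (ha χ) x

end Dual

end NakayamaGP

/-! ### Lengths of projectives, the Auslander–Reiten translate, and cycles of the resolution quiver.
-/

namespace NakayamaGP

namespace SerialData

variable {A : Type u} [Ring A] {ι : Type w} {D : SerialData A ι}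

variable (D) in
lemma isGenerator_e (i : ι) : D.IsGenerator i (D.c i)
    (⟨D.e i, Submodule.mem_span_singleton_self _⟩ : Submodule.span A {D.e i}) :=
  isGenerator_path (Nat.zero_le (D.c i))

lemma IsGenerator.ne_zero {M : Type u} [AddCommGroup M] [Module A M] {i : ι} {n : ℕ} {m : M}
    (h : D.IsGenerator i n m) (h0 : 0 < n) (hn : n ≤ D.c i) : m ≠ 0 := by
  rintro rfl
  exact h.path_smul_ne_zero h0 hn (smul_zero _)

lemma IsGenerator.isIndecomposable {P : Type u} [AddCommGroup P] [Module A P] {i : ι} {p : P}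
    (h : D.IsGenerator i (D.c i) p) : IsIndecomposable A P := by
  have hc := D.c_pos i
  refine ⟨⟨⟨p, 0, h.ne_zero hc le_rfl⟩⟩, fun N N' hN => ?_⟩
  by_contra! hcon
  have h1 := hN.disjoint.le_bot
    ⟨path_smul_mem_of_ne_bot h hcon.1, path_smul_mem_of_ne_bot h hcon.2⟩
  exact h.path_smul_ne_zero (by omega) le_rfl h1

/-- A submodule is determined by the least `k` with `path i k • p` in it, which bounds the length of
chains. Only this inequality is needed to compare `c i` with `p`. -/
lemma IsGenerator.length_le {P : Type u} [AddCommGroup P] [Module A P] {i : ι} {p : P}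
    (h : D.IsGenerator i (D.c i) p) : Module.length A P ≤ D.c i := by
  let d : Submodule A P → ℕ := fun N => sInf {k | D.path i k • p ∈ N}
  have hne : ∀ N : Submodule A P, D.c i ∈ {k | D.path i k • p ∈ N} := fun N => by
    change D.path i (D.c i) • p ∈ N
    rw [D.path_eq_zero_iff.2 le_rfl, zero_smul]
    exact N.zero_mem
  have hd : ∀ N, D.path i (d N) • p ∈ N := fun N => Nat.sInf_mem ⟨_, hne N⟩
  have hdc : ∀ N, d N ≤ D.c i := fun N => Nat.sInf_le (hne N)
  have hanti : ∀ N N', N ≤ N' → d N' ≤ d N := fun N N' hN => Nat.sInf_le (hN (hd N))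
  have hle : ∀ N N', d N' ≤ d N → N ≤ N' := by
    intro N N' hN x hx
    by_cases hx0 : x = 0
    · rw [hx0]; exact N'.zero_mem
    obtain ⟨z, rfl⟩ := Submodule.mem_span_singleton.1
      (h.span ▸ Submodule.mem_top : x ∈ Submodule.span A {p})
    have hz : z • p = (z * D.e i) • p := by rw [mul_smul, h.e_smul]
    have hz0 : z * D.e i ≠ 0 := fun h0 => hx0 (by rw [hz, h0, zero_smul])
    obtain ⟨k, hk, u, v, h1, h2, -⟩ := D.left_form (x := z * D.e i) (i := i)
      (by rw [mul_assoc, D.e_mul_e]) hz0 (one_mul 1) (one_mul _)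
    have h3 : D.path i k • p ∈ N := by
      rw [← D.e_mul_path, ← h2, mul_assoc, ← h1, mul_smul, ← hz]
      exact N.smul_mem _ hx
    have h4 : d N' ≤ k := hN.trans (Nat.sInf_le h3)
    rw [hz, h1, show k = d N' + (k - d N') by omega, path_add, ← mul_assoc, mul_smul]
    exact N'.smul_mem _ (hd N')
  have hmono : StrictMono fun N => D.c i - d N := by
    intro N N' hN
    have h1 := hdc N
    have h2 : d N' < d N := by
      by_contra h2
      exact hN.not_ge (hle _ _ (not_lt.1 h2))
    change D.c i - d N < D.c i - d N'
    omega
  rw [Module.length_eq_height]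
  refine Order.height_le fun s _ => ?_
  have h1 := (s.map _ hmono).head_add_length_le_nat
  have h2 : (s.map _ hmono).last ≤ D.c i := Nat.sub_le _ _
  have h3 : (s.map _ hmono).length = s.length := rfl
  exact_mod_cast (by omega : s.length ≤ D.c i)

lemma minProjLength_le (D : SerialData A ι) (i : ι) : minProjLength A ≤ D.c i := by
  refine le_trans (sInf_le ?_) (D.isGenerator_e i).length_le
  exact ⟨ModuleCat.of A (Submodule.span A {D.e i}), inferInstance, (D.isGenerator_e i).projective,
    (D.isGenerator_e i).isIndecomposable, rfl⟩

lemma IsGenerator.isSimpleModule {S : Type u} [AddCommGroup S] [Module A S] {i : ι} {x : S}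
    (h : D.IsGenerator i 1 x) : IsSimpleModule A S := by
  rw [isSimpleModule_iff_toSpanSingleton_surjective]
  refine ⟨⟨⟨x, 0, h.ne_zero Nat.zero_lt_one (D.one_lt_c i).le⟩⟩, fun y hy => ?_⟩
  rw [← LinearMap.range_eq_top, LinearMap.range_toSpanSingleton, eq_top_iff, ← h.span,
    Submodule.span_singleton_le_iff_mem]
  obtain ⟨a, rfl⟩ := Submodule.mem_span_singleton.1
    (h.span ▸ Submodule.mem_top : y ∈ Submodule.span A {x})
  rcases D.left_gen i (a * D.e i) (by rw [mul_assoc, D.e_mul_e]) with ⟨v, hv⟩ | ⟨v, hv⟩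
  · refine Submodule.mem_span_singleton.2 ⟨v, ?_⟩
    conv_rhs => rw [← h.e_smul, ← hv, mul_smul, mul_smul, h.e_smul]
  · exact absurd ((h.smul_eq_zero_iff a).2 ⟨v, by rw [hv, path_one]⟩) hy

variable (D) in
lemma nonempty_linearEquiv {M N : Type*} [AddCommGroup M] [Module A M] [AddCommGroup N]
    [Module A N] [IsSimpleModule A M] [IsSimpleModule A N] {i : ι} {m : M} {n : N}
    (hm : D.e i • m ≠ 0) (hn : D.e i • n ≠ 0) : Nonempty (M ≃ₗ[A] N) := by
  have hm1 := D.isGenerator_of_isSimpleModule (by rw [← mul_smul, D.e_mul_e]) hm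
  have hn1 := D.isGenerator_of_isSimpleModule (by rw [← mul_smul, D.e_mul_e]) hn
  obtain ⟨φ, hφ⟩ := exists_map_of_span_singleton hm1.span (y := D.e i • n)
    fun a ha => (hn1.smul_eq_zero_iff a).2 ((hm1.smul_eq_zero_iff a).1 ha)
  exact ⟨LinearEquiv.ofBijective φ (LinearMap.bijective_of_ne_zero fun h0 => hn (by
    rw [← hφ, h0, LinearMap.zero_apply]))⟩

section Translate

variable {R : Type v} [CommRing R] [Algebra R A]

lemma exists_e_smul_ne_zero_of_isARTranslate {S T : Type u} [AddCommGroup S] [Module A S]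
    [AddCommGroup T] [Module A T] [Nontrivial T] (hT : IsARTranslate R (A := A) S T) {k : ι}
    {x : S} (hx : D.IsGenerator k 1 x) : ∃ t : T, D.e (D.σ k) • t ≠ 0 := by
  obtain ⟨P₀, P₁, g, h, J, hg, hh, -, e, he⟩ := hT
  obtain ⟨ξ, hξ⟩ := exists_transpose_generator hg hh hx
  obtain ⟨t, ht⟩ := exists_ne (0 : T)
  obtain ⟨X, hX⟩ : ∃ X, e t X ≠ 0 := by
    by_contra! hcon
    exact ht (e.map_eq_zero_iff.1 (LinearMap.ext hcon))
  obtain ⟨y, rfl⟩ := Submodule.mem_span_singleton.1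
    (hξ.span ▸ Submodule.mem_top : X ∈ Submodule.span Aᵐᵒᵖ {ξ})
  obtain ⟨y, rfl⟩ := op_surjective y
  have hξe : MulOpposite.op (D.e (D.σ k)) • ξ = ξ := hξ.e_smul
  refine ⟨y • t, fun h0 => hX ?_⟩
  rw [← he, ← hξe, ← he, h0, map_zero, LinearMap.zero_apply]

/-- From the presentation `A e (σ k) → A e k → S`, the dual of the transpose is a simple module on
which `e (σ k)` is nonzero. This property fixes its isomorphism class, so it is `T`. -/
lemma isARTranslate_of_e_smul_ne_zero [IsArtinianRing R] [Module.Finite R A] {S T : Type u}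
    [AddCommGroup S] [Module A S] [AddCommGroup T] [Module A T] [IsSimpleModule A T] {k : ι}
    {x : S} (hx : D.IsGenerator k 1 x) {t : T} (ht : D.e (D.σ k) • t ≠ 0) :
    IsARTranslate R (A := A) S T := by
  have hS := hx.isSimpleModule
  have hnt := IsSimpleModule.nontrivial A S
  obtain ⟨g, hg⟩ := exists_map_of_span_singleton (D.isGenerator_e k).span (y := x) fun a ha => by
    obtain ⟨v, hv⟩ := ((D.isGenerator_e k).smul_eq_zero_iff a).1 ha
    exact (hx.smul_eq_zero_iff a).2 ⟨0, by
      rw [hv, D.path_eq_zero_iff.2 le_rfl, mul_zero, zero_mul]⟩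
  have hgs : Function.Surjective g := by
    rw [← LinearMap.range_eq_top, eq_top_iff, ← hx.span, Submodule.span_singleton_le_iff_mem]
    exact ⟨_, hg⟩
  have harr : ∀ v : A, v * D.arr k ∈ Submodule.span A {D.e k} := fun v =>
    Submodule.mem_span_singleton.2 ⟨v * D.arr k, by rw [smul_eq_mul, mul_assoc, D.arr_mul_e]⟩
  have hga : ∀ a ha, g ⟨a, ha⟩ = a • x := by
    intro a ha
    obtain ⟨b, rfl⟩ := Submodule.mem_span_singleton.1 ha
    have h1 : g (b • ⟨D.e k, Submodule.mem_span_singleton_self _⟩) = (b * D.e k) • x := by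
      rw [map_smul, hg, mul_smul, hx.e_smul]
    exact h1
  have harr0 : D.arr k • x = 0 :=
    (hx.smul_eq_zero_iff _).2 ⟨1, by rw [path_one, one_mul, D.arr_mul_e]⟩
  set m : LinearMap.ker g := ⟨⟨D.arr k, by simpa using harr 1⟩, by
    rw [LinearMap.mem_ker, hga, harr0]⟩ with hm
  have hm0 : m ≠ 0 := fun h0 =>
    D.arr_ne_zero k (congrArg (fun y : LinearMap.ker g => (y : Submodule.span A {D.e k}).1) h0)
  have hntk : Nontrivial (LinearMap.ker g) := ⟨⟨m, 0, hm0⟩⟩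
  obtain ⟨h, hh⟩ := exists_map_of_span_singleton (D.isGenerator_e (D.σ k)).span (y := m)
    fun a ha => by
      have h1 : a * D.e (D.σ k) = 0 := congrArg Subtype.val ha
      refine Subtype.ext (Subtype.ext ?_)
      change a * D.arr k = 0
      rw [← D.e_mul_arr, ← mul_assoc, h1, zero_mul]
  have hhs : Function.Surjective h := by
    rintro ⟨⟨a, ha⟩, hker⟩
    rw [LinearMap.mem_ker, hga, hx.smul_eq_zero_iff] at hker
    obtain ⟨v, hv⟩ := hker
    refine ⟨v • ⟨D.e (D.σ k), Submodule.mem_span_singleton_self _⟩, ?_⟩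
    rw [map_smul, hh]
    refine Subtype.ext (Subtype.ext ?_)
    obtain ⟨b, rfl⟩ := Submodule.mem_span_singleton.1 ha
    change v * D.arr k = b * D.e k
    rw [← path_one, ← hv, smul_eq_mul, mul_assoc, D.e_mul_e]
  have hgc := (D.isGenerator_e k).isProjectiveCover hgs
  have hhc := (D.isGenerator_e (D.σ k)).isProjectiveCover hhs
  obtain ⟨ξ, hξ⟩ := exists_transpose_generator hgc hhc hx
  obtain ⟨J, hJ⟩ := exists_isEnvelopeOfTop R
  have hX := hξ.isSimpleModule
  have hfin : Module.Finite R Aᵐᵒᵖ := Module.Finite.equiv (MulOpposite.opLinearEquiv R)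
  have hfinX : Module.Finite Aᵐᵒᵖ (Transpose ((LinearMap.ker g).subtype ∘ₗ h)) :=
    ⟨⟨{ξ}, by rw [Finset.coe_singleton, hξ.span]⟩⟩
  have hfinX' : Module.Finite R (Transpose ((LinearMap.ker g).subtype ∘ₗ h)) :=
    Module.Finite.trans Aᵐᵒᵖ _
  have hdual : IsSimpleModule A (RDual R (Transpose ((LinearMap.ker g).subtype ∘ₗ h)) J) :=
    isSimpleModule_rDual hJ
  have hntd := IsSimpleModule.nontrivial A
    (RDual R (Transpose ((LinearMap.ker g).subtype ∘ₗ h)) J)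
  obtain ⟨φ, hφ⟩ := exists_ne (0 : RDual R (Transpose ((LinearMap.ker g).subtype ∘ₗ h)) J)
  obtain ⟨X, hX⟩ : ∃ X, RDual.hom φ X ≠ 0 := by
    by_contra! hcon
    exact hφ (RDual.hom.map_eq_zero_iff.1 (LinearMap.ext hcon))
  obtain ⟨y, rfl⟩ := Submodule.mem_span_singleton.1
    (hξ.span ▸ Submodule.mem_top : X ∈ Submodule.span Aᵐᵒᵖ {ξ})
  obtain ⟨y, rfl⟩ := op_surjective y
  have hξe : MulOpposite.op (D.e (D.σ k)) • ξ = ξ := hξ.e_smul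
  obtain ⟨e⟩ := D.nonempty_linearEquiv ht (n := y • φ) fun h0 => hX (by
    rw [← RDual.hom_smul_apply, ← hξe, ← RDual.hom_smul_apply, h0, map_zero,
      LinearMap.zero_apply])
  refine ⟨ModuleCat.of A _, ModuleCat.of A _, g, h, J, hgc, hhc, hJ,
    e.toAddEquiv.trans RDual.hom, fun a n x => ?_⟩
  exact congrArg (fun ψ => RDual.hom ψ x) (map_smul e a n)

end Translate

end SerialData

section Cycles

variable {α : Type*} {f : α → α}

/-- The vertices of the cycle are the iterates of `f` on the first one, and one full turn returns to
it. -/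
lemma mem_periodicPts_of_chain {c : Cycle α} (hc : c.Chain fun a b => b = f a) {a : α}
    (ha : a ∈ c) : a ∈ Function.periodicPts f ∧ f a ∈ c := by
  induction c with
  | nil => exact absurd ha (Cycle.notMem_nil a)
  | cons b l _ =>
    rw [Cycle.chain_coe_cons, List.isChain_iff_getElem] at hc
    have h1 : ∀ k (hk : k < (b :: (l ++ [b])).length), (b :: (l ++ [b]))[k] = f^[k] b := by
      intro k
      induction k with
      | zero => intro hk; rfl
      | succ k ih =>
        intro hk
        rw [hc k hk, ih, Function.iterate_succ_apply']
    have h2 : f^[l.length + 1] b = b := by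
      rw [← h1 _ (by simp)]
      simp
    have h3 : b ∈ Function.periodicPts f :=
      Function.mk_mem_periodicPts (Nat.succ_pos _) h2
    rw [Cycle.mem_coe_iff] at ha ⊢
    obtain ⟨k, hk, rfl⟩ := List.mem_iff_getElem.1 ha
    have h4 : (b :: l)[k] = f^[k] b := by
      rw [← h1 k (by simp at hk ⊢; omega)]
      exact (List.getElem_append_left (as := b :: l) (bs := [b]) hk).symm
    have hk' : k + 1 < (b :: (l ++ [b])).length := by simp at hk ⊢; omega
    have h5 := h1 (k + 1) hk'
    rw [h4]
    refine ⟨iterate_mem_periodicPts h3 k, ?_⟩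
    rw [← Function.iterate_succ_apply' f, ← h5]
    have h6 : (b :: (l ++ [b]))[k + 1] ∈ b :: (l ++ [b]) := List.getElem_mem hk'
    generalize (b :: (l ++ [b]))[k + 1] = z at h6
    simp only [List.mem_cons, List.mem_append, List.not_mem_nil, or_false] at h6 ⊢
    tauto

end Cycles

section Quiver

variable {A : Type u} [Ring A]

lemma isGenerator_of_vertex {D : SerialData A (SimpleClass A)}
    (hD : ∀ (T : {S : ModuleCat.{u} A // IsSimpleModule A S}) (i : SimpleClass A),
      (∃ x : T.1, D.e i • x ≠ 0) ↔ SimpleClass.mk A T = i)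
    (S : {S : ModuleCat.{u} A // IsSimpleModule A S}) :
    ∃ x : S.1, D.IsGenerator (SimpleClass.mk A S) 1 x := by
  obtain ⟨x, hx⟩ := (hD S _).2 rfl
  have := S.2
  exact ⟨_, D.isGenerator_of_isSimpleModule (by rw [← mul_smul, D.e_mul_e]) hx⟩

lemma isBlack_iff {D : SerialData A (SimpleClass A)}
    (hD : ∀ (T : {S : ModuleCat.{u} A // IsSimpleModule A S}) (i : SimpleClass A),
      (∃ x : T.1, D.e i • x ≠ 0) ↔ SimpleClass.mk A T = i) (a : SimpleClass A) :
    IsBlack a ↔ D.Black a := by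
  constructor
  · rintro ⟨S, rfl, hS⟩
    obtain ⟨x, hx⟩ := isGenerator_of_vertex hD S
    exact (SerialData.two_le_projectiveDimension_iff hx).1 hS
  · intro ha
    obtain ⟨S, rfl⟩ := Quotient.exists_rep a
    obtain ⟨x, hx⟩ := isGenerator_of_vertex hD S
    exact ⟨S, rfl, (SerialData.two_le_projectiveDimension_iff hx).2 ha⟩

/-- Every vertex of the resolution quiver is the source of a unique arrow. -/
lemma resolutionArrow_iff {R : Type v} [CommRing R] [IsArtinianRing R] [Algebra R A]
    [Module.Finite R A] {D : SerialData A (SimpleClass A)}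
    (hD : ∀ (T : {S : ModuleCat.{u} A // IsSimpleModule A S}) (i : SimpleClass A),
      (∃ x : T.1, D.e i • x ≠ 0) ↔ SimpleClass.mk A T = i) (a b : SimpleClass A) :
    ResolutionArrow R a b ↔ b = D.next a := by
  have hnext : ∀ i, D.next i = D.σ ((D.σ ^ (D.c i - 1)) i) := fun i => by
    have := D.c_pos i
    rw [SerialData.next, ← Equiv.Perm.mul_apply, ← pow_succ', Nat.sub_add_cancel this]
  constructor
  · rintro ⟨S, T, rfl, rfl, P, f, hf, hT⟩
    obtain ⟨x, hx⟩ := isGenerator_of_vertex hD S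
    obtain ⟨p, -, hp⟩ := SerialData.exists_generator_of_isProjectiveCover hf hx.span hx.e_smul
      (hx.ne_zero Nat.zero_lt_one (D.one_lt_c _).le)
    obtain ⟨hs, y, hy, hy0⟩ := SerialData.socle_of_isGenerator hp
    have := T.2
    have := IsSimpleModule.nontrivial A T.1
    rw [hnext]
    exact (hD T _).1 (SerialData.exists_e_smul_ne_zero_of_isARTranslate hT
      (D.isGenerator_of_isSimpleModule hy hy0))
  · rintro rfl
    obtain ⟨S, hS⟩ := Quotient.exists_rep a
    obtain ⟨T, hT⟩ := Quotient.exists_rep (D.next a)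
    have hS' : SimpleClass.mk A S = a := hS
    subst hS'
    obtain ⟨x, hx⟩ := isGenerator_of_vertex hD S
    obtain ⟨g, hg⟩ := exists_map_of_span_singleton (D.isGenerator_e _).span (y := x)
      fun a ha => by
        obtain ⟨v, hv⟩ := ((D.isGenerator_e (SimpleClass.mk A S)).smul_eq_zero_iff a).1 ha
        exact (hx.smul_eq_zero_iff a).2 ⟨0, by
          rw [hv, D.path_eq_zero_iff.2 le_rfl, mul_zero, zero_mul]⟩
    have hgs : Function.Surjective g := by
      rw [← LinearMap.range_eq_top, eq_top_iff, ← hx.span, Submodule.span_singleton_le_iff_mem]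
      exact ⟨_, hg⟩
    have := S.2
    have := T.2
    have := IsSimpleModule.nontrivial A S.1
    obtain ⟨hs, y, hy, hy0⟩ := SerialData.socle_of_isGenerator
      (D.isGenerator_e (SimpleClass.mk A S))
    obtain ⟨t, ht⟩ := (hD T _).2 hT
    rw [hnext] at ht
    exact ⟨S, T, rfl, hT, ModuleCat.of A _, g, (D.isGenerator_e _).isProjectiveCover hgs,
      SerialData.isARTranslate_of_e_smul_ne_zero (D.isGenerator_of_isSimpleModule hy hy0) ht⟩

lemma isResolutionCycle_periodicOrbit {R : Type v} [CommRing R] [IsArtinianRing R] [Algebra R A]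
    [Module.Finite R A] {D : SerialData A (SimpleClass A)}
    (hD : ∀ (T : {S : ModuleCat.{u} A // IsSimpleModule A S}) (i : SimpleClass A),
      (∃ x : T.1, D.e i • x ≠ 0) ↔ SimpleClass.mk A T = i) {i : SimpleClass A}
    (hi : i ∈ Function.periodicPts D.next) :
    IsResolutionCycle R (Function.periodicOrbit D.next i) := by
  refine ⟨fun h => Function.periodicOrbit_eq_nil_iff_not_periodic_pt.1 h hi,
    Function.nodup_periodicOrbit, ?_⟩
  rw [Function.periodicOrbit_chain' _ hi]
  intro n
  rw [resolutionArrow_iff hD, Function.iterate_succ_apply']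

lemma IsResolutionCycle.mem_periodicPts {R : Type v} [CommRing R] [IsArtinianRing R] [Algebra R A]
    [Module.Finite R A] {D : SerialData A (SimpleClass A)}
    (hD : ∀ (T : {S : ModuleCat.{u} A // IsSimpleModule A S}) (i : SimpleClass A),
      (∃ x : T.1, D.e i • x ≠ 0) ↔ SimpleClass.mk A T = i) {c : Cycle (SimpleClass A)}
    (hc : IsResolutionCycle R c) {i : SimpleClass A} (hi : i ∈ c) :
    i ∈ Function.periodicPts D.next ∧ D.next i ∈ c :=
  mem_periodicPts_of_chain (hc.2.2.imp fun a b => (resolutionArrow_iff hD a b).1) hi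

/-- If `s < p`, the length of every indecomposable projective module exceeds the period of the
permutation of the vertices. -/
lemma exists_period_lt [Finite (SimpleClass A)] (D : SerialData A (SimpleClass A))
    (h : numSimples A < minProjLength A) (i : SimpleClass A) :
    ∃ t, 0 < t ∧ (∀ j, t < D.c j) ∧ (D.σ ^ t) i = i := by
  have := Fintype.ofFinite (SimpleClass A)
  have hi := D.σ.injective.mem_periodicPts i
  refine ⟨Function.minimalPeriod D.σ i, Function.minimalPeriod_pos_of_mem_periodicPts hi,
    fun j => ?_, ?_⟩
  · have h1 : (Function.minimalPeriod D.σ i : ℕ∞) ≤ numSimples A := by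
      rw [numSimples, ENat.card_eq_coe_fintype_card]
      exact_mod_cast Function.minimalPeriod_le_card
    exact_mod_cast h1.trans_lt (h.trans_le (D.minProjLength_le j))
  · rw [← Equiv.Perm.iterate_eq_pow]
    exact Function.iterate_minimalPeriod

/-- The opposite ring of `A`, as a left module over itself, is the right module `A`. -/
lemma injectiveDimension_op_eq (A : Type u) [Ring A] : injectiveDimension (ModuleCat.of Aᵐᵒᵖ A) =
    injectiveDimension (ModuleCat.of Aᵐᵒᵖ Aᵐᵒᵖ) :=
  injectiveDimension_eq_of_iso (LinearEquiv.toModuleIso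
    ({ opAddEquiv with map_smul' := fun _ _ => rfl } : A ≃ₗ[Aᵐᵒᵖ] Aᵐᵒᵖ))

lemma SerialData.isGorensteinAlgebra [IsArtinianRing A] [IsArtinianRing Aᵐᵒᵖ] {ι : Type w}
    [Finite ι] (D : SerialData A ι) (h : ∀ i ∈ Function.periodicPts D.next, D.Black i) :
    IsGorensteinAlgebra A := by
  rw [IsGorensteinAlgebra, injectiveDimension_op_eq, injectiveDimension_ne_top_iff,
    injectiveDimension_ne_top_iff]
  exact ⟨D.exists_hasInjectiveDimensionLE h,
    D.op.exists_hasInjectiveDimensionLE (D.op_black_of_black h)⟩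

end Quiver

end NakayamaGP

/-! ### The theorem: cycles of the quiver translated into periodic orbits of `next`. -/

theorem proposition5 {R : Type v} [CommRing R] [IsArtinianRing R] {Λ : Type u} [Ring Λ]
    [Algebra R Λ] [Module.Finite R Λ] (hN : NakayamaGP.IsNakayama Λ)
    (hS : NakayamaGP.NoSimpleProjective Λ) :
    (NakayamaGP.numSimples Λ < NakayamaGP.minProjLength Λ →
      (NakayamaGP.IsGorensteinAlgebra Λ ↔
        ∀ c : Cycle (NakayamaGP.SimpleClass Λ), NakayamaGP.IsResolutionCycle R c →
          ∀ S ∈ c, NakayamaGP.IsBlack S) ∧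
      (NakayamaGP.IsCMFree Λ ↔
        ∀ c : Cycle (NakayamaGP.SimpleClass Λ), NakayamaGP.IsResolutionCycle R c →
          ∃ S ∈ c, NakayamaGP.IsRed S)) ∧
    ((∀ c : Cycle (NakayamaGP.SimpleClass Λ), NakayamaGP.IsResolutionCycle R c →
        ∃ S ∈ c, NakayamaGP.IsRed S) → NakayamaGP.IsCMFree Λ) := by
  have hfin : Module.Finite R Λᵐᵒᵖ := Module.Finite.equiv (MulOpposite.opLinearEquiv R)
  have hart : IsArtinianRing Λ := IsArtinianRing.of_finite R Λ
  have hart' : IsArtinianRing Λᵐᵒᵖ := IsArtinianRing.of_finite R Λᵐᵒᵖ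
  have hfinS := NakayamaGP.finite_simpleClass hN.1
  obtain ⟨D, hD⟩ := NakayamaGP.exists_serialData hN hS
  have hfree : (∀ c : Cycle (NakayamaGP.SimpleClass Λ), NakayamaGP.IsResolutionCycle R c →
      ∃ S ∈ c, NakayamaGP.IsRed S) → NakayamaGP.IsCMFree Λ := by
    intro h M _ _ hM
    have := hM.finite
    refine D.projective_of_extVanishes (fun i hi => ?_) hM.extVanishes
    obtain ⟨S, hSc, hred⟩ := h _ (NakayamaGP.isResolutionCycle_periodicOrbit hD hi)
    obtain ⟨k, rfl⟩ := (Function.mem_periodicOrbit_iff hi).1 hSc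
    exact ⟨k, fun hb => hred ((NakayamaGP.isBlack_iff hD _).2 hb)⟩
  refine ⟨fun hp => ⟨⟨fun hG c hc S hSc => ?_, fun h => D.isGorensteinAlgebra fun i hi => ?_⟩,
    fun hCM c hc => ?_, hfree⟩, hfree⟩
  · obtain ⟨n, hn⟩ := (injectiveDimension_ne_top_iff _).1 hG.1
    obtain ⟨t, ht0, ht, hti⟩ := NakayamaGP.exists_period_lt D hp S
    exact (NakayamaGP.isBlack_iff hD S).2
      (D.black_of_hasInjectiveDimensionLE (n := n) (hc.mem_periodicPts hD hSc).1 ht0 ht hti)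
  · exact (NakayamaGP.isBlack_iff hD i).1
      (h _ (NakayamaGP.isResolutionCycle_periodicOrbit hD hi) i
        (Function.self_mem_periodicOrbit hi))
  · by_contra! hcon
    obtain ⟨i, hi⟩ : ∃ i, i ∈ c := by
      induction c with
      | nil => exact absurd rfl hc.1
      | cons a l _ => exact ⟨a, Cycle.mem_coe_iff.2 List.mem_cons_self⟩
    -- A cycle is closed under `next`, so a cycle without red vertices contains an entirely black
    -- orbit.
    have hmem : ∀ k, D.next^[k] i ∈ c := by
      intro k
      induction k with
      | zero => exact hi
      | succ k ih =>
        rw [Function.iterate_succ_apply']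
        exact (hc.mem_periodicPts hD ih).2
    obtain ⟨t, ht0, ht, hti⟩ := NakayamaGP.exists_period_lt D hp i
    obtain ⟨M, _, _, hM, hMp⟩ := D.exists_isGorensteinProjective (hc.mem_periodicPts hD hi).1
      (fun k => (NakayamaGP.isBlack_iff hD _).1 (not_not.1 (hcon _ (hmem k)))) ht0 ht hti
    exact hMp (hCM M hM)
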